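/- For $0<\alpha<1$ and $X=\mathbb{T}$ (the unit circle in $\mathbb{C}$) or $X=\mathbb{R}$, let $\Lambda_\alpha(X)$ be the class of functions $f:X\to\mathbb{C}$ with $$\|f\|_{\Lambda_\alpha}:=\sup_{x\ne y}\frac{|f(x)-f(y)|}{|x-y|^\alpha}<\infty .$$ There is an absolute constant $c>0$ such that the following hold for every $\alpha\in(0,1)$. (i) If $f\in\Lambda_\alpha(\mathbb{T})$, then $$\|f(U)-f(V)\|\le c\,(1-\alpha)^{-1}\|f\|_{\Lambda_\alpha}\|U-V\|^\alpha$$ for all unitary operators $U,V$ on a complex Hilbert space. (ii) If $f\in\Lambda_\alpha(\mathbb{R})$, then $$\|f(A)-f(B)\|\le c\,(1-\alpha)^{-1}\|f\|_{\Lambda_\alpha}\|A-B\|^\alpha$$ for all (not necessarily bounded) self-adjoint operators $A,B$ on a complex Hilbert space whose difference $A-B$ is bounded; in particular $f(A)-f(B)$ is bounded. Here $f(A)=\int f\,dE_A$, where $E_A$ is the spectral measure of $A$. The difference $S-T$ of two densely defined operators is called bounded if $D(T)\subseteq D(S)$ and $Su-Tu=Ku$ for all $u\in D(T)$ and some bounded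 operator $K$ on the whole space; then $\|S-T\|:=\|K\|$. -/

import Mathlib

open scoped NNReal ENNReal InnerProductSpace

/-- A spectral measure on the Borel sets of the real line: a strongly countably additive function
whose values are orthogonal projections of the Hilbert space `H`, with `E(ℝ) = 1`.
(Only the values at Borel sets matter.) -/
structure RealSpectralMeasure (H : Type*) [NormedAddCommGroup H] [InnerProductSpace ℂ H]
    [CompleteSpace H] where
  proj : Set ℝ → H →L[ℂ] H
  isStarProjection : ∀ S, MeasurableSet S → IsStarProjection (proj S)
  proj_univ : proj Set.univ = 1
  hasSum_iUnion : ∀ S : ℕ → Set ℝ, (∀ i, MeasurableSet (S i)) →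
    Pairwise (Function.onFun Disjoint S) →
    ∀ x : H, HasSum (fun i => proj (S i) x) (proj (⋃ i, S i) x)

namespace RealSpectralMeasure

variable {H : Type*} [NormedAddCommGroup H] [InnerProductSpace ℂ H] [CompleteSpace H]

theorem inner_proj_eq (E : RealSpectralMeasure H) {S : Set ℝ} (hS : MeasurableSet S) (x : H) :
    (⟪x, E.proj S x⟫_ℂ).re = ‖E.proj S x‖ ^ 2 := by
  have h := E.isStarProjection S hS
  have h1 : E.proj S (E.proj S x) = E.proj S x := by
    have := congrArg (fun T : H →L[ℂ] H => T x) h.isIdempotentElem.eq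
    simpa using this
  have h2 : ⟪E.proj S x, E.proj S x⟫_ℂ = ⟪x, E.proj S x⟫_ℂ := by
    have h3 : ContinuousLinearMap.adjoint (E.proj S) = E.proj S := h.isSelfAdjoint
    rw [← ContinuousLinearMap.adjoint_inner_right (E.proj S), h3, h1]
  rw [← h2]
  exact inner_self_eq_norm_sq (𝕜 := ℂ) _

theorem proj_empty_apply (E : RealSpectralMeasure H) (x : H) : E.proj ∅ x = 0 := by
  have h := E.hasSum_iUnion (fun _ => ∅) (fun _ => MeasurableSet.empty)
    (fun _ _ _ => by simp [Function.onFun]) x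
  exact tendsto_nhds_unique tendsto_const_nhds h.summable.tendsto_atTop_zero

/-- The scalar spectral measure `S ↦ ⟪x, E(S) x⟫`, a finite positive Borel measure on the line. -/
noncomputable def scalarMeasure (E : RealSpectralMeasure H) (x : H) : MeasureTheory.Measure ℝ :=
  MeasureTheory.Measure.ofMeasurable (fun S _ => ENNReal.ofReal (⟪x, E.proj S x⟫_ℂ).re)
    (by simp [proj_empty_apply])
    (by
      intro S hS hd
      have h1 := (E.hasSum_iUnion S hS hd x).mapL (innerSL ℂ x)
      have h2 : HasSum (fun i => (⟪x, E.proj (S i) x⟫_ℂ).re) (⟪x, E.proj (⋃ i, S i) x⟫_ℂ).re :=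
        Complex.hasSum_re (by simpa using h1)
      rw [← h2.tsum_eq]
      refine ENNReal.ofReal_tsum_of_nonneg (fun i => ?_) h2.summable
      rw [inner_proj_eq E (hS i)]
      positivity)

/-- `E.IsIntegral f T` says that the (possibly unbounded) operator `T` is `∫ f(t) dE(t)`: its domain
consists of the `x` for which `f` is square integrable against `⟪x, E(·) x⟫`, and
`⟪x, T x⟫ = ∫ f(t) d⟪x, E(t) x⟫` on the domain. As `H` is a complex space, polarization shows that
there is at most one such `T` as soon as this domain is dense. -/
def IsIntegral (E : RealSpectralMeasure H) (f : ℝ → ℂ) (T : H →ₗ.[ℂ] H) : Prop :=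
  (∀ x : H, x ∈ T.domain ↔ ∫⁻ t, ‖f t‖ₑ ^ 2 ∂(E.scalarMeasure x) < ∞) ∧
  ∀ x : T.domain, ⟪(x : H), T x⟫_ℂ = ∫ t, f t ∂(E.scalarMeasure (x : H))

end RealSpectralMeasure

/-- `T = f(A)`: there is a spectral measure `E` with `A = ∫ t dE(t)` (the spectral measure of `A`)
and `T = ∫ f(t) dE(t)`. -/
def IsFunctionOfOperator {H : Type*} [NormedAddCommGroup H] [InnerProductSpace ℂ H]
    [CompleteSpace H] (f : ℝ → ℂ) (A T : H →ₗ.[ℂ] H) : Prop :=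
  ∃ E : RealSpectralMeasure H, E.IsIntegral (fun t => (t : ℂ)) A ∧ E.IsIntegral f T

open Classical in
/-- The operator `f(A)` for a (possibly unbounded) self-adjoint operator `A`. For self-adjoint `A`
and continuous `f` the operator exists and is unique, by the spectral theorem. -/
noncomputable def operatorFunction {H : Type*} [NormedAddCommGroup H] [InnerProductSpace ℂ H]
    [CompleteSpace H] (f : ℝ → ℂ) (A : H →ₗ.[ℂ] H) : H →ₗ.[ℂ] H :=
  if h : ∃ T, IsFunctionOfOperator f A T then h.choose else ⊥

/-- The operator `A - B` is bounded and `K` is its continuous extension to the whole space: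
`D(B) ⊆ D(A)` and `A u - B u = K u` for every `u ∈ D(B)`. -/
def IsBoundedDifference {H : Type*} [NormedAddCommGroup H] [InnerProductSpace ℂ H]
    (A B : H →ₗ.[ℂ] H) (K : H →L[ℂ] H) : Prop :=
  B.domain ≤ A.domain ∧
    ∀ (a : A.domain) (b : B.domain), (a : H) = (b : H) → A a - B b = K (b : H)

/-- The operator `f(U)` for a unitary operator `U` and a continuous function `f` on the unit circle
(which contains the spectrum of `U`), by the continuous functional calculus. The extension of `f` by
zero off the circle plays no role. -/
noncomputable def unitaryFunction {H : Type*} [NormedAddCommGroup H] [InnerProductSpace ℂ H]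
    [CompleteSpace H] (f : Circle → ℂ) (U : unitary (H →L[ℂ] H)) : H →L[ℂ] H :=
  cfc (Function.extend (fun z : Circle => (z : ℂ)) f 0) (U : H →L[ℂ] H)

/-! Everything is tested on quadratic forms. For a vector `x`, the form of `f(A) - f(B)` is the
difference of the integrals of `f` against the two scalar spectral measures of `x`, so an estimate
for pairs of finite measures on the line suffices; polarization then costs a factor `2` in the
operator norm.

The analytic input is a Bernstein inequality for the Poisson integral `P_s h` of a bounded function:
the forms of `(P_s h)(A)` and `(P_s h)(B)` differ by at most `‖h‖∞ ‖K‖ / s * ‖x‖²`. Indeed the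
spectral measure of `x` smoothed at height `s` has density `k_A(t) = (s/π) ‖(A - t ∓ is)⁻¹ x‖²`,
which is also a jump of the resolvent. The second resolvent identity and Cauchy-Schwarz give `|k_A -
k_B| ≤ (‖K‖ / 2s)(k_A + k_B)`, and both densities have mass `‖x‖²`
(`RealSpectralMeasure.bernstein`). For unitaries the measures are carried to the line by the
argument; on `2π`-periodic functions `P_s` is the Poisson integral of the disc at radius `e^{-s}`,
and the same argument works with `(e^{it} - e^{-s} U)⁻¹` (`unitary_bernstein`).

The passage from Bernstein to Hölder is `holder_of_bernstein_of_bounded`. Approximating `F` by `P_s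
F` alone would lose a factor `(1 - α)⁻¹` at each scale, because the Poisson kernel decays only like
`t⁻²`. The combinations `c P_s - P_{cs}` have kernels decaying like `t⁻⁴`, so they approximate `(c -
1) F` within `O(s^α)` uniformly in `α`. With `Q_s = 2 P_s - P_{2s}`, the semigroup law writes `Q_s F
- Q_{2s} F` as `P_s` of a function of size `O(s^α)`, and Bernstein gains `‖K‖ / s`. Summing over `s
= 2^k ‖K‖` is a geometric series of ratio `2^{α-1}`, the only source of `(1 - α)⁻¹`.

The rest is spectral theory: integration against a projection-valued measure, the spectral theorem
for unbounded self-adjoint operators (via the bounded normal resolvent), and, in the unbounded case,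
the extension of the estimate from `D(B)` to `D(f(B))` by closedness of `f(A)`. -/

/-! ### Cauchy distributions and their convolution semigroup. -/

section

-- Split at `0`, the integral is a sum of two exponential integrals `1/b - 1/a`, with `ab = -4π²(x²
-- + s²)`.
open MeasureTheory ProbabilityTheory FourierTransform in
theorem fourier_exp_neg_abs (s : ℝ≥0) (hs : s ≠ 0) :
    𝓕 (fun ξ : ℝ => (Real.exp (-(2 * Real.pi * s) * |ξ|) : ℂ)) =
      fun x => (cauchyPDFReal 0 s x : ℂ) := by
  have hs' : (0 : ℝ) < s := by positivity
  have hpi := Real.pi_pos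
  funext x
  rw [Real.fourier_real_eq_integral_exp_smul]
  set a : ℂ := 2 * Real.pi * (-(s : ℝ) - x * Complex.I) with ha
  set b : ℂ := 2 * Real.pi * ((s : ℝ) - x * Complex.I) with hb
  have hare : a.re < 0 := by simp [ha]; positivity
  have hbre : 0 < b.re := by simp [hb]; positivity
  have h1 : Set.EqOn (fun v : ℝ => Complex.exp (((-2 * Real.pi * v * x : ℝ) : ℂ) * Complex.I) •
      (Real.exp (-(2 * Real.pi * s) * |v|) : ℂ)) (fun v : ℝ => Complex.exp (a * v)) (Set.Ioi 0) := by
    intro v hv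
    have hv' : (0 : ℝ) < v := hv
    simp only [smul_eq_mul, abs_of_pos hv', Complex.ofReal_exp, ← Complex.exp_add, ha]
    congr 1
    push_cast
    ring
  have h2 : Set.EqOn (fun v : ℝ => Complex.exp (((-2 * Real.pi * v * x : ℝ) : ℂ) * Complex.I) •
      (Real.exp (-(2 * Real.pi * s) * |v|) : ℂ)) (fun v : ℝ => Complex.exp (b * v)) (Set.Iic 0) := by
    intro v hv
    have hv' : v ≤ 0 := hv
    simp only [smul_eq_mul, abs_of_nonpos hv', Complex.ofReal_exp, ← Complex.exp_add, hb]
    congr 1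
    push_cast
    ring
  have i1 := (integrableOn_exp_mul_complex_Ioi hare 0).congr_fun h1.symm measurableSet_Ioi
  have i2 := (integrableOn_exp_mul_complex_Iic hbre 0).congr_fun h2.symm measurableSet_Iic
  rw [← intervalIntegral.integral_Iic_add_Ioi i2 i1, setIntegral_congr_fun measurableSet_Ioi h1,
    setIntegral_congr_fun measurableSet_Iic h2, integral_exp_mul_complex_Ioi hare,
    integral_exp_mul_complex_Iic hbre]
  have ha0 : a ≠ 0 := fun h => by simp [h] at hare
  have hb0 : b ≠ 0 := fun h => by simp [h] at hbre
  have hq : ((x : ℂ) ^ 2 + (s : ℝ) ^ 2) ≠ 0 := by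
    have : (x ^ 2 + (s : ℝ) ^ 2) ≠ 0 := by positivity
    exact_mod_cast this
  have hpi' : (Real.pi : ℂ) ≠ 0 := by exact_mod_cast hpi.ne'
  simp only [Complex.ofReal_zero, mul_zero, Complex.exp_zero, cauchyPDFReal_def, sub_zero]
  push_cast
  have hab : a * b = -(4 * Real.pi ^ 2 * ((x : ℂ) ^ 2 + (s : ℝ) ^ 2)) := by
    rw [ha, hb]
    ring_nf
    simp only [Complex.I_sq]
    ring
  have : (1 : ℂ) / b + -1 / a = (a - b) / (a * b) := by field_simp; ring
  rw [this, hab, ha, hb]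
  field_simp
  ring

theorem integrable_exp_neg_mul_abs {c : ℝ} (hc : 0 < c) :
    MeasureTheory.Integrable (fun ξ : ℝ => Real.exp (-c * |ξ|)) := by
  rw [← MeasureTheory.integrableOn_univ, ← Set.Iic_union_Ioi (a := (0 : ℝ))]
  refine MeasureTheory.IntegrableOn.union ?_ ?_
  · refine (integrableOn_exp_mul_Iic hc 0).congr_fun (fun v hv => ?_) measurableSet_Iic
    simp [abs_of_nonpos (show v ≤ 0 from hv)]
  · refine (integrableOn_exp_mul_Ioi (a := -c) (by simpa) 0).congr_fun (fun v hv => ?_) measurableSet_Ioi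
    simp [abs_of_pos (show 0 < v from hv)]

open MeasureTheory ProbabilityTheory FourierTransform in
theorem integral_cauchyMeasure {E : Type*} [NormedAddCommGroup E] [NormedSpace ℝ E] (s : ℝ≥0) (hs : s ≠ 0)
    (g : ℝ → E) : ∫ t, g t ∂(cauchyMeasure 0 s) = ∫ t, cauchyPDFReal 0 s t • g t := by
  rw [cauchyMeasure_of_scale_ne_zero _ hs,
    integral_withDensity_eq_integral_toReal_smul (measurable_cauchyPDF _ _) (by simp [cauchyPDF])]
  refine integral_congr_ae (Filter.Eventually.of_forall fun t => ?_)
  simp [cauchyPDF, (cauchyPDF_pos 0 hs t).le]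

open MeasureTheory ProbabilityTheory FourierTransform in
theorem integrable_cauchyMeasure_iff {E : Type*} [NormedAddCommGroup E] [NormedSpace ℝ E]
    (s : ℝ≥0) (hs : s ≠ 0) (g : ℝ → E) :
    Integrable g (cauchyMeasure 0 s) ↔ Integrable (fun t => cauchyPDFReal 0 s t • g t) := by
  rw [cauchyMeasure_of_scale_ne_zero _ hs,
    integrable_withDensity_iff_integrable_smul' (measurable_cauchyPDF _ _) (by simp [cauchyPDF])]
  refine integrable_congr (Filter.Eventually.of_forall fun t => ?_)
  simp [cauchyPDF, (cauchyPDF_pos 0 hs t).le]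

-- Fourier inversion for `exp (-2πs|ξ|)`, which is continuous and integrable with integrable
-- transform; the evaluation at `ξ / 2π` reconciles the two normalisations. Scale `0` is the Dirac
-- mass.
open MeasureTheory ProbabilityTheory FourierTransform in
theorem charFun_cauchyMeasure (s : ℝ≥0) (ξ : ℝ) :
    charFun (cauchyMeasure 0 s) ξ = Real.exp (-s * |ξ|) := by
  rcases eq_or_ne s 0 with rfl | hs
  · simp
  have hs' : (0 : ℝ) < s := by positivity
  have hpi := Real.pi_pos
  have h1 := (Continuous.fourierInv_fourier_eq
    (f := fun ξ : ℝ => (Real.exp (-(2 * Real.pi * s) * |ξ|) : ℂ)) (by fun_prop)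
    (integrable_exp_neg_mul_abs (by positivity)).ofReal
    (by rw [fourier_exp_neg_abs s hs]; exact (integrable_cauchyPDFReal 0).ofReal))
  rw [fourier_exp_neg_abs s hs] at h1
  have h2 := congrFun h1 (ξ / (2 * Real.pi))
  rw [Real.fourierInv_eq'] at h2
  rw [charFun_apply_real, integral_cauchyMeasure s hs]
  convert h2 using 1
  · congr 1
    ext v
    simp only [smul_eq_mul, Complex.real_smul]
    rw [mul_comm]
    congr 2
    simp
    field_simp
  · rw [abs_div, abs_of_pos (by positivity : 0 < 2 * Real.pi)]
    congr 2
    field_simp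

-- The exponents of the characteristic functions add. This is the semigroup law of Poisson
-- integrals.
open MeasureTheory ProbabilityTheory in
theorem cauchyMeasure_conv (a b : ℝ≥0) :
    (cauchyMeasure 0 a) ∗ (cauchyMeasure 0 b) = cauchyMeasure 0 (a + b) := by
  refine Measure.ext_of_charFun ?_
  ext ξ
  rw [charFun_conv, charFun_cauchyMeasure, charFun_cauchyMeasure, charFun_cauchyMeasure,
    ← Complex.ofReal_mul, ← Real.exp_add]
  congr 2
  push_cast
  ring

end

/-! ### Poisson integrals, and the Hölder estimate deduced from a Bernstein inequality. -/

section

open MeasureTheory ProbabilityTheory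

/-- The Poisson integral of `F` at height `s`, i.e. the average of the translates of `F` with
respect to the Cauchy distribution of scale `s`. -/
noncomputable def poissonIntegral (s : ℝ≥0) (F : ℝ → ℂ) (x : ℝ) : ℂ :=
  ∫ t, F (x + t) ∂(cauchyMeasure 0 s)

theorem integrable_of_bounded {μ : Measure ℝ} [IsFiniteMeasure μ] {F : ℝ → ℂ} (hF : Continuous F)
    {M : ℝ} (hM : ∀ x, ‖F x‖ ≤ M) : Integrable F μ :=
  Integrable.of_bound hF.aestronglyMeasurable M (Filter.Eventually.of_forall hM)

theorem integral_mul_sub_sub_mul {μ : Measure ℝ} {f g h : ℝ → ℂ} (hf : Integrable f μ)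
    (hg : Integrable g μ) (hh : Integrable h μ) (a b : ℂ) :
    ∫ x, (a * f x - g x - b * h x) ∂μ = a * ∫ x, f x ∂μ - ∫ x, g x ∂μ - b * ∫ x, h x ∂μ := by
  have h1 : Integrable (fun x => a * f x) μ := hf.const_mul a
  have h2 : Integrable (fun x => a * f x - g x) μ := h1.sub hg
  rw [integral_sub h2 (hh.const_mul b), integral_sub h1 hg, integral_const_mul, integral_const_mul]

theorem norm_poissonIntegral_le (s : ℝ≥0) {F : ℝ → ℂ} {M : ℝ} (hM : ∀ x, ‖F x‖ ≤ M) (x : ℝ) :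
    ‖poissonIntegral s F x‖ ≤ M := by
  have := norm_integral_le_of_norm_le_const (μ := cauchyMeasure 0 s) (f := fun t => F (x + t))
    (Filter.Eventually.of_forall fun t => hM (x + t))
  simpa [poissonIntegral] using this

theorem continuous_poissonIntegral (s : ℝ≥0) {F : ℝ → ℂ} (hF : Continuous F) {M : ℝ}
    (hM : ∀ x, ‖F x‖ ≤ M) : Continuous (poissonIntegral s F) := by
  refine continuous_of_dominated (bound := fun _ => M) (fun x => ?_) (fun x => ?_)
    (integrable_const _) ?_
  · exact (hF.comp (continuous_const.add continuous_id)).aestronglyMeasurable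
  · exact Filter.Eventually.of_forall fun t => hM _
  · exact Filter.Eventually.of_forall fun t => hF.comp (continuous_id.add continuous_const)

theorem periodic_poissonIntegral (s : ℝ≥0) {F : ℝ → ℂ} {p : ℝ} (hp : Function.Periodic F p) :
    Function.Periodic (poissonIntegral s F) p := fun x => by
  unfold poissonIntegral
  congr 1
  ext t
  rw [add_right_comm, hp]

theorem poissonIntegral_add (a b : ℝ≥0) {F : ℝ → ℂ} (hF : Continuous F) {M : ℝ}
    (hM : ∀ x, ‖F x‖ ≤ M) :
    poissonIntegral a (poissonIntegral b F) = poissonIntegral (a + b) F := by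
  ext x
  unfold poissonIntegral
  rw [← cauchyMeasure_conv, integral_conv]
  · simp only [add_assoc]
  · exact integrable_of_bounded (hF.comp (continuous_const.add continuous_id)) (fun t => hM _)

theorem rpow_le_one_add_sq {u α : ℝ} (hu : 0 ≤ u) (h0 : 0 ≤ α) (h1 : α ≤ 1) :
    u ^ α ≤ 1 + u ^ 2 := by
  rcases le_total u 1 with h | h
  · have := Real.rpow_le_one hu h h0
    nlinarith [sq_nonneg u]
  · have := Real.rpow_le_rpow_of_exponent_le h h1
    rw [Real.rpow_one] at this
    nlinarith

/-- Trades `|t|^α` for quadratic growth, which a kernel of decay `t⁻⁴` integrates with a constant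
free of `α`. -/
theorem abs_rpow_le {s t α : ℝ} (hs : 0 < s) (h0 : 0 ≤ α) (h1 : α ≤ 1) :
    |t| ^ α ≤ s ^ α * (1 + t ^ 2 / s ^ 2) := by
  have h := rpow_le_one_add_sq (u := |t| / s) (by positivity) h0 h1
  rw [Real.div_rpow (abs_nonneg t) hs.le, div_pow, sq_abs] at h
  have hp : 0 < s ^ α := Real.rpow_pos_of_pos hs α
  calc |t| ^ α = s ^ α * (|t| ^ α / s ^ α) := by field_simp
    _ ≤ _ := by gcongr

/-- The kernel `c p_s - p_{cs}` of Poisson kernels is positive and decays like `|t| ^ (-4)`. -/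
theorem cauchyPDFReal_combination_bounds (c s : ℝ≥0) (hc : 1 ≤ c) (hs : s ≠ 0) (t : ℝ) :
    0 ≤ c * cauchyPDFReal 0 s t - cauchyPDFReal 0 (c * s) t ∧
    (c * cauchyPDFReal 0 s t - cauchyPDFReal 0 (c * s) t) * (1 + t ^ 2 / (s : ℝ) ^ 2) ≤
      (c * cauchyPDFReal 0 s t - cauchyPDFReal 0 (c * s) t) +
        c * (c ^ 2 - 1) * cauchyPDFReal 0 s t := by
  have hs' : (0 : ℝ) < s := by positivity
  have hc' : (1 : ℝ) ≤ c := by exact_mod_cast hc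
  have hpi := Real.pi_pos
  have hc2 : (0 : ℝ) ≤ c ^ 2 - 1 := by nlinarith
  -- The leading `t⁻²` terms cancel: `cs(t² + c²s²) - cs(t² + s²) = c(c² - 1)s³`.
  have key : (c * cauchyPDFReal 0 s t - cauchyPDFReal 0 (c * s) t : ℝ) =
      Real.pi⁻¹ * (c * (c ^ 2 - 1) * s ^ 3) * (t ^ 2 + s ^ 2)⁻¹ * (t ^ 2 + (c * s) ^ 2)⁻¹ := by
    simp only [cauchyPDFReal_def, sub_zero]
    push_cast
    field_simp
    ring
  rw [key]
  refine ⟨by positivity, ?_⟩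
  rw [mul_add, mul_one]
  refine add_le_add le_rfl ?_
  simp only [cauchyPDFReal_def, sub_zero]
  have : Real.pi⁻¹ * (c * (c ^ 2 - 1) * s ^ 3) * (t ^ 2 + s ^ 2)⁻¹ * (t ^ 2 + (c * s) ^ 2)⁻¹ *
      (t ^ 2 / s ^ 2) = c * (c ^ 2 - 1) * (Real.pi⁻¹ * s * (t ^ 2 + (s : ℝ) ^ 2)⁻¹) *
        (t ^ 2 / (t ^ 2 + (c * s) ^ 2)) := by
    field_simp
  rw [this]
  refine mul_le_of_le_one_right (by positivity) ?_
  rw [div_le_one (by positivity)]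
  nlinarith [sq_nonneg ((c : ℝ) * s)]

/-- The kernel `c p_s - p_{cs}` is positive of mass `c - 1`, so the left side is its integral
against `F(x + t) - F(x)`. The increment is at most `C s^α (1 + t²/s²)`, and the weighted kernel has
mass at most `c - 1 + c(c² - 1)`. The constant stays bounded as `α → 1`. -/
theorem norm_poissonIntegral_combination_le (c s : ℝ≥0) (hc : 1 ≤ c) (hs : s ≠ 0) {F : ℝ → ℂ}
    (hF : Continuous F) {M : ℝ} (hM : ∀ x, ‖F x‖ ≤ M) {C α : ℝ} (h0 : 0 ≤ α) (h1 : α ≤ 1)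
    (hC : 0 ≤ C) (hH : ∀ x y, ‖F x - F y‖ ≤ C * |x - y| ^ α) (x : ℝ) :
    ‖c * poissonIntegral s F x - poissonIntegral (c * s) F x - (c - 1) * F x‖ ≤
      (c - 1 + c * (c ^ 2 - 1)) * C * (s : ℝ) ^ α := by
  have hs' : (0 : ℝ) < s := by positivity
  have hc' : (1 : ℝ) ≤ c := by exact_mod_cast hc
  have hc0 : c ≠ 0 := (zero_lt_one.trans_le hc).ne'
  have hcs : c * s ≠ 0 := mul_ne_zero hc0 hs
  have hFx : Continuous fun t => F (x + t) - F x := by fun_prop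
  have hFb : ∀ t, ‖F (x + t) - F x‖ ≤ M + M := fun t => (norm_sub_le _ _).trans
    (add_le_add (hM _) (hM _))
  have e1 : ∀ r : ℝ≥0, poissonIntegral r F x - F x =
      ∫ t, (F (x + t) - F x) ∂(cauchyMeasure 0 r) := fun r => by
    rw [integral_sub (integrable_of_bounded (by fun_prop) (fun t => hM (x + t)))
      (integrable_const _)]
    simp [poissonIntegral]
  have i1 := (integrable_cauchyMeasure_iff s hs _).1
    (integrable_of_bounded (μ := cauchyMeasure 0 s) hFx hFb)
  have i1' : Integrable (fun t => (c : ℝ) • cauchyPDFReal 0 s t • (F (x + t) - F x)) := i1.smul (c : ℝ)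
  have i2 := (integrable_cauchyMeasure_iff (c * s) hcs _).1
    (integrable_of_bounded (μ := cauchyMeasure 0 (c * s)) hFx hFb)
  have e2 : c * poissonIntegral s F x - poissonIntegral (c * s) F x - (c - 1) * F x =
      ∫ t, (c * cauchyPDFReal 0 s t - cauchyPDFReal 0 (c * s) t : ℝ) • (F (x + t) - F x) := by
    have : c * poissonIntegral s F x - poissonIntegral (c * s) F x - (c - 1) * F x =
        (c : ℝ) • (poissonIntegral s F x - F x) - (poissonIntegral (c * s) F x - F x) := by
      simp only [Complex.real_smul]
      ring
    rw [this, e1, e1, integral_cauchyMeasure s hs, integral_cauchyMeasure (c * s) hcs,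
      ← integral_smul, ← integral_sub i1' i2]
    congr 1
    ext t
    rw [sub_smul, smul_smul]
  rw [e2]
  have hi : Integrable (fun t => C * (s : ℝ) ^ α * ((c * cauchyPDFReal 0 s t -
      cauchyPDFReal 0 (c * s) t) + c * (c ^ 2 - 1) * cauchyPDFReal 0 s t)) := by fun_prop
  refine (norm_integral_le_of_norm_le hi (Filter.Eventually.of_forall fun t => ?_)).trans
    (le_of_eq ?_)
  · obtain ⟨k1, k2⟩ := cauchyPDFReal_combination_bounds c s hc hs t
    rw [norm_smul, Real.norm_of_nonneg k1]
    have h3 : ‖F (x + t) - F x‖ ≤ C * ((s : ℝ) ^ α * (1 + t ^ 2 / (s : ℝ) ^ 2)) := by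
      refine (hH _ _).trans ?_
      rw [add_sub_cancel_left]
      exact mul_le_mul_of_nonneg_left (abs_rpow_le hs' h0 h1) hC
    calc _ ≤ _ := mul_le_mul_of_nonneg_left h3 k1
      _ = C * (s : ℝ) ^ α * ((c * cauchyPDFReal 0 s t - cauchyPDFReal 0 (c * s) t) *
          (1 + t ^ 2 / (s : ℝ) ^ 2)) := by ring
      _ ≤ _ := by gcongr
  · rw [integral_const_mul, integral_add (by fun_prop) (by fun_prop),
      integral_sub (by fun_prop) (by fun_prop), integral_const_mul, integral_const_mul,
      integral_cauchyPDFReal_eq_one 0 hs, integral_cauchyPDFReal_eq_one 0 hcs]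
    ring

/-- Convexity of `exp` between `0` and `-log 2` gives `2^{α-1} ≤ α + (1 - α)/2`. This bounds the
geometric series by `2(1 - α)⁻¹`. -/
theorem one_sub_two_rpow_ge {α : ℝ} (h0 : 0 ≤ α) (h1 : α ≤ 1) :
    (1 - α) / 2 ≤ 1 - (2 : ℝ) ^ (α - 1) := by
  have h := convexOn_exp.2 (Set.mem_univ 0) (Set.mem_univ (-Real.log 2)) h0 (by linarith : 0 ≤ 1 - α)
    (by ring)
  simp only [smul_eq_mul, mul_zero, zero_add, Real.exp_zero, mul_one, Real.exp_neg,
    Real.exp_log (by norm_num : (0 : ℝ) < 2)] at h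
  rw [Real.rpow_def_of_pos (by norm_num)]
  have : Real.log 2 * (α - 1) = (1 - α) * -Real.log 2 := by ring
  rw [this]
  linarith

/-- If the Poisson integrals of bounded functions satisfy a Bernstein inequality for the pair
`μ, ν`, then bounded Hölder functions satisfy the corresponding Hölder estimate. -/
theorem holder_of_bernstein_of_bounded {μ ν : Measure ℝ} [IsFiniteMeasure μ] [IsFiniteMeasure ν]
    {m p : ℝ} (hμ : μ.real Set.univ ≤ m) (hν : ν.real Set.univ ≤ m) {κ : ℝ≥0} (hκ : κ ≠ 0)
    (hB : ∀ h : ℝ → ℂ, Continuous h → Function.Periodic h p → ∀ M : ℝ, (∀ x, ‖h x‖ ≤ M) →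
      ∀ s : ℝ≥0, s ≠ 0 →
        ‖∫ x, poissonIntegral s h x ∂μ - ∫ x, poissonIntegral s h x ∂ν‖ ≤ M / s * κ * m)
    {F : ℝ → ℂ} (hF : Continuous F) (hp : Function.Periodic F p) {M : ℝ} (hM : ∀ x, ‖F x‖ ≤ M)
    {C α : ℝ} (h0 : 0 ≤ α) (h1 : α < 1) (hC : 0 ≤ C)
    (hH : ∀ x y, ‖F x - F y‖ ≤ C * |x - y| ^ α) :
    ‖∫ x, F x ∂μ - ∫ x, F x ∂ν‖ ≤ 66 * (1 - α)⁻¹ * C * (κ : ℝ) ^ α * m := by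
  have hκ' : (0 : ℝ) < κ := by positivity
  have hm : 0 ≤ m := measureReal_nonneg.trans hμ
  have hM0 : 0 ≤ M := (norm_nonneg _).trans (hM 0)
  have hcP : ∀ s, Continuous (poissonIntegral s F) := fun s => continuous_poissonIntegral s hF hM
  have hbP : ∀ s x, ‖poissonIntegral s F x‖ ≤ M := fun s => norm_poissonIntegral_le s hM
  have iFμ : Integrable F μ := integrable_of_bounded hF hM
  have iFν : Integrable F ν := integrable_of_bounded hF hM
  have iPμ : ∀ s, Integrable (poissonIntegral s F) μ := fun s => integrable_of_bounded (hcP s) (hbP s)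
  have iPν : ∀ s, Integrable (poissonIntegral s F) ν := fun s => integrable_of_bounded (hcP s) (hbP s)
  set lam : ℝ≥0 → ℂ := fun s => ∫ x, poissonIntegral s F x ∂μ - ∫ x, poissonIntegral s F x ∂ν
    with hlam
  set q : ℝ≥0 → ℂ := fun s => 2 * lam s - lam (2 * s) with hq
  -- The combination with `c = 2` has constant `1 + 2·3 = 7`, used once for each measure.
  have step0 : ‖(∫ x, F x ∂μ - ∫ x, F x ∂ν) - q κ‖ ≤ 14 * C * (κ : ℝ) ^ α * m := by
    have hpt : ∀ x, ‖2 * poissonIntegral κ F x - poissonIntegral (2 * κ) F x - F x‖ ≤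
        7 * C * (κ : ℝ) ^ α := fun x => by
      have := norm_poissonIntegral_combination_le 2 κ (by norm_num) hκ hF hM h0 h1.le hC hH x
      norm_num at this ⊢
      convert this using 3
    have e : ∀ {ρ : Measure ℝ} [IsFiniteMeasure ρ], ρ.real Set.univ ≤ m →
        ‖2 * ∫ x, poissonIntegral κ F x ∂ρ - ∫ x, poissonIntegral (2 * κ) F x ∂ρ - ∫ x, F x ∂ρ‖ ≤
          7 * C * (κ : ℝ) ^ α * m := by
      intro ρ _ hρ
      have j := fun s => integrable_of_bounded (μ := ρ) (hcP s) (hbP s)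
      have jF := integrable_of_bounded (μ := ρ) hF hM
      have e0 := integral_mul_sub_sub_mul (j κ) (j (2 * κ)) jF 2 1
      simp only [one_mul] at e0
      rw [← e0]
      refine (norm_integral_le_of_norm_le_const (Filter.Eventually.of_forall hpt)).trans ?_
      gcongr
    have e1 := e hμ
    have e2 := e hν
    calc _ = ‖(2 * ∫ x, poissonIntegral κ F x ∂ν - ∫ x, poissonIntegral (2 * κ) F x ∂ν - ∫ x, F x ∂ν)
        - (2 * ∫ x, poissonIntegral κ F x ∂μ - ∫ x, poissonIntegral (2 * κ) F x ∂μ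
          - ∫ x, F x ∂μ)‖ := by
          simp only [hq, hlam]
          congr 1
          ring
      _ ≤ _ := norm_sub_le _ _
      _ ≤ _ := add_le_add e2 e1
      _ = _ := by ring
  -- By the semigroup law, `q s - q (2s) = 2λ(s) - 3λ(2s) + λ(4s)` is minus the difference of the
  -- integrals of `P_s h` for `h = 3 P_s F - P_{3s} F - 2F`. The combination with `c = 3` bounds `h`
  -- by `(2 + 3·8) C s^α`, and Bernstein contributes `κ / s`.
  have step1 : ∀ s : ℝ≥0, s ≠ 0 → ‖q s - q (2 * s)‖ ≤ 26 * C * (s : ℝ) ^ (α - 1) * κ * m := by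
    intro s hs
    have hs' : (0 : ℝ) < s := by positivity
    set h : ℝ → ℂ := fun x => 3 * poissonIntegral s F x - poissonIntegral (3 * s) F x - 2 * F x
      with hh
    have hhc : Continuous h := by
      have := hcP s; have := hcP (3 * s); fun_prop
    have hhp : Function.Periodic h p := fun x => by
      simp only [hh, periodic_poissonIntegral _ hp x, hp x]
    have hpt : ∀ x, ‖h x‖ ≤ 26 * C * (s : ℝ) ^ α := fun x => by
      have := norm_poissonIntegral_combination_le 3 s (by norm_num) hs hF hM h0 h1.le hC hH x
      norm_num at this ⊢
      convert this using 4
    have hPh : ∀ x, poissonIntegral s h x = 3 * poissonIntegral (2 * s) F x -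
        poissonIntegral (4 * s) F x - 2 * poissonIntegral s F x := by
      intro x
      have j : ∀ r, Integrable (fun t => poissonIntegral r F (x + t)) (cauchyMeasure 0 s) :=
        fun r => integrable_of_bounded ((hcP r).comp (continuous_const.add continuous_id))
          (fun t => hbP r _)
      have jF : Integrable (fun t => F (x + t)) (cauchyMeasure 0 s) :=
        integrable_of_bounded (hF.comp (continuous_const.add continuous_id)) (fun t => hM _)
      have a1 := congrFun (poissonIntegral_add s s hF hM) x
      have a2 := congrFun (poissonIntegral_add s (3 * s) hF hM) x
      rw [show s + s = 2 * s by ring] at a1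
      rw [show s + 3 * s = 4 * s by ring] at a2
      rw [← a1, ← a2]
      simp only [poissonIntegral, hh] at j ⊢
      exact integral_mul_sub_sub_mul (j s) (j _) jF 3 2
    have hb := hB h hhc hhp _ hpt s hs
    have eint : ∀ {ρ : Measure ℝ} [IsFiniteMeasure ρ], ∫ x, poissonIntegral s h x ∂ρ =
        3 * ∫ x, poissonIntegral (2 * s) F x ∂ρ - ∫ x, poissonIntegral (4 * s) F x ∂ρ -
          2 * ∫ x, poissonIntegral s F x ∂ρ := by
      intro ρ _
      have j := fun s => integrable_of_bounded (μ := ρ) (hcP s) (hbP s)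
      simp_rw [hPh]
      exact integral_mul_sub_sub_mul (j _) (j _) (j _) 3 2
    rw [eint, eint] at hb
    rw [← norm_neg]
    convert hb using 1
    · simp only [hq, hlam, ← mul_assoc, show (2 : ℝ≥0) * 2 = 4 by norm_num]
      congr 1
      ring
    · rw [Real.rpow_sub_one hs'.ne']
      ring
  have hθ0 : (0 : ℝ) < 2 ^ (α - 1) := Real.rpow_pos_of_pos (by norm_num) _
  have hθ1 := one_sub_two_rpow_ge h0 h1.le
  have hθ : (2 : ℝ) ^ (α - 1) < 1 := by linarith
  -- Telescoping over the scales `2^k κ`, where the factor `s^{α-1} κ` becomes `κ^α (2^{α-1})^k`.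
  have step2 : ∀ N : ℕ, ‖q κ - q (2 ^ N * κ)‖ ≤
      ∑ k ∈ Finset.range N, 26 * C * (κ : ℝ) ^ α * m * ((2 : ℝ) ^ (α - 1)) ^ k := by
    intro N
    induction N with
    | zero => simp
    | succ N ih =>
      rw [Finset.sum_range_succ]
      have hne : (2 : ℝ≥0) ^ N * κ ≠ 0 := by positivity
      have h3 := step1 (2 ^ N * κ) hne
      have : q κ - q (2 ^ (N + 1) * κ) =
          (q κ - q (2 ^ N * κ)) + (q (2 ^ N * κ) - q (2 * (2 ^ N * κ))) := by
        rw [show (2 : ℝ≥0) * (2 ^ N * κ) = 2 ^ (N + 1) * κ by ring]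
        ring
      rw [this]
      refine (norm_add_le _ _).trans (add_le_add ih (h3.trans (le_of_eq ?_)))
      push_cast
      rw [Real.mul_rpow (by positivity) hκ'.le, ← Real.rpow_natCast_mul (by norm_num),
        mul_comm (N : ℝ), Real.rpow_mul_natCast (by norm_num), Real.rpow_sub_one hκ'.ne']
      field_simp
  -- Boundedness of `F` enters quantitatively only here: Bernstein for `F` itself makes the
  -- remainder `q (2^N κ)` at most `(2 + 1/2) M m 2^{-N}`. The bound `M` disappears as `N → ∞`.
  have step3 : ∀ N : ℕ, ‖q κ‖ ≤ 26 * C * (κ : ℝ) ^ α * m * (1 - (2 : ℝ) ^ (α - 1))⁻¹ +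
      3 * M * m * (1 / 2) ^ N := by
    intro N
    have hne : (2 : ℝ≥0) ^ N * κ ≠ 0 := by positivity
    have t1 : ∀ s : ℝ≥0, s ≠ 0 → ‖lam s‖ ≤ M / s * κ * m := fun s hs => hB F hF hp M hM s hs
    have t2 : ‖q (2 ^ N * κ)‖ ≤ 3 * M * m * (1 / 2) ^ N := by
      have a1 := t1 _ hne
      have a2 := t1 (2 * (2 ^ N * κ)) (by positivity)
      have a3 : M / ((2 ^ N * κ : ℝ≥0) : ℝ) * κ * m = M * m * (1 / 2) ^ N := by
        push_cast
        rw [one_div, inv_pow]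
        field_simp
      have a4 : M / ((2 * (2 ^ N * κ) : ℝ≥0) : ℝ) * κ * m = M * m * (1 / 2) ^ N / 2 := by
        push_cast
        rw [one_div, inv_pow]
        field_simp
      rw [a3] at a1
      rw [a4] at a2
      have a5 : 0 ≤ M * m * (1 / 2) ^ N := by positivity
      calc _ ≤ ‖2 * lam (2 ^ N * κ)‖ + ‖lam (2 * (2 ^ N * κ))‖ := norm_sub_le _ _
        _ ≤ 2 * (M * m * (1 / 2) ^ N) + M * m * (1 / 2) ^ N / 2 := by
          rw [norm_mul, Complex.norm_ofNat]
          gcongr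
        _ ≤ _ := by linarith
    have t3 : ∑ k ∈ Finset.range N, 26 * C * (κ : ℝ) ^ α * m * ((2 : ℝ) ^ (α - 1)) ^ k ≤
        26 * C * (κ : ℝ) ^ α * m * (1 - (2 : ℝ) ^ (α - 1))⁻¹ := by
      rw [← Finset.mul_sum]
      refine mul_le_mul_of_nonneg_left ?_ (by positivity)
      rw [← tsum_geometric_of_lt_one hθ0.le hθ]
      exact (summable_geometric_of_lt_one hθ0.le hθ).sum_le_tsum _ (fun _ _ => by positivity)
    calc ‖q κ‖ = ‖(q κ - q (2 ^ N * κ)) + q (2 ^ N * κ)‖ := by rw [sub_add_cancel]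
      _ ≤ _ := norm_add_le _ _
      _ ≤ _ := add_le_add ((step2 N).trans t3) t2
  have step4 : ‖q κ‖ ≤ 26 * C * (κ : ℝ) ^ α * m * (1 - (2 : ℝ) ^ (α - 1))⁻¹ := by
    refine ge_of_tendsto' (f := fun N : ℕ => 26 * C * (κ : ℝ) ^ α * m *
      (1 - (2 : ℝ) ^ (α - 1))⁻¹ + 3 * M * m * (1 / 2) ^ N) (x := Filter.atTop) ?_ step3
    have := ((tendsto_pow_atTop_nhds_zero_of_lt_one (by norm_num : (0 : ℝ) ≤ 1 / 2)
      (by norm_num)).const_mul (3 * M * m)).const_add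
        (26 * C * (κ : ℝ) ^ α * m * (1 - (2 : ℝ) ^ (α - 1))⁻¹)
    simpa using this
  have h1α : 0 < 1 - α := by linarith
  have hinv : (1 - (2 : ℝ) ^ (α - 1))⁻¹ ≤ 2 * (1 - α)⁻¹ := by
    calc _ ≤ ((1 - α) / 2)⁻¹ := inv_anti₀ (by positivity) hθ1
      _ = _ := by rw [inv_div]; ring
  have hinv1 : 1 ≤ (1 - α)⁻¹ := (one_le_inv₀ h1α).2 (by linarith)
  have hCk : 0 ≤ C * (κ : ℝ) ^ α * m := by positivity
  calc ‖∫ x, F x ∂μ - ∫ x, F x ∂ν‖ = ‖((∫ x, F x ∂μ - ∫ x, F x ∂ν) - q κ) + q κ‖ := by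
        rw [sub_add_cancel]
    _ ≤ 14 * C * (κ : ℝ) ^ α * m +
        26 * C * (κ : ℝ) ^ α * m * (1 - (2 : ℝ) ^ (α - 1))⁻¹ :=
        (norm_add_le _ _).trans (add_le_add step0 step4)
    -- Since `1 ≤ (1 - α)⁻¹`, the total constant is `14 + 2·26 = 66`.
    _ ≤ 14 * (C * (κ : ℝ) ^ α * m) * (1 - α)⁻¹ +
        26 * (C * (κ : ℝ) ^ α * m) * (2 * (1 - α)⁻¹) := by
        refine add_le_add ?_ ?_
        · nlinarith
        · have := mul_le_mul_of_nonneg_left hinv hCk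
          nlinarith
    _ = _ := by ring

end

/-! ### Truncation, to reach unbounded Hölder functions. -/

section

open MeasureTheory ProbabilityTheory

/-- Truncation of a complex number to the square `[-M, M] × [-M, M]`. -/
noncomputable def Complex.clip (M : ℝ) (z : ℂ) : ℂ :=
  ⟨max (-M) (min z.re M), max (-M) (min z.im M)⟩

theorem abs_max_min_sub_le (M a b : ℝ) :
    |max (-M) (min a M) - max (-M) (min b M)| ≤ |a - b| := by
  refine (abs_max_sub_max_le_max _ _ _ _).trans ?_
  simp only [sub_self, abs_zero]
  refine max_le (abs_nonneg _) ((abs_min_sub_min_le_max _ _ _ _).trans ?_)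
  simp

/-- Each coordinate is clamped to an interval, which is `1`-Lipschitz. Hence truncation does not
increase Hölder constants. -/
theorem Complex.norm_clip_sub_clip_le (M : ℝ) (z w : ℂ) :
    ‖Complex.clip M z - Complex.clip M w‖ ≤ ‖z - w‖ := by
  rw [← sq_le_sq₀ (norm_nonneg _) (norm_nonneg _), ← Complex.normSq_eq_norm_sq,
    ← Complex.normSq_eq_norm_sq, Complex.normSq_apply, Complex.normSq_apply]
  have h1 := sq_le_sq.2 (abs_max_min_sub_le M z.re w.re)
  have h2 := sq_le_sq.2 (abs_max_min_sub_le M z.im w.im)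
  simp only [Complex.clip, Complex.sub_re, Complex.sub_im]
  nlinarith

theorem Complex.norm_clip_le {M : ℝ} (hM : 0 ≤ M) (z : ℂ) : ‖Complex.clip M z‖ ≤ M + M := by
  refine (Complex.norm_le_abs_re_add_abs_im _).trans (add_le_add ?_ ?_) <;>
  · simp only [Complex.clip]
    exact abs_le.2 ⟨le_max_left _ _, max_le (by linarith) (min_le_right _ _)⟩

theorem Complex.clip_eq_self {M : ℝ} {z : ℂ} (hz : ‖z‖ ≤ M) : Complex.clip M z = z := by
  have h1 := abs_le.1 ((Complex.abs_re_le_norm z).trans hz)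
  have h2 := abs_le.1 ((Complex.abs_im_le_norm z).trans hz)
  simp only [Complex.clip, min_eq_left h1.2, min_eq_left h2.2, max_eq_right h1.1, max_eq_right h2.1]

theorem Complex.norm_clip_le_norm {M : ℝ} (hM : 0 ≤ M) (z : ℂ) : ‖Complex.clip M z‖ ≤ ‖z‖ := by
  have := Complex.norm_clip_sub_clip_le M z 0
  rwa [Complex.clip_eq_self (z := 0) (by simpa), sub_zero, sub_zero] at this

theorem Complex.continuous_clip (M : ℝ) : Continuous (Complex.clip M) :=
  (LipschitzWith.of_dist_le_mul (K := 1) fun z w => by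
    simpa [dist_eq_norm] using Complex.norm_clip_sub_clip_le M z w).continuous

theorem continuous_of_holder {F : ℝ → ℂ} {C α : ℝ} (h0 : 0 < α)
    (hH : ∀ x y, ‖F x - F y‖ ≤ C * |x - y| ^ α) : Continuous F := by
  refine continuous_iff_continuousAt.2 fun x => ?_
  rw [ContinuousAt, tendsto_iff_norm_sub_tendsto_zero]
  have h1 : Filter.Tendsto (fun y : ℝ => C * |y - x| ^ α) (nhds x) (nhds 0) := by
    have : Continuous fun y : ℝ => C * |y - x| ^ α :=
      continuous_const.mul ((by fun_prop : Continuous fun y : ℝ => |y - x|).rpow_const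
        fun _ => Or.inr h0.le)
    have h2 := this.tendsto x
    simpa [Real.zero_rpow h0.ne'] using h2
  exact squeeze_zero (fun _ => norm_nonneg _) (fun y => hH y x) h1

theorem tendsto_integral_clip {μ : Measure ℝ} {F : ℝ → ℂ} (hF : Integrable F μ) :
    Filter.Tendsto (fun N : ℕ => ∫ x, Complex.clip N (F x) ∂μ) Filter.atTop
      (nhds (∫ x, F x ∂μ)) := by
  refine tendsto_integral_of_dominated_convergence (fun x => ‖F x‖) (fun N => ?_) hF.norm
    (fun N => Filter.Eventually.of_forall fun x => Complex.norm_clip_le_norm N.cast_nonneg _)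
    (Filter.Eventually.of_forall fun x => ?_)
  · exact (Complex.continuous_clip _).comp_aestronglyMeasurable hF.1
  · refine tendsto_const_nhds.congr' ?_
    obtain ⟨N₀, hN₀⟩ := exists_nat_ge ‖F x‖
    filter_upwards [Filter.eventually_ge_atTop N₀] with N hN
    exact (Complex.clip_eq_self (hN₀.trans (by exact_mod_cast hN))).symm

/-- If the Poisson integrals of bounded functions satisfy a Bernstein inequality for the pair
`μ, ν`, then Hölder functions satisfy the corresponding Hölder estimate. -/
theorem holder_of_bernstein_of_ne_zero {μ ν : Measure ℝ} [IsFiniteMeasure μ] [IsFiniteMeasure ν]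
    {m p : ℝ} (hμ : μ.real Set.univ ≤ m) (hν : ν.real Set.univ ≤ m) {κ : ℝ≥0} (hκ : κ ≠ 0)
    (hB : ∀ h : ℝ → ℂ, Continuous h → Function.Periodic h p → ∀ M : ℝ, (∀ x, ‖h x‖ ≤ M) →
      ∀ s : ℝ≥0, s ≠ 0 →
        ‖∫ x, poissonIntegral s h x ∂μ - ∫ x, poissonIntegral s h x ∂ν‖ ≤ M / s * κ * m)
    {F : ℝ → ℂ} (hp : Function.Periodic F p) (iμ : Integrable F μ) (iν : Integrable F ν)
    {C α : ℝ} (h0 : 0 < α) (h1 : α < 1) (hC : 0 ≤ C)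
    (hH : ∀ x y, ‖F x - F y‖ ≤ C * |x - y| ^ α) :
    ‖∫ x, F x ∂μ - ∫ x, F x ∂ν‖ ≤ 66 * (1 - α)⁻¹ * C * (κ : ℝ) ^ α * m := by
  have hF := continuous_of_holder h0 hH
  -- The bounded estimate does not involve the supremum of the function, so it survives removal of
  -- the truncation.
  refine le_of_tendsto' ((tendsto_integral_clip iμ).sub (tendsto_integral_clip iν)).norm
    fun N => ?_
  exact holder_of_bernstein_of_bounded hμ hν hκ hB ((Complex.continuous_clip N).comp hF)
    (fun x => by simp only [Function.comp_apply, hp x])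
    (fun x => Complex.norm_clip_le N.cast_nonneg _) h0.le h1 hC
    (fun x y => (Complex.norm_clip_sub_clip_le _ _ _).trans (hH x y))

end

/-! ### Algebra of spectral measures and integrals of simple functions. -/

section

open MeasureTheory

section QuadraticForm

variable {H : Type*} [NormedAddCommGroup H] [InnerProductSpace ℂ H]

/-- Complex polarization. It reduces many operator identities below to identities between scalar
measures. -/
theorem ContinuousLinearMap.ext_inner_self {T T' : H →L[ℂ] H}
    (h : ∀ x, ⟪x, T x⟫_ℂ = ⟪x, T' x⟫_ℂ) : T = T' := by
  have : (T : H →ₗ[ℂ] H) = T' := (ext_inner_map _ _).1 fun x => by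
    have := congrArg (starRingEnd ℂ) (h x)
    rwa [inner_conj_symm, inner_conj_symm] at this
  ext x
  exact congrArg (fun L : H →ₗ[ℂ] H => L x) this

end QuadraticForm

namespace RealSpectralMeasure

variable {H : Type*} [NormedAddCommGroup H] [InnerProductSpace ℂ H] [CompleteSpace H]
variable (E : RealSpectralMeasure H)

theorem scalarMeasure_apply (x : H) {S : Set ℝ} (hS : MeasurableSet S) :
    E.scalarMeasure x S = ENNReal.ofReal (‖E.proj S x‖ ^ 2) := by
  rw [scalarMeasure, Measure.ofMeasurable_apply _ hS, inner_proj_eq E hS]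

instance isFiniteMeasure_scalarMeasure (x : H) : IsFiniteMeasure (E.scalarMeasure x) :=
  ⟨by rw [scalarMeasure_apply _ _ MeasurableSet.univ]; exact ENNReal.ofReal_lt_top⟩

theorem scalarMeasure_real (x : H) {S : Set ℝ} (hS : MeasurableSet S) :
    (E.scalarMeasure x).real S = ‖E.proj S x‖ ^ 2 := by
  rw [Measure.real, scalarMeasure_apply _ _ hS, ENNReal.toReal_ofReal (by positivity)]

theorem scalarMeasure_real_univ (x : H) : (E.scalarMeasure x).real Set.univ = ‖x‖ ^ 2 := by
  rw [scalarMeasure_real _ _ MeasurableSet.univ, E.proj_univ, one_apply_eq_self]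

theorem proj_proj {S : Set ℝ} (hS : MeasurableSet S) (x : H) :
    E.proj S (E.proj S x) = E.proj S x := by
  have := congrArg (fun T : H →L[ℂ] H => T x) (E.isStarProjection S hS).isIdempotentElem.eq
  simpa using this

theorem inner_proj_left {S : Set ℝ} (hS : MeasurableSet S) (x y : H) :
    ⟪E.proj S x, y⟫_ℂ = ⟪x, E.proj S y⟫_ℂ := by
  have h3 : ContinuousLinearMap.adjoint (E.proj S) = E.proj S := (E.isStarProjection S hS).isSelfAdjoint
  rw [← ContinuousLinearMap.adjoint_inner_right, h3]

theorem inner_proj {S : Set ℝ} (hS : MeasurableSet S) (x : H) :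
    ⟪x, E.proj S x⟫_ℂ = ((E.scalarMeasure x).real S : ℂ) := by
  rw [scalarMeasure_real _ _ hS, ← E.proj_proj hS x, ← E.inner_proj_left hS, E.proj_proj hS,
    inner_self_eq_norm_sq_to_K]
  norm_cast

theorem norm_proj_le {S : Set ℝ} (hS : MeasurableSet S) (x : H) : ‖E.proj S x‖ ≤ ‖x‖ := by
  have := measureReal_mono (μ := E.scalarMeasure x) (Set.subset_univ S)
  rw [scalarMeasure_real _ _ hS, scalarMeasure_real_univ] at this
  exact (sq_le_sq₀ (norm_nonneg _) (norm_nonneg _)).1 this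

theorem proj_union {S T : Set ℝ} (hS : MeasurableSet S) (hT : MeasurableSet T) (h : Disjoint S T) :
    E.proj (S ∪ T) = E.proj S + E.proj T := by
  refine ContinuousLinearMap.ext_inner_self fun x => ?_
  rw [add_apply, inner_add_right, inner_proj _ hS, inner_proj _ hT,
    inner_proj _ (hS.union hT), measureReal_union h hT]
  push_cast
  rfl

/-- For `y` in the range of `E(T)`, additivity gives `‖E(S ∪ T) y‖² = ‖E(S) y‖² + ‖y‖²`, while the
left side is at most `‖y‖²`. -/
theorem proj_proj_of_disjoint {S T : Set ℝ} (hS : MeasurableSet S) (hT : MeasurableSet T)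
    (h : Disjoint S T) (x : H) : E.proj S (E.proj T x) = 0 := by
  set y := E.proj T x with hy
  have hTy : E.proj T y = y := E.proj_proj hT x
  have h1 := measureReal_union (μ := E.scalarMeasure y) h hT
  rw [scalarMeasure_real _ _ hS, scalarMeasure_real _ _ hT,
    scalarMeasure_real _ _ (hS.union hT), hTy] at h1
  have h2 := E.norm_proj_le (hS.union hT) y
  have h3 : ‖E.proj S y‖ ^ 2 ≤ 0 := by nlinarith [norm_nonneg (E.proj (S ∪ T) y), norm_nonneg y]
  have h4 : ‖E.proj S y‖ ^ 2 = 0 := le_antisymm h3 (by positivity)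
  simpa using h4

theorem proj_inter {S T : Set ℝ} (hS : MeasurableSet S) (hT : MeasurableSet T) (x : H) :
    E.proj S (E.proj T x) = E.proj (S ∩ T) x := by
  have h1 : E.proj S = E.proj (S ∩ T) + E.proj (S \ T) := by
    rw [← E.proj_union (hS.inter hT) (hS.diff hT) Set.disjoint_sdiff_inter.symm,
      Set.inter_union_sdiff]
  have h2 : E.proj T = E.proj (S ∩ T) + E.proj (T \ S) := by
    rw [← E.proj_union (hS.inter hT) (hT.diff hS)
      (by rw [Set.inter_comm]; exact Set.disjoint_sdiff_inter.symm), Set.inter_comm,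
      Set.inter_union_sdiff]
  rw [h1, add_apply,
    E.proj_proj_of_disjoint (hS.diff hT) hT Set.disjoint_sdiff_left, add_zero, h2,
    add_apply, map_add, E.proj_proj (hS.inter hT),
    E.proj_proj_of_disjoint (hS.inter hT) (hT.diff hS)
      (Set.disjoint_sdiff_right.mono_left Set.inter_subset_left), add_zero]

/-- From the parallelogram law; it makes the domain of `∫ f dE` closed under addition. -/
theorem scalarMeasure_add_le (x y : H) :
    E.scalarMeasure (x + y) ≤ (2 : ℝ≥0) • (E.scalarMeasure x + E.scalarMeasure y) := by
  refine Measure.le_iff.2 fun S hS => ?_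
  rw [Measure.smul_apply, Measure.add_apply, scalarMeasure_apply _ _ hS, scalarMeasure_apply _ _ hS,
    scalarMeasure_apply _ _ hS, ← ENNReal.ofReal_add (by positivity) (by positivity),
    ENNReal.smul_def, smul_eq_mul, ← ENNReal.ofReal_coe_nnreal, ← ENNReal.ofReal_mul (by positivity)]
  refine ENNReal.ofReal_le_ofReal ?_
  have h := parallelogram_law_with_norm ℂ (E.proj S x) (E.proj S y)
  rw [map_add]
  push_cast
  nlinarith [sq_nonneg ‖E.proj S x - E.proj S y‖]

theorem scalarMeasure_smul (c : ℂ) (x : H) :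
    E.scalarMeasure (c • x) = (‖c‖₊ ^ 2) • E.scalarMeasure x := by
  refine Measure.ext fun S hS => ?_
  rw [Measure.smul_apply, scalarMeasure_apply _ _ hS, scalarMeasure_apply _ _ hS,
    ENNReal.smul_def, smul_eq_mul, ← ENNReal.ofReal_coe_nnreal, ← ENNReal.ofReal_mul (by positivity),
    map_smul, norm_smul, mul_pow]
  rfl

/-- The integral of a simple function against a spectral measure. -/
noncomputable def simpleIntegral (g : SimpleFunc ℝ ℂ) : H →L[ℂ] H :=
  ∑ c ∈ g.range, c • E.proj (g ⁻¹' {c})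

theorem integrable_simpleFunc (μ : Measure ℝ) [IsFiniteMeasure μ] (g : SimpleFunc ℝ ℂ) :
    Integrable g μ := SimpleFunc.integrable_of_isFiniteMeasure g

theorem inner_simpleIntegral (g : SimpleFunc ℝ ℂ) (x : H) :
    ⟪x, E.simpleIntegral g x⟫_ℂ = ∫ t, g t ∂(E.scalarMeasure x) := by
  rw [← SimpleFunc.integral_eq_integral _ (integrable_simpleFunc _ g), SimpleFunc.integral_eq,
    simpleIntegral, sum_apply, inner_sum]
  refine Finset.sum_congr rfl fun c _ => ?_
  rw [smul_apply, inner_smul_right, inner_proj _ (g.measurableSet_preimage _),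
    Complex.real_smul, mul_comm]

/-- Checked on quadratic forms, where it is additivity of the scalar integral; no common refinement
of level sets is needed. -/
theorem simpleIntegral_add (g h : SimpleFunc ℝ ℂ) :
    E.simpleIntegral (g + h) = E.simpleIntegral g + E.simpleIntegral h := by
  refine ContinuousLinearMap.ext_inner_self fun x => ?_
  rw [add_apply, inner_add_right, inner_simpleIntegral, inner_simpleIntegral,
    inner_simpleIntegral, ← integral_add (integrable_simpleFunc _ g) (integrable_simpleFunc _ h)]
  rfl

theorem simpleIntegral_smul (c : ℂ) (g : SimpleFunc ℝ ℂ) :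
    E.simpleIntegral (c • g) = c • E.simpleIntegral g := by
  refine ContinuousLinearMap.ext_inner_self fun x => ?_
  rw [smul_apply, inner_smul_right, inner_simpleIntegral, inner_simpleIntegral,
    ← integral_const_mul]
  rfl

theorem simpleIntegral_sub (g h : SimpleFunc ℝ ℂ) :
    E.simpleIntegral (g - h) = E.simpleIntegral g - E.simpleIntegral h := by
  have : g - h = g + (-1 : ℂ) • h := by ext t; simp [sub_eq_add_neg]
  rw [this, simpleIntegral_add, simpleIntegral_smul, neg_one_smul, sub_eq_add_neg]

theorem simpleIntegral_conj (g : SimpleFunc ℝ ℂ) :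
    E.simpleIntegral (g.map (starRingEnd ℂ)) = ContinuousLinearMap.adjoint (E.simpleIntegral g) := by
  refine ContinuousLinearMap.ext_inner_self fun x => ?_
  rw [ContinuousLinearMap.adjoint_inner_right, ← inner_conj_symm (E.simpleIntegral g x),
    inner_simpleIntegral, inner_simpleIntegral, ← integral_conj]
  rfl

theorem simpleIntegral_indicator {S : Set ℝ} (hS : MeasurableSet S) (c : ℂ) :
    E.simpleIntegral ((SimpleFunc.const ℝ c).piecewise S hS (SimpleFunc.const ℝ 0)) =
      c • E.proj S := by
  refine ContinuousLinearMap.ext_inner_self fun x => ?_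
  rw [inner_simpleIntegral, smul_apply, inner_smul_right, inner_proj _ hS]
  have : ((SimpleFunc.const ℝ c).piecewise S hS (SimpleFunc.const ℝ 0) : ℝ → ℂ) =
      S.indicator fun _ => c := by
    ext t; simp [SimpleFunc.coe_piecewise, Set.indicator, Set.piecewise]
  rw [this, integral_indicator_const _ hS, Complex.real_smul, mul_comm]

/-- By bilinearity only indicators matter, where it is `E(S) E(T) = E(S ∩ T)`. -/
theorem simpleIntegral_mul (g h : SimpleFunc ℝ ℂ) :
    E.simpleIntegral (g * h) = E.simpleIntegral g * E.simpleIntegral h := by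
  induction g using SimpleFunc.induction with
  | const c hS =>
    rename_i S
    induction h using SimpleFunc.induction with
    | const d hT =>
      rename_i T
      have e : (SimpleFunc.const ℝ c).piecewise S hS (SimpleFunc.const ℝ 0) *
          (SimpleFunc.const ℝ d).piecewise T hT (SimpleFunc.const ℝ 0) =
          (SimpleFunc.const ℝ (c * d)).piecewise (S ∩ T) (hS.inter hT) (SimpleFunc.const ℝ 0) := by
        ext t
        by_cases h1 : t ∈ S <;> by_cases h2 : t ∈ T <;> simp [SimpleFunc.coe_piecewise, h1, h2]
      rw [e, simpleIntegral_indicator, simpleIntegral_indicator, simpleIntegral_indicator]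
      ext x
      simp [E.proj_inter hS hT, smul_smul, mul_comm]
    | add _ h1 h2 =>
      rw [mul_add, simpleIntegral_add, simpleIntegral_add, h1, h2, mul_add]
  | add _ h1 h2 =>
    rw [add_mul, simpleIntegral_add, simpleIntegral_add, h1, h2, add_mul]

/-- Multiplicativity and the adjoint formula turn the squared norm into the form of `∫ |g|² dE`.
This isometry drives the extension to `L²`. -/
theorem enorm_simpleIntegral (g : SimpleFunc ℝ ℂ) (x : H) :
    ‖E.simpleIntegral g x‖ₑ = eLpNorm g 2 (E.scalarMeasure x) := by
  have h1 : ((‖E.simpleIntegral g x‖ ^ 2 : ℝ) : ℂ) =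
      ((∫ t, ‖g t‖ ^ 2 ∂(E.scalarMeasure x) : ℝ) : ℂ) := by
    have : ⟪E.simpleIntegral g x, E.simpleIntegral g x⟫_ℂ =
        ∫ t, (g.map (starRingEnd ℂ) * g) t ∂(E.scalarMeasure x) := by
      rw [← inner_simpleIntegral, simpleIntegral_mul, simpleIntegral_conj,
        mul_apply_eq_comp, ContinuousLinearMap.adjoint_inner_right]
    rw [inner_self_eq_norm_sq_to_K] at this
    rw [← integral_complex_ofReal]
    push_cast
    refine this.trans (integral_congr_ae (Filter.Eventually.of_forall fun t => ?_))
    simp [Complex.conj_mul']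
  have h2 : ‖E.simpleIntegral g x‖ ^ 2 = ∫ t, ‖g t‖ ^ 2 ∂(E.scalarMeasure x) := by
    exact_mod_cast h1
  have hm : MemLp g 2 (E.scalarMeasure x) := SimpleFunc.memLp_of_isFiniteMeasure g _ _
  rw [hm.eLpNorm_eq_integral_rpow_norm (by norm_num) (by norm_num)]
  simp only [ENNReal.toReal_ofNat, Real.rpow_ofNat]
  rw [← h2, ← ofReal_norm]
  congr 1
  exact_mod_cast (Real.pow_rpow_inv_natCast (norm_nonneg _) two_ne_zero).symm

end RealSpectralMeasure

end

/-! ### Integrals of measurable, possibly unbounded functions. -/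

section

open MeasureTheory Filter Topology

theorem eLpNorm_two_sq (μ : Measure ℝ) (f : ℝ → ℂ) :
    eLpNorm f 2 μ ^ 2 = ∫⁻ t, ‖f t‖ₑ ^ 2 ∂μ := by
  rw [eLpNorm_eq_lintegral_rpow_enorm_toReal (by norm_num) (by norm_num)]
  simp only [ENNReal.toReal_ofNat, ENNReal.rpow_ofNat]
  rw [← ENNReal.rpow_natCast, ← ENNReal.rpow_mul]
  norm_num

theorem memLp_two_iff_lintegral {μ : Measure ℝ} {f : ℝ → ℂ} (hf : Measurable f) :
    MemLp f 2 μ ↔ ∫⁻ t, ‖f t‖ₑ ^ 2 ∂μ < ∞ := by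
  rw [← eLpNorm_two_sq]
  simp [MemLp, hf.aestronglyMeasurable, ENNReal.pow_lt_top_iff]

/-- Simple functions approximating a measurable function. -/
noncomputable def simpleApprox (f : ℝ → ℂ) (hf : Measurable f) (n : ℕ) : SimpleFunc ℝ ℂ :=
  SimpleFunc.approxOn f hf (Set.range f ∪ {0}) 0 (by simp) n

theorem tendsto_eLpNorm_simpleApprox {μ : Measure ℝ} {f : ℝ → ℂ} (hf : Measurable f)
    (h : MemLp f 2 μ) :
    Tendsto (fun n => eLpNorm (⇑(simpleApprox f hf n) - f) 2 μ) atTop (𝓝 0) :=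
  SimpleFunc.tendsto_approxOn_range_Lp_eLpNorm (by norm_num) hf h.2

namespace RealSpectralMeasure

variable {H : Type*} [NormedAddCommGroup H] [InnerProductSpace ℂ H] [CompleteSpace H]
variable (E : RealSpectralMeasure H)

theorem edist_simpleIntegral (g h : SimpleFunc ℝ ℂ) (x : H) :
    edist (E.simpleIntegral g x) (E.simpleIntegral h x) =
      eLpNorm (⇑g - ⇑h) 2 (E.scalarMeasure x) := by
  rw [edist_eq_enorm_sub, ← sub_apply, ← simpleIntegral_sub, enorm_simpleIntegral]
  rfl

theorem edist_simpleIntegral_le {f : ℝ → ℂ} (hf : Measurable f) (g h : SimpleFunc ℝ ℂ) (x : H) :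
    edist (E.simpleIntegral g x) (E.simpleIntegral h x) ≤
      eLpNorm (⇑g - f) 2 (E.scalarMeasure x) + eLpNorm (⇑h - f) 2 (E.scalarMeasure x) := by
  rw [edist_simpleIntegral, eLpNorm_sub_comm ⇑h f, ← sub_add_sub_cancel (⇑g) f ⇑h]
  exact eLpNorm_add_le (g.measurable.sub hf).aestronglyMeasurable
    (hf.sub h.measurable).aestronglyMeasurable (by norm_num)

/-- The value at `x` of the operator `∫ f(t) dE(t)`, characterised by `tendsto_simpleIntegral`. -/
noncomputable def vectorIntegral (f : ℝ → ℂ) (x : H) : H :=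
  Classical.epsilon fun v => ∀ g : ℕ → SimpleFunc ℝ ℂ,
    Tendsto (fun n => eLpNorm (⇑(g n) - f) 2 (E.scalarMeasure x)) atTop (𝓝 0) →
      Tendsto (fun n => E.simpleIntegral (g n) x) atTop (𝓝 v)

theorem tendsto_simpleIntegral {f : ℝ → ℂ} (hf : Measurable f) {x : H}
    {g : ℕ → SimpleFunc ℝ ℂ}
    (hg : Tendsto (fun n => eLpNorm (⇑(g n) - f) 2 (E.scalarMeasure x)) atTop (𝓝 0)) :
    Tendsto (fun n => E.simpleIntegral (g n) x) atTop (𝓝 (E.vectorIntegral f x)) := by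
  have hc : CauchySeq fun n => E.simpleIntegral (g n) x := by
    rw [EMetric.cauchySeq_iff]
    intro ε hε
    have hε2 : 0 < ε / 2 := ENNReal.half_pos hε.ne'
    obtain ⟨N, hN⟩ := (hg.eventually_lt_const hε2).exists_forall_of_atTop
    refine ⟨N, fun m hm n hn => (E.edist_simpleIntegral_le hf _ _ x).trans_lt ?_⟩
    calc _ < ε / 2 + ε / 2 := ENNReal.add_lt_add (hN m hm) (hN n hn)
      _ = ε := ENNReal.add_halves ε
  obtain ⟨v, hv⟩ := cauchySeq_tendsto_of_complete hc
  -- The limit is the same for every approximating sequence, so the vector picked by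
  -- `Classical.epsilon` has the required property.
  have hex : ∃ v, ∀ g : ℕ → SimpleFunc ℝ ℂ,
      Tendsto (fun n => eLpNorm (⇑(g n) - f) 2 (E.scalarMeasure x)) atTop (𝓝 0) →
        Tendsto (fun n => E.simpleIntegral (g n) x) atTop (𝓝 v) := by
    refine ⟨v, fun g' hg' => ?_⟩
    refine hv.congr_dist ?_
    have h1 : Tendsto (fun n => edist (E.simpleIntegral (g n) x) (E.simpleIntegral (g' n) x))
        atTop (𝓝 0) :=
      tendsto_of_tendsto_of_tendsto_of_le_of_le tendsto_const_nhds (by simpa using hg.add hg')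
        (fun _ => zero_le) fun n => E.edist_simpleIntegral_le hf _ _ x
    simpa [Function.comp_def, ← dist_edist] using
      (ENNReal.tendsto_toReal ENNReal.zero_ne_top).comp h1
  exact Classical.epsilon_spec hex g hg

theorem vectorIntegral_simpleFunc (g : SimpleFunc ℝ ℂ) (x : H) :
    E.vectorIntegral g x = E.simpleIntegral g x :=
  tendsto_nhds_unique (E.tendsto_simpleIntegral g.measurable (g := fun _ => g) (by simp))
    tendsto_const_nhds

theorem vectorIntegral_add {f g : ℝ → ℂ} (hf : Measurable f) (hg : Measurable g) {x : H}
    (hfx : MemLp f 2 (E.scalarMeasure x)) (hgx : MemLp g 2 (E.scalarMeasure x)) :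
    E.vectorIntegral (f + g) x = E.vectorIntegral f x + E.vectorIntegral g x := by
  have h1 := tendsto_eLpNorm_simpleApprox hf hfx
  have h2 := tendsto_eLpNorm_simpleApprox hg hgx
  have h3 := (E.tendsto_simpleIntegral hf h1).add (E.tendsto_simpleIntegral hg h2)
  simp only [← add_apply, ← simpleIntegral_add] at h3
  refine tendsto_nhds_unique (E.tendsto_simpleIntegral (hf.add hg) ?_) h3
  refine tendsto_of_tendsto_of_tendsto_of_le_of_le tendsto_const_nhds
    (by simpa using h1.add h2) (fun _ => zero_le) fun n => ?_
  dsimp only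
  rw [SimpleFunc.coe_add, add_sub_add_comm]
  exact eLpNorm_add_le ((SimpleFunc.measurable _).sub hf).aestronglyMeasurable
    ((SimpleFunc.measurable _).sub hg).aestronglyMeasurable (by norm_num)

/-- A simple function is bounded, so multiplication by it preserves `L²` approximation. -/
theorem vectorIntegral_simpleFunc_mul (g : SimpleFunc ℝ ℂ) {f : ℝ → ℂ} (hf : Measurable f) {x : H}
    (hfx : MemLp f 2 (E.scalarMeasure x)) :
    E.vectorIntegral (⇑g * f) x = E.simpleIntegral g (E.vectorIntegral f x) := by
  have h1 := tendsto_eLpNorm_simpleApprox hf hfx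
  have h3 := ((E.simpleIntegral g).continuous.tendsto _).comp (E.tendsto_simpleIntegral hf h1)
  simp only [Function.comp_def, ← mul_apply_eq_comp, ← simpleIntegral_mul] at h3
  refine tendsto_nhds_unique (E.tendsto_simpleIntegral (g.measurable.mul hf) ?_) h3
  obtain ⟨C, hC⟩ := g.exists_forall_norm_le
  have hC0 : 0 ≤ C := (norm_nonneg _).trans (hC 0)
  have h4 : Tendsto (fun n => C.toNNReal • eLpNorm
      (⇑(simpleApprox f hf n) - f) 2 (E.scalarMeasure x))
      atTop (𝓝 0) := by
    have := ENNReal.Tendsto.const_mul (a := (C.toNNReal : ℝ≥0∞)) h1 (Or.inr ENNReal.coe_ne_top)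
    simpa [ENNReal.smul_def] using this
  refine tendsto_of_tendsto_of_tendsto_of_le_of_le tendsto_const_nhds h4 (fun _ => zero_le)
    fun n => ?_
  dsimp only
  rw [SimpleFunc.coe_mul, ← mul_sub]
  refine eLpNorm_le_nnreal_smul_eLpNorm_of_ae_le_mul (Eventually.of_forall fun t => ?_) 2
  rw [Pi.mul_apply, nnnorm_mul]
  gcongr
  rw [← NNReal.coe_le_coe, Real.coe_toNNReal _ hC0]
  exact hC t

theorem vectorIntegral_const_mul (c : ℂ) {f : ℝ → ℂ} (hf : Measurable f) {x : H}
    (hfx : MemLp f 2 (E.scalarMeasure x)) :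
    E.vectorIntegral (fun t => c * f t) x = c • E.vectorIntegral f x := by
  have h := E.vectorIntegral_simpleFunc_mul (SimpleFunc.const ℝ c) hf hfx
  have h2 : E.simpleIntegral (SimpleFunc.const ℝ c) = c • 1 := by
    refine ContinuousLinearMap.ext_inner_self fun y => ?_
    rw [inner_simpleIntegral]
    simp [scalarMeasure_real_univ, inner_self_eq_norm_sq_to_K, mul_comm]
  rw [h2] at h
  exact h

theorem vectorIntegral_sub {f g : ℝ → ℂ} (hf : Measurable f) (hg : Measurable g) {x : H}
    (hfx : MemLp f 2 (E.scalarMeasure x)) (hgx : MemLp g 2 (E.scalarMeasure x)) :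
    E.vectorIntegral (f - g) x = E.vectorIntegral f x - E.vectorIntegral g x := by
  have h1 : f - g = f + fun t => (-1) * g t := by ext t; simp [sub_eq_add_neg]
  rw [h1, vectorIntegral_add _ hf (by fun_prop) hfx (hgx.const_mul _),
    vectorIntegral_const_mul _ _ hg hgx, neg_one_smul, sub_eq_add_neg]

theorem enorm_vectorIntegral {f : ℝ → ℂ} (hf : Measurable f) {x : H}
    (hfx : MemLp f 2 (E.scalarMeasure x)) :
    ‖E.vectorIntegral f x‖ₑ = eLpNorm f 2 (E.scalarMeasure x) := by
  have h1 := tendsto_eLpNorm_simpleApprox hf hfx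
  have h2 := (E.tendsto_simpleIntegral hf h1).enorm
  simp only [enorm_simpleIntegral] at h2
  have mg := fun n => (simpleApprox f hf n).measurable
  refine le_antisymm (le_of_tendsto_of_tendsto' h2
    (by simpa using tendsto_const_nhds.add h1) fun n => ?_)
    (le_of_tendsto_of_tendsto' tendsto_const_nhds (by simpa using h2.add h1) fun n => ?_)
  · have := eLpNorm_add_le hf.aestronglyMeasurable ((mg n).sub hf).aestronglyMeasurable
      (μ := E.scalarMeasure x) (p := 2) (by norm_num)
    rwa [add_sub_cancel] at this
  · rw [eLpNorm_sub_comm]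
    have := eLpNorm_add_le (mg n).aestronglyMeasurable (hf.sub (mg n)).aestronglyMeasurable
      (μ := E.scalarMeasure x) (p := 2) (by norm_num)
    rwa [add_sub_cancel] at this

/-- The scalar measure is finite, so `L²` convergence of the approximants implies `L¹` convergence.
-/
theorem inner_vectorIntegral {f : ℝ → ℂ} (hf : Measurable f) {x : H}
    (hfx : MemLp f 2 (E.scalarMeasure x)) :
    ⟪x, E.vectorIntegral f x⟫_ℂ = ∫ t, f t ∂(E.scalarMeasure x) := by
  have h1 := tendsto_eLpNorm_simpleApprox hf hfx
  have h2 := (tendsto_const_nhds (x := x)).inner (𝕜 := ℂ) (E.tendsto_simpleIntegral hf h1)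
  simp only [inner_simpleIntegral] at h2
  refine tendsto_nhds_unique h2 (tendsto_integral_of_L1' f hf.aestronglyMeasurable
    (Eventually.of_forall fun n => integrable_simpleFunc _ _) ?_)
  have h3 := ENNReal.Tendsto.mul_const (b := E.scalarMeasure x Set.univ ^
    (1 / (1 : ℝ≥0∞).toReal - 1 / (2 : ℝ≥0∞).toReal)) h1
    (Or.inr (ENNReal.rpow_ne_top_of_nonneg (by norm_num) (measure_ne_top _ _)))
  rw [zero_mul] at h3
  exact tendsto_of_tendsto_of_tendsto_of_le_of_le tendsto_const_nhds h3 (fun _ => zero_le)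
    fun n => eLpNorm_le_eLpNorm_mul_rpow_measure_univ (by norm_num)
      ((SimpleFunc.measurable _).sub hf).aestronglyMeasurable

theorem enorm_vectorIntegral_sq {f : ℝ → ℂ} (hf : Measurable f) {x : H}
    (hfx : MemLp f 2 (E.scalarMeasure x)) :
    ‖E.vectorIntegral f x‖ₑ ^ 2 = ∫⁻ t, ‖f t‖ₑ ^ 2 ∂(E.scalarMeasure x) := by
  rw [enorm_vectorIntegral _ hf hfx, eLpNorm_two_sq]

/-- `E(S)` applied to `∫ f dE x` is `∫ 1_S f dE x`, whose squared norm is the integral of `|f|²`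
over `S`. -/
theorem scalarMeasure_vectorIntegral {f : ℝ → ℂ} (hf : Measurable f) {x : H}
    (hfx : MemLp f 2 (E.scalarMeasure x)) :
    E.scalarMeasure (E.vectorIntegral f x) =
      (E.scalarMeasure x).withDensity (fun t => ‖f t‖ₑ ^ 2) := by
  refine Measure.ext fun S hS => ?_
  have h1 := E.vectorIntegral_simpleFunc_mul
    ((SimpleFunc.const ℝ 1).piecewise S hS (SimpleFunc.const ℝ 0)) hf hfx
  rw [simpleIntegral_indicator, one_smul] at h1
  have e : ⇑((SimpleFunc.const ℝ (1 : ℂ)).piecewise S hS (SimpleFunc.const ℝ 0)) * f =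
      S.indicator f := by
    ext t; by_cases ht : t ∈ S <;> simp [SimpleFunc.coe_piecewise, ht]
  rw [e] at h1
  rw [withDensity_apply _ hS, scalarMeasure_apply _ _ hS, ← h1, ENNReal.ofReal_pow (norm_nonneg _),
    ofReal_norm, enorm_vectorIntegral_sq _ (hf.indicator hS) (hfx.indicator hS),
    ← lintegral_indicator hS]
  congr 1
  ext t
  by_cases ht : t ∈ S <;> simp [ht]

theorem eLpNorm_scalarMeasure_vectorIntegral {f g : ℝ → ℂ} (hf : Measurable f) (hg : Measurable g)
    {x : H} (hgx : MemLp g 2 (E.scalarMeasure x)) :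
    eLpNorm f 2 (E.scalarMeasure (E.vectorIntegral g x)) =
      eLpNorm (f * g) 2 (E.scalarMeasure x) := by
  refine (ENNReal.pow_right_strictMono two_ne_zero).injective ?_
  rw [eLpNorm_two_sq, eLpNorm_two_sq, scalarMeasure_vectorIntegral _ hg hgx,
    lintegral_withDensity_eq_lintegral_mul _ (by fun_prop) (by fun_prop)]
  refine lintegral_congr fun t => ?_
  simp [mul_pow, mul_comm]

/-- Simple functions `k` approach `f` in `L²` of the new scalar measure `|g|² μ_x` exactly when `k
g` approaches `f g` in `L²(μ_x)`. -/
theorem vectorIntegral_vectorIntegral {f g : ℝ → ℂ} (hf : Measurable f) (hg : Measurable g)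
    {x : H} (hgx : MemLp g 2 (E.scalarMeasure x)) (hfg : MemLp (f * g) 2 (E.scalarMeasure x)) :
    E.vectorIntegral f (E.vectorIntegral g x) = E.vectorIntegral (f * g) x := by
  have hfy : MemLp f 2 (E.scalarMeasure (E.vectorIntegral g x)) :=
    ⟨hf.aestronglyMeasurable, by
      rw [eLpNorm_scalarMeasure_vectorIntegral _ hf hg hgx]; exact hfg.2⟩
  have h1 := tendsto_eLpNorm_simpleApprox hf hfy
  have h2 := E.tendsto_simpleIntegral hf h1
  refine tendsto_nhds_unique h2 ?_
  rw [tendsto_iff_edist_tendsto_0]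
  convert h1 using 2 with n
  set k := simpleApprox f hf n
  have hk : MemLp (⇑k * g) 2 (E.scalarMeasure x) := by
    obtain ⟨C, hC⟩ := k.exists_forall_norm_le
    exact hgx.of_le_mul (k.measurable.mul hg).aestronglyMeasurable (c := C)
      (Eventually.of_forall fun t => by
        rw [Pi.mul_apply, norm_mul]; exact mul_le_mul_of_nonneg_right (hC t) (norm_nonneg _))
  rw [← vectorIntegral_simpleFunc_mul _ _ hg hgx, edist_eq_enorm_sub,
    ← vectorIntegral_sub _ (k.measurable.mul hg) (hf.mul hg) hk hfg,
    enorm_vectorIntegral _ ((k.measurable.mul hg).sub (hf.mul hg)) (hk.sub hfg), ← sub_mul,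
    eLpNorm_scalarMeasure_vectorIntegral _ (k.measurable.sub hf) hg hgx]

theorem inner_vectorIntegral_conj {f : ℝ → ℂ} (hf : Measurable f) {x y : H}
    (hfx : MemLp f 2 (E.scalarMeasure x)) (hfy : MemLp f 2 (E.scalarMeasure y)) :
    ⟪E.vectorIntegral (fun t => starRingEnd ℂ (f t)) x, y⟫_ℂ = ⟪x, E.vectorIntegral f y⟫_ℂ := by
  have h1 := tendsto_eLpNorm_simpleApprox hf hfx
  have h2 := tendsto_eLpNorm_simpleApprox hf hfy
  have h3 := (tendsto_const_nhds (x := x)).inner (𝕜 := ℂ) (E.tendsto_simpleIntegral hf h2)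
  have hc : Measurable fun t => starRingEnd ℂ (f t) := by
    exact Complex.continuous_conj.measurable.comp hf
  have h4 := (E.tendsto_simpleIntegral hc (x := x) (g := fun n =>
    (simpleApprox f hf n).map (starRingEnd ℂ)) (by
      convert h1 using 2 with n
      refine eLpNorm_congr_norm_ae (Eventually.of_forall fun t => ?_)
      simp [← map_sub])).inner (𝕜 := ℂ) (tendsto_const_nhds (x := y))
  simp only [simpleIntegral_conj, ContinuousLinearMap.adjoint_inner_left] at h4
  exact tendsto_nhds_unique h4 h3

theorem memLp_add {f : ℝ → ℂ} (hf : Measurable f) {x y : H}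
    (hfx : MemLp f 2 (E.scalarMeasure x)) (hfy : MemLp f 2 (E.scalarMeasure y)) :
    MemLp f 2 (E.scalarMeasure (x + y)) := by
  rw [memLp_two_iff_lintegral hf] at *
  refine (lintegral_mono' (E.scalarMeasure_add_le x y) le_rfl).trans_lt ?_
  rw [lintegral_smul_measure, lintegral_add_measure, ENNReal.smul_def, smul_eq_mul]
  exact ENNReal.mul_lt_top ENNReal.coe_lt_top (ENNReal.add_lt_top.2 ⟨hfx, hfy⟩)

theorem memLp_smul {f : ℝ → ℂ} (c : ℂ) {x : H} (hfx : MemLp f 2 (E.scalarMeasure x)) :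
    MemLp f 2 (E.scalarMeasure (c • x)) := by
  rw [scalarMeasure_smul]
  exact hfx.smul_measure (by simp)

theorem vectorIntegral_add_right {f : ℝ → ℂ} (hf : Measurable f) {x y : H}
    (hfx : MemLp f 2 (E.scalarMeasure x)) (hfy : MemLp f 2 (E.scalarMeasure y)) :
    E.vectorIntegral f (x + y) = E.vectorIntegral f x + E.vectorIntegral f y := by
  have h1 := E.tendsto_simpleIntegral hf (tendsto_eLpNorm_simpleApprox hf hfx)
  have h2 := E.tendsto_simpleIntegral hf (tendsto_eLpNorm_simpleApprox hf hfy)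
  have h3 := E.tendsto_simpleIntegral hf
    (tendsto_eLpNorm_simpleApprox hf (E.memLp_add hf hfx hfy))
  simp only [map_add] at h3
  exact tendsto_nhds_unique h3 (h1.add h2)

theorem vectorIntegral_smul_right {f : ℝ → ℂ} (hf : Measurable f) (c : ℂ) {x : H}
    (hfx : MemLp f 2 (E.scalarMeasure x)) :
    E.vectorIntegral f (c • x) = c • E.vectorIntegral f x := by
  have h1 := E.tendsto_simpleIntegral hf (tendsto_eLpNorm_simpleApprox hf hfx)
  have h3 := E.tendsto_simpleIntegral hf
    (tendsto_eLpNorm_simpleApprox hf (E.memLp_smul c hfx))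
  simp only [map_smul] at h3
  exact tendsto_nhds_unique h3 (h1.const_smul c)

theorem scalarMeasure_zero : E.scalarMeasure 0 = 0 := by
  refine Measure.ext fun S hS => ?_
  rw [scalarMeasure_apply _ _ hS]
  simp

/-- The operator `∫ f(t) dE(t)` with its maximal domain. -/
noncomputable def integral (f : ℝ → ℂ) (hf : Measurable f) : H →ₗ.[ℂ] H where
  domain :=
    { carrier := {x | MemLp f 2 (E.scalarMeasure x)}
      add_mem' := fun hx hy => E.memLp_add hf hx hy
      zero_mem' := by
        change MemLp f 2 (E.scalarMeasure 0)
        rw [scalarMeasure_zero]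
        exact ⟨hf.aestronglyMeasurable, by simp⟩
      smul_mem' := fun c _ hx => E.memLp_smul c hx }
  toFun :=
    { toFun := fun x => E.vectorIntegral f x
      map_add' := fun x y => E.vectorIntegral_add_right hf x.2 y.2
      map_smul' := fun c x => E.vectorIntegral_smul_right hf c x.2 }

theorem mem_integral_domain {f : ℝ → ℂ} (hf : Measurable f) {x : H} :
    x ∈ (E.integral f hf).domain ↔ MemLp f 2 (E.scalarMeasure x) := Iff.rfl

theorem integral_apply {f : ℝ → ℂ} (hf : Measurable f) (x : (E.integral f hf).domain) :
    E.integral f hf x = E.vectorIntegral f x := rfl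

theorem isIntegral_integral {f : ℝ → ℂ} (hf : Measurable f) :
    E.IsIntegral f (E.integral f hf) :=
  ⟨fun _ => memLp_two_iff_lintegral hf, fun x => E.inner_vectorIntegral hf x.2⟩

end RealSpectralMeasure

end

/-! ### Quadratic forms of densely defined operators; closedness and resolvents of spectral
integrals. -/

section

open MeasureTheory Filter Topology

section QuadraticForm

variable {H : Type*} [NormedAddCommGroup H] [InnerProductSpace ℂ H]

/-- A densely defined operator with bounded quadratic form is bounded. -/
theorem norm_le_of_norm_inner_self_le {D : Submodule ℂ H} (hD : Dense (D : Set H))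
    (S : D →ₗ[ℂ] H) {C : ℝ} (h : ∀ x : D, ‖⟪(x : H), S x⟫_ℂ‖ ≤ C * ‖(x : H)‖ ^ 2) (x : D) :
    ‖S x‖ ≤ 2 * C * ‖(x : H)‖ := by
  have h1 : ∀ y : D, ‖⟪(y : H), S x⟫_ℂ‖ ≤ C * (‖(x : H)‖ ^ 2 + ‖(y : H)‖ ^ 2) := by
    intro y
    have e : 4 * ⟪(y : H), S x⟫_ℂ =
        (⟪((y + x : D) : H), S (y + x)⟫_ℂ - ⟪((y - x : D) : H), S (y - x)⟫_ℂ) -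
        Complex.I * (⟪((y + Complex.I • x : D) : H), S (y + Complex.I • x)⟫_ℂ -
          ⟪((y - Complex.I • x : D) : H), S (y - Complex.I • x)⟫_ℂ) := by
      simp only [map_add, map_sub, map_smul, Submodule.coe_add, Submodule.coe_sub,
        Submodule.coe_smul, inner_add_left, inner_add_right, inner_sub_left, inner_sub_right,
        inner_smul_left, inner_smul_right, Complex.conj_I]
      ring_nf
      simp only [Complex.I_sq]
      ring
    have b : 4 * ‖⟪(y : H), S x⟫_ℂ‖ ≤ C * ‖(y : H) + x‖ ^ 2 + C * ‖(y : H) - x‖ ^ 2 +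
        (C * ‖(y : H) + Complex.I • (x : H)‖ ^ 2 + C * ‖(y : H) - Complex.I • (x : H)‖ ^ 2) := by
      have : 4 * ‖⟪(y : H), S x⟫_ℂ‖ = ‖4 * ⟪(y : H), S x⟫_ℂ‖ := by simp
      rw [this, e]
      refine (norm_sub_le _ _).trans (add_le_add ((norm_sub_le _ _).trans
        (add_le_add (h _) (h _))) ?_)
      rw [norm_mul, Complex.norm_I, one_mul]
      exact (norm_sub_le _ _).trans (add_le_add (h _) (h _))
    have p1 := parallelogram_law_with_norm ℂ (y : H) x
    have p2 := parallelogram_law_with_norm ℂ (y : H) (Complex.I • (x : H))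
    rw [norm_smul, Complex.norm_I, one_mul] at p2
    have : 4 * ‖⟪(y : H), S x⟫_ℂ‖ ≤ 4 * (C * (‖(x : H)‖ ^ 2 + ‖(y : H)‖ ^ 2)) := by
      refine b.trans (le_of_eq ?_)
      linear_combination C * p1 + C * p2
    linarith
  have h2 : ∀ y : H, ‖⟪y, S x⟫_ℂ‖ ≤ C * (‖(x : H)‖ ^ 2 + ‖y‖ ^ 2) := by
    intro y
    have hc : IsClosed {y : H | ‖⟪y, S x⟫_ℂ‖ ≤ C * (‖(x : H)‖ ^ 2 + ‖y‖ ^ 2)} :=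
      isClosed_le (by fun_prop) (by fun_prop)
    exact (hc.closure_subset_iff (s := (D : Set H))).2 (fun y hy => h1 ⟨y, hy⟩)
      (hD.closure_eq ▸ Set.mem_univ y)
  rcases eq_or_ne (S x) 0 with hS | hS
  · rw [hS, norm_zero]
    have := (norm_nonneg _).trans (h x)
    rcases eq_or_ne (x : H) 0 with hx | hx
    · simp [hx]
    · have hx' : 0 < ‖(x : H)‖ := norm_pos_iff.2 hx
      have hC : 0 ≤ C := by
        by_contra! hC
        nlinarith [mul_pos hx' hx']
      positivity
  · have hx : (x : H) ≠ 0 := fun hx => hS (by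
      rw [show x = 0 from Subtype.ext hx, map_zero])
    have hx' : 0 < ‖(x : H)‖ := norm_pos_iff.2 hx
    have hS' : 0 < ‖S x‖ := norm_pos_iff.2 hS
    -- The test vector is `S x` rescaled to the norm of `x`, which makes the bound `C(‖x‖² + ‖y‖²)`
    -- equal to `2C‖x‖²`.
    have h3 := h2 (((‖(x : H)‖ / ‖S x‖ : ℝ) : ℂ) • S x)
    rw [inner_smul_left, norm_mul, inner_self_eq_norm_sq_to_K, norm_smul, Complex.conj_ofReal,
      Complex.norm_of_nonneg (by positivity), div_mul_cancel₀ _ hS'.ne'] at h3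
    simp only [norm_pow, Complex.coe_algebraMap, Complex.norm_real, norm_norm] at h3
    have h4 : ‖(x : H)‖ / ‖S x‖ * ‖S x‖ ^ 2 = ‖(x : H)‖ * ‖S x‖ := by field_simp
    rw [h4] at h3
    have h5 : ‖(x : H)‖ * ‖S x‖ ≤ ‖(x : H)‖ * (2 * C * ‖(x : H)‖) := by linarith
    exact le_of_mul_le_mul_left h5 hx'

end QuadraticForm

namespace RealSpectralMeasure

variable {H : Type*} [NormedAddCommGroup H] [InnerProductSpace ℂ H] [CompleteSpace H]
variable (E : RealSpectralMeasure H)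

/-- The domains agree by definition, and the difference has zero quadratic form on a dense subspace.
-/
theorem IsIntegral.eq {f : ℝ → ℂ} {T T' : H →ₗ.[ℂ] H} (hT : E.IsIntegral f T)
    (hT' : E.IsIntegral f T') (hd : Dense (T.domain : Set H)) : T = T' := by
  have hdom : T.domain = T'.domain := Submodule.ext fun x => (hT.1 x).trans (hT'.1 x).symm
  refine LinearPMap.ext hdom fun x hx hx' => ?_
  let S : T.domain →ₗ[ℂ] H := T.toFun - T'.toFun ∘ₗ Submodule.inclusion hdom.le
  have h := norm_le_of_norm_inner_self_le hd S (C := 0) (fun x => by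
    have h1 := hT.2 x
    have h2 := hT'.2 (Submodule.inclusion hdom.le x)
    have h3 : ⟪(x : H), S x⟫_ℂ = 0 := by
      change ⟪(x : H), T x - T' (Submodule.inclusion hdom.le x)⟫_ℂ = 0
      rw [inner_sub_right, h1]
      exact sub_eq_zero.2 h2.symm
    simp [h3]) ⟨x, hx⟩
  have h4 : S ⟨x, hx⟩ = 0 := by simpa using h
  exact sub_eq_zero.1 h4

theorem memLp_of_bound (x : H) {f : ℝ → ℂ} (hf : Measurable f) {C : ℝ} (hC : ∀ t, ‖f t‖ ≤ C) :
    MemLp f 2 (E.scalarMeasure x) :=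
  MemLp.of_bound hf.aestronglyMeasurable C (Eventually.of_forall hC)

theorem norm_vectorIntegral_sq {f : ℝ → ℂ} (hf : Measurable f) {x : H}
    (hfx : MemLp f 2 (E.scalarMeasure x)) :
    ‖E.vectorIntegral f x‖ ^ 2 = ∫ t, ‖f t‖ ^ 2 ∂(E.scalarMeasure x) := by
  have h := E.enorm_vectorIntegral_sq hf hfx
  rw [integral_eq_lintegral_of_nonneg_ae (Eventually.of_forall fun t => by positivity)
    (by fun_prop)]
  have h2 : ∀ t, ENNReal.ofReal (‖f t‖ ^ 2) = ‖f t‖ₑ ^ 2 := fun t => by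
    rw [ENNReal.ofReal_pow (norm_nonneg _), ofReal_norm]
  simp only [h2, ← h, ENNReal.toReal_pow, toReal_enorm]

theorem norm_vectorIntegral_le (x : H) {f : ℝ → ℂ} (hf : Measurable f) {C : ℝ}
    (hC : ∀ t, ‖f t‖ ≤ C) : ‖E.vectorIntegral f x‖ ≤ C * ‖x‖ := by
  have hC0 : 0 ≤ C := (norm_nonneg _).trans (hC 0)
  rw [← sq_le_sq₀ (norm_nonneg _) (by positivity),
    norm_vectorIntegral_sq _ hf (E.memLp_of_bound x hf hC), mul_pow, ← E.scalarMeasure_real_univ]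
  refine (integral_mono_of_nonneg (Eventually.of_forall fun t => by positivity)
    (integrable_const (C ^ 2)) (Eventually.of_forall fun t => ?_)).trans (le_of_eq ?_)
  · exact pow_le_pow_left₀ (norm_nonneg _) (hC t) 2
  · simp [mul_comm]

theorem vectorIntegral_one (x : H) : E.vectorIntegral (fun _ => 1) x = x := by
  have h := E.simpleIntegral_indicator MeasurableSet.univ 1
  rw [E.proj_univ, one_smul] at h
  have h2 := E.vectorIntegral_simpleFunc
    ((SimpleFunc.const ℝ (1 : ℂ)).piecewise Set.univ MeasurableSet.univ (SimpleFunc.const ℝ 0)) x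
  rw [h] at h2
  rw [one_apply_eq_self] at h2
  convert h2 using 2
  ext t
  simp

theorem vectorIntegral_indicator {S : Set ℝ} (hS : MeasurableSet S) {f : ℝ → ℂ} (hf : Measurable f)
    {x : H} (hfx : MemLp f 2 (E.scalarMeasure x)) :
    E.vectorIntegral (S.indicator f) x = E.proj S (E.vectorIntegral f x) := by
  have h1 := E.vectorIntegral_simpleFunc_mul
    ((SimpleFunc.const ℝ 1).piecewise S hS (SimpleFunc.const ℝ 0)) hf hfx
  rw [simpleIntegral_indicator, one_smul] at h1
  rw [← h1]
  congr 1
  ext t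
  by_cases ht : t ∈ S <;> simp [SimpleFunc.coe_piecewise, ht]

theorem tendsto_vectorIntegral_indicator {S : ℕ → Set ℝ} (hS : ∀ n, MeasurableSet (S n))
    (hS' : ∀ t, ∀ᶠ n in atTop, t ∈ S n) {f : ℝ → ℂ} (hf : Measurable f) {x : H}
    (hfx : MemLp f 2 (E.scalarMeasure x)) :
    Tendsto (fun n => E.vectorIntegral ((S n).indicator f) x) atTop
      (𝓝 (E.vectorIntegral f x)) := by
  rw [tendsto_iff_norm_sub_tendsto_zero]
  have h1 : Tendsto (fun n => ∫ t, ‖((S n).indicator f - f) t‖ ^ 2 ∂(E.scalarMeasure x)) atTop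
      (𝓝 (∫ t, 0 ∂(E.scalarMeasure x))) := by
    refine tendsto_integral_of_dominated_convergence (fun t => ‖f t‖ ^ 2) (fun n => ?_)
      ((memLp_two_iff_integrable_sq_norm hfx.1).1 hfx) (fun n => Eventually.of_forall fun t => ?_)
      (Eventually.of_forall fun t => ?_)
    · exact (((hf.indicator (hS n)).sub hf).norm.pow_const 2).aestronglyMeasurable
    · by_cases ht : t ∈ S n <;> simp [ht]
    · refine tendsto_const_nhds.congr' ?_
      filter_upwards [hS' t] with n hn
      simp [hn]
  rw [integral_zero] at h1
  have h2 := h1.sqrt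
  rw [Real.sqrt_zero] at h2
  refine h2.congr fun n => ?_
  rw [← vectorIntegral_sub _ (hf.indicator (hS n)) hf (hfx.indicator (hS n)) hfx,
    ← norm_vectorIntegral_sq _ ((hf.indicator (hS n)).sub hf) ((hfx.indicator (hS n)).sub hfx),
    Real.sqrt_sq (norm_nonneg _)]

theorem tendsto_proj {S : ℕ → Set ℝ} (hS : ∀ n, MeasurableSet (S n))
    (hS' : ∀ t, ∀ᶠ n in atTop, t ∈ S n) (x : H) :
    Tendsto (fun n => E.proj (S n) x) atTop (𝓝 x) := by
  have h := E.tendsto_vectorIntegral_indicator hS hS' (f := fun _ => 1) measurable_const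
    (E.memLp_of_bound x measurable_const (C := 1) (by simp))
  simp only [fun n => E.vectorIntegral_indicator (hS n) (f := fun _ => 1) measurable_const
    (E.memLp_of_bound x measurable_const (C := 1) (by simp)), vectorIntegral_one] at h
  exact h

theorem vectorIntegral_sub_right {f : ℝ → ℂ} (hf : Measurable f) {x y : H}
    (hfx : MemLp f 2 (E.scalarMeasure x)) (hfy : MemLp f 2 (E.scalarMeasure y)) :
    E.vectorIntegral f (x - y) = E.vectorIntegral f x - E.vectorIntegral f y := by
  rw [sub_eq_add_neg, ← neg_one_smul ℂ y, vectorIntegral_add_right _ hf hfx (E.memLp_smul _ hfy),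
    vectorIntegral_smul_right _ hf _ hfy, neg_one_smul, sub_eq_add_neg]

/-- The operator `∫ f(t) dE(t)` is closed. -/
theorem integral_closed {f : ℝ → ℂ} (hf : Measurable f) {u : ℕ → H} {x y : H}
    (hu : ∀ n, MemLp f 2 (E.scalarMeasure (u n))) (hux : Tendsto u atTop (𝓝 x))
    (huy : Tendsto (fun n => E.vectorIntegral f (u n)) atTop (𝓝 y)) :
    MemLp f 2 (E.scalarMeasure x) ∧ E.vectorIntegral f x = y := by
  set S : ℕ → Set ℝ := fun N => {t | ‖f t‖ ≤ N} with hS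
  have mS : ∀ N, MeasurableSet (S N) := fun N => measurableSet_le hf.norm measurable_const
  have eS : ∀ t, ∀ᶠ n in atTop, t ∈ S n := fun t => by
    obtain ⟨N, hN⟩ := exists_nat_ge ‖f t‖
    filter_upwards [eventually_ge_atTop N] with n hn
    exact hN.trans (by exact_mod_cast hn)
  have mk : ∀ N, Measurable ((S N).indicator f) := fun N => hf.indicator (mS N)
  have bk : ∀ N t, ‖(S N).indicator f t‖ ≤ N := fun N t => by
    by_cases ht : t ∈ S N
    · simpa only [Set.indicator_of_mem ht] using (show ‖f t‖ ≤ N from ht)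
    · simp [ht]
  -- Cutting `f` off where `|f| > N` gives a bounded operator, through which the limit passes.
  have key : ∀ N, E.vectorIntegral ((S N).indicator f) x = E.proj (S N) y := by
    intro N
    have h1 : Tendsto (fun n => E.vectorIntegral ((S N).indicator f) (u n)) atTop
        (𝓝 (E.vectorIntegral ((S N).indicator f) x)) := by
      rw [tendsto_iff_norm_sub_tendsto_zero] at hux ⊢
      have h2 := hux.const_mul (N : ℝ)
      rw [mul_zero] at h2
      refine squeeze_zero (fun _ => norm_nonneg _) (fun n => ?_) h2
      rw [← vectorIntegral_sub_right _ (mk N) (E.memLp_of_bound _ (mk N) (bk N))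
        (E.memLp_of_bound _ (mk N) (bk N))]
      exact E.norm_vectorIntegral_le _ (mk N) (bk N)
    refine tendsto_nhds_unique h1 ?_
    simp only [fun n => E.vectorIntegral_indicator (mS N) hf (hu n)]
    exact ((E.proj (S N)).continuous.tendsto _).comp huy
  have hx : MemLp f 2 (E.scalarMeasure x) := by
    rw [memLp_two_iff_lintegral hf]
    have h1 : ∀ t, liminf (fun N => ‖(S N).indicator f t‖ₑ ^ 2) atTop = ‖f t‖ₑ ^ 2 := fun t => by
      refine Tendsto.liminf_eq (tendsto_const_nhds.congr' ?_)
      filter_upwards [eS t] with n hn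
      simp [hn]
    simp only [← h1]
    -- Fatou: the truncated integrals are all at most `‖y‖²`, since `key` makes them `‖E(S N) y‖²`.
    refine (lintegral_liminf_le fun N => ((mk N).enorm.pow_const 2)).trans_lt ?_
    simp only [← fun N => E.enorm_vectorIntegral_sq (mk N) (E.memLp_of_bound x (mk N) (bk N)), key]
    refine lt_of_le_of_lt (liminf_le_of_frequently_le' (x := ‖y‖ₑ ^ 2)
      (Frequently.of_forall fun N => ?_)) (ENNReal.pow_lt_top enorm_lt_top)
    gcongr
    rw [enorm_le_iff_norm_le]
    exact E.norm_proj_le (mS N) y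
  refine ⟨hx, ?_⟩
  have h1 := E.tendsto_vectorIntegral_indicator mS eS hf hx
  simp only [key] at h1
  exact tendsto_nhds_unique h1 (E.tendsto_proj mS eS y)

/-- The resolvent function `t ↦ (t - z)⁻¹`. -/
noncomputable def resolventFun (z : ℂ) (t : ℝ) : ℂ := ((t : ℂ) - z)⁻¹

theorem measurable_resolventFun (z : ℂ) : Measurable (resolventFun z) := by
  unfold resolventFun; fun_prop

theorem norm_resolventFun_le {z : ℂ} (hz : z.im ≠ 0) (t : ℝ) :
    ‖resolventFun z t‖ ≤ |z.im|⁻¹ := by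
  rw [resolventFun, norm_inv]
  refine inv_anti₀ (abs_pos.2 hz) ?_
  have := Complex.abs_im_le_norm ((t : ℂ) - z)
  simpa using this

theorem memLp_resolventFun {z : ℂ} (hz : z.im ≠ 0) (x : H) :
    MemLp (resolventFun z) 2 (E.scalarMeasure x) :=
  E.memLp_of_bound x (measurable_resolventFun z) (norm_resolventFun_le hz)

theorem mul_resolventFun {z : ℂ} (hz : z.im ≠ 0) :
    (fun t : ℝ => (t : ℂ)) * resolventFun z = (fun _ => 1) + fun t => z * resolventFun z t := by
  ext t
  have : (t : ℂ) - z ≠ 0 := fun h => hz (by simpa using congrArg Complex.im h)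
  simp only [Pi.mul_apply, Pi.add_apply, resolventFun]
  field_simp
  ring

/-- The resolvent of `∫ t dE(t)` maps into the domain. -/
theorem integral_resolvent {z : ℂ} (hz : z.im ≠ 0) (y : H) :
    MemLp (fun t : ℝ => (t : ℂ)) 2 (E.scalarMeasure (E.vectorIntegral (resolventFun z) y)) ∧
    E.vectorIntegral (fun t : ℝ => (t : ℂ)) (E.vectorIntegral (resolventFun z) y) =
      y + z • E.vectorIntegral (resolventFun z) y := by
  have mid : Measurable fun t : ℝ => (t : ℂ) := by fun_prop
  have mr := measurable_resolventFun z
  have lr := E.memLp_resolventFun hz y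
  have l1 : MemLp (fun _ : ℝ => (1 : ℂ)) 2 (E.scalarMeasure y) :=
    E.memLp_of_bound y measurable_const (C := 1) (by simp)
  have lir : MemLp ((fun t : ℝ => (t : ℂ)) * resolventFun z) 2 (E.scalarMeasure y) := by
    rw [mul_resolventFun hz]
    exact l1.add (lr.const_mul z)
  refine ⟨⟨mid.aestronglyMeasurable, ?_⟩, ?_⟩
  · rw [eLpNorm_scalarMeasure_vectorIntegral _ mid mr lr]
    exact lir.2
  · rw [vectorIntegral_vectorIntegral _ mid mr lr lir, mul_resolventFun hz,
      vectorIntegral_add _ measurable_const (mr.const_mul z) l1 (lr.const_mul z),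
      vectorIntegral_one, vectorIntegral_const_mul _ _ mr lr]

theorem IsIntegral.eq_integral {A : H →ₗ.[ℂ] H} {f : ℝ → ℂ} (hf : Measurable f)
    (hA : E.IsIntegral f A) (hd : Dense (A.domain : Set H)) : A = E.integral f hf :=
  IsIntegral.eq E hA (E.isIntegral_integral hf) hd

theorem IsIntegral.apply_eq {A : H →ₗ.[ℂ] H} {f : ℝ → ℂ} (hf : Measurable f)
    (hA : E.IsIntegral f A) (hd : Dense (A.domain : Set H)) (x : A.domain) :
    A x = E.vectorIntegral f x := by
  obtain ⟨x, hx⟩ := x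
  have := IsIntegral.eq_integral E hf hA hd
  subst this
  rfl

theorem IsIntegral.mem_domain_iff {A : H →ₗ.[ℂ] H} {f : ℝ → ℂ} (hf : Measurable f)
    (hA : E.IsIntegral f A) {x : H} : x ∈ A.domain ↔ MemLp f 2 (E.scalarMeasure x) :=
  (hA.1 x).trans (memLp_two_iff_lintegral hf).symm

theorem IsIntegral.resolvent_right {A : H →ₗ.[ℂ] H}
    (hA : E.IsIntegral (fun t => (t : ℂ)) A) (hd : Dense (A.domain : Set H)) {z : ℂ}
    (hz : z.im ≠ 0) (y : H) :
    ∃ w : A.domain, (w : H) = E.vectorIntegral (resolventFun z) y ∧ A w = y + z • (w : H) := by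
  obtain ⟨h1, h2⟩ := E.integral_resolvent hz y
  have mid : Measurable fun t : ℝ => (t : ℂ) := by fun_prop
  refine ⟨⟨_, (IsIntegral.mem_domain_iff E mid hA).2 h1⟩, rfl, ?_⟩
  rw [IsIntegral.apply_eq E mid hA hd, h2]

/-- The form `⟪w, A w⟫` is an integral of a real function, hence real, whereas here it equals `z
‖w‖²`. -/
theorem IsIntegral.eq_zero_of_apply_eq_smul {A : H →ₗ.[ℂ] H}
    (hA : E.IsIntegral (fun t => (t : ℂ)) A) {z : ℂ} (hz : z.im ≠ 0) (w : A.domain)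
    (h : A w = z • (w : H)) : (w : H) = 0 := by
  have h1 := hA.2 w
  rw [h, integral_complex_ofReal, inner_smul_right, inner_self_eq_norm_sq_to_K] at h1
  have h2 := congrArg Complex.im h1
  rw [Complex.ofReal_im] at h2
  change (z * ((‖(w : H)‖ : ℝ) : ℂ) ^ 2).im = 0 at h2
  rw [← Complex.ofReal_pow, Complex.im_mul_ofReal] at h2
  simpa [hz] using h2

/-- A right inverse of the injective map `A - z` is also a left inverse. -/
theorem IsIntegral.resolvent_left {A : H →ₗ.[ℂ] H}
    (hA : E.IsIntegral (fun t => (t : ℂ)) A) (hd : Dense (A.domain : Set H)) {z : ℂ}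
    (hz : z.im ≠ 0) (w : A.domain) :
    E.vectorIntegral (resolventFun z) (A w - z • (w : H)) = w := by
  obtain ⟨v, hv, hAv⟩ := IsIntegral.resolvent_right E hA hd hz (A w - z • (w : H))
  rw [← hv]
  have h := IsIntegral.eq_zero_of_apply_eq_smul E hA hz (v - w) (by
    rw [LinearPMap.map_sub, hAv, Submodule.coe_sub, smul_sub]
    abel)
  rw [Submodule.coe_sub] at h
  exact sub_eq_zero.1 h

end RealSpectralMeasure

end

/-! ### The Bernstein inequality for self-adjoint operators. -/

section

open MeasureTheory Filter Topology ProbabilityTheory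

/-- The density of the convolution of `μ` with the Cauchy distribution of scale `s`. -/
noncomputable def poissonDensity (s : ℝ≥0) (μ : Measure ℝ) (t : ℝ) : ℝ :=
  ∫ u, cauchyPDFReal 0 s (t - u) ∂μ

theorem integrable_cauchyPDFReal_sub_prod (s : ℝ≥0) (μ : Measure ℝ) [IsFiniteMeasure μ] :
    Integrable (fun q : ℝ × ℝ => cauchyPDFReal 0 s (q.2 - q.1)) (μ.prod volume) := by
  have hm : Measurable fun q : ℝ × ℝ => cauchyPDFReal 0 s (q.2 - q.1) :=
    (measurable_cauchyPDFReal 0 s).comp (measurable_snd.sub measurable_fst)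
  rw [integrable_prod_iff hm.aestronglyMeasurable]
  refine ⟨Eventually.of_forall fun u => (integrable_cauchyPDFReal 0).comp_sub_right u, ?_⟩
  have : ∀ u : ℝ, ∫ t, ‖cauchyPDFReal 0 s (t - u)‖ = ∫ t, ‖cauchyPDFReal 0 s t‖ := fun u =>
    integral_sub_right_eq_self (fun t => ‖cauchyPDFReal 0 s t‖) u
  simp only [this]
  exact integrable_const _

theorem integrable_poissonDensity (s : ℝ≥0) (μ : Measure ℝ) [IsFiniteMeasure μ] :
    Integrable (poissonDensity s μ) :=
  (integrable_cauchyPDFReal_sub_prod s μ).integral_prod_right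

theorem integral_poissonDensity (s : ℝ≥0) (hs : s ≠ 0) (μ : Measure ℝ) [IsFiniteMeasure μ] :
    ∫ t, poissonDensity s μ t = μ.real Set.univ := by
  unfold poissonDensity
  rw [integral_integral_swap (f := fun t u => cauchyPDFReal 0 s (t - u))
    (integrable_cauchyPDFReal_sub_prod s μ).swap]
  have : ∀ u : ℝ, ∫ t, cauchyPDFReal 0 s (t - u) = 1 := fun u => by
    rw [integral_sub_right_eq_self (fun t => cauchyPDFReal 0 s t) u,
      integral_cauchyPDFReal_eq_one 0 hs]
  simp [this]

theorem poissonIntegral_eq (s : ℝ≥0) (hs : s ≠ 0) (h : ℝ → ℂ) (x : ℝ) :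
    poissonIntegral s h x = ∫ t, cauchyPDFReal 0 s (t - x) • h t := by
  rw [poissonIntegral, integral_cauchyMeasure s hs,
    ← integral_sub_right_eq_self (fun t => cauchyPDFReal 0 s t • h (x + t)) x]
  simp

/-- Fubini moves the smoothing from `h` onto the measure, leaving only the boundedness of `h` to be
used. -/
theorem integral_poissonIntegral (s : ℝ≥0) (hs : s ≠ 0) (μ : Measure ℝ) [IsFiniteMeasure μ]
    {h : ℝ → ℂ} (hc : Continuous h) {M : ℝ} (hM : ∀ x, ‖h x‖ ≤ M) :
    ∫ x, poissonIntegral s h x ∂μ = ∫ t, poissonDensity s μ t • h t := by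
  simp only [poissonIntegral_eq s hs]
  rw [integral_integral_swap (f := fun x t => cauchyPDFReal 0 s (t - x) • h t)]
  · simp only [integral_smul_const, poissonDensity]
  · exact (integrable_cauchyPDFReal_sub_prod s μ).smul_bdd M
      (hc.comp continuous_snd).aestronglyMeasurable (Eventually.of_forall fun q => hM q.2)

theorem integrable_smul_of_bounded {ρ : Measure ℝ} {k : ℝ → ℝ} (hk : Integrable k ρ) {h : ℝ → ℂ}
    (hc : Continuous h) {M : ℝ} (hM : ∀ t, ‖h t‖ ≤ M) : Integrable (fun t => k t • h t) ρ :=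
  hk.smul_bdd M hc.aestronglyMeasurable (Eventually.of_forall hM)

/-- Integrals of a bounded function against two densities whose difference is controlled by their
sum. -/
theorem norm_integral_smul_sub_le {τ : Measure ℝ} {k l : ℝ → ℝ} (hk : Integrable k τ)
    (hl : Integrable l τ) {L m : ℝ} (hL : 0 ≤ L) (hkm : ∫ t, k t ∂τ ≤ m) (hlm : ∫ t, l t ∂τ ≤ m)
    (hkl : ∀ t, |k t - l t| ≤ L / 2 * (k t + l t)) {h : ℝ → ℂ} (hc : Continuous h) {M : ℝ}
    (hM : ∀ x, ‖h x‖ ≤ M) : ‖∫ t, k t • h t ∂τ - ∫ t, l t • h t ∂τ‖ ≤ M * L * m := by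
  have hM0 : 0 ≤ M := (norm_nonneg _).trans (hM 0)
  rw [← integral_sub (integrable_smul_of_bounded hk hc hM) (integrable_smul_of_bounded hl hc hM)]
  have hi : Integrable (fun t => L / 2 * (k t + l t) * M) τ :=
    ((hk.add hl).const_mul _).mul_const _
  refine (norm_integral_le_of_norm_le hi (Eventually.of_forall fun t => ?_)).trans ?_
  · rw [← sub_smul, norm_smul, Real.norm_eq_abs]
    exact mul_le_mul (hkl t) (hM t) (norm_nonneg _) ((abs_nonneg _).trans (hkl t))
  · rw [integral_mul_const, integral_const_mul, integral_add hk hl]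
    have : L / 2 * (∫ t, k t ∂τ + ∫ t, l t ∂τ) ≤ L * m := by nlinarith
    nlinarith

namespace RealSpectralMeasure

variable {H : Type*} [NormedAddCommGroup H] [InnerProductSpace ℂ H] [CompleteSpace H]

theorem resolventFun_sub_conj (s : ℝ≥0) (hs : s ≠ 0) (t u : ℝ) :
    resolventFun (t + s * Complex.I) u - resolventFun (t - s * Complex.I) u =
      2 * Real.pi * Complex.I * cauchyPDFReal 0 s (t - u) := by
  have hs' : (0 : ℝ) < s := by positivity
  have h1 : (u : ℂ) - (t + s * Complex.I) ≠ 0 := fun h => hs'.ne' (by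
    simpa using congrArg Complex.im h)
  have h2 : (u : ℂ) - (t - s * Complex.I) ≠ 0 := fun h => hs'.ne' (by
    simpa using congrArg Complex.im h)
  have h3 : ((u : ℂ) - (t + s * Complex.I)) * ((u : ℂ) - (t - s * Complex.I)) =
      (t - u) ^ 2 + (s : ℝ) ^ 2 := by
    ring_nf
    simp only [Complex.I_sq]
    ring
  have h4 : ((t : ℂ) - u) ^ 2 + ((s : ℝ) : ℂ) ^ 2 ≠ 0 := by
    rw [← h3]; exact mul_ne_zero h1 h2
  have hpi : (Real.pi : ℂ) ≠ 0 := by exact_mod_cast Real.pi_ne_zero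
  rw [resolventFun, resolventFun, inv_sub_inv h1 h2, h3, cauchyPDFReal_def]
  rw [sub_zero]
  push_cast
  generalize ((t : ℂ) - u) ^ 2 + ((s : ℝ) : ℂ) ^ 2 = Q at h4 h3
  field_simp
  ring

theorem norm_resolventFun_sq (s : ℝ≥0) (hs : s ≠ 0) (t u : ℝ) (z : ℂ)
    (hz : z = t + s * Complex.I ∨ z = t - s * Complex.I) :
    ‖resolventFun z u‖ ^ 2 = Real.pi / s * cauchyPDFReal 0 s (t - u) := by
  have hs' : (0 : ℝ) < s := by positivity
  have hpi := Real.pi_pos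
  have : ‖(u : ℂ) - z‖ ^ 2 = (t - u) ^ 2 + (s : ℝ) ^ 2 := by
    rw [← Complex.normSq_eq_norm_sq, Complex.normSq_apply]
    rcases hz with rfl | rfl <;> simp <;> ring
  rw [resolventFun, norm_inv, inv_pow, this, cauchyPDFReal_def]
  field_simp
  simp

/-- `|u - t ∓ is|⁻²` is `π / s` times the Cauchy density at `t - u`, for either sign. -/
theorem norm_vectorIntegral_resolventFun_sq (E : RealSpectralMeasure H) {s : ℝ≥0} (hs : s ≠ 0)
    (t : ℝ) (z : ℂ) (hz : z = t + s * Complex.I ∨ z = t - s * Complex.I) (x : H) :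
    ‖E.vectorIntegral (resolventFun z) x‖ ^ 2 =
      Real.pi / s * poissonDensity s (E.scalarMeasure x) t := by
  have hs' : (0 : ℝ) < s := by positivity
  have hz' : z.im ≠ 0 := by rcases hz with rfl | rfl <;> simp [hs]
  rw [norm_vectorIntegral_sq _ (measurable_resolventFun z) (E.memLp_resolventFun hz' x),
    poissonDensity, ← integral_const_mul]
  simp only [norm_resolventFun_sq s hs t _ z hz]

/-- Stone's formula at positive height. Being linear in the resolvent, it is the form in which two
operators can be subtracted. -/
theorem poissonDensity_eq (E : RealSpectralMeasure H) {s : ℝ≥0} (hs : s ≠ 0) (t : ℝ) (x : H) :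
    2 * Real.pi * Complex.I * poissonDensity s (E.scalarMeasure x) t =
      ⟪x, E.vectorIntegral (resolventFun (t + s * Complex.I)) x⟫_ℂ -
      ⟪x, E.vectorIntegral (resolventFun (t - s * Complex.I)) x⟫_ℂ := by
  have h1 : ((t : ℂ) + s * Complex.I).im ≠ 0 := by simp [hs]
  have h2 : ((t : ℂ) - s * Complex.I).im ≠ 0 := by simp [hs]
  rw [E.inner_vectorIntegral (measurable_resolventFun _) (E.memLp_resolventFun h1 x),
    E.inner_vectorIntegral (measurable_resolventFun _) (E.memLp_resolventFun h2 x),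
    ← integral_sub ((E.memLp_resolventFun h1 x).integrable (by norm_num))
      ((E.memLp_resolventFun h2 x).integrable (by norm_num))]
  simp only [resolventFun_sub_conj s hs]
  rw [integral_const_mul, integral_complex_ofReal, poissonDensity]

/-- The second resolvent identity. -/
theorem vectorIntegral_resolvent_sub {EA EB : RealSpectralMeasure H} {A B : H →ₗ.[ℂ] H}
    (hA : EA.IsIntegral (fun t => (t : ℂ)) A) (hB : EB.IsIntegral (fun t => (t : ℂ)) B)
    (hdA : Dense (A.domain : Set H)) (hdB : Dense (B.domain : Set H)) {K : H →L[ℂ] H}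
    (hK : IsBoundedDifference A B K) {z : ℂ} (hz : z.im ≠ 0) (x : H) :
    EA.vectorIntegral (resolventFun z) x - EB.vectorIntegral (resolventFun z) x =
      -EA.vectorIntegral (resolventFun z) (K (EB.vectorIntegral (resolventFun z) x)) := by
  obtain ⟨w, hw, hBw⟩ := IsIntegral.resolvent_right EB hB hdB hz x
  have h1 := IsIntegral.resolvent_left EA hA hdA hz ⟨w, hK.1 w.2⟩
  have h2 := hK.2 ⟨w, hK.1 w.2⟩ w rfl
  have h3 : A ⟨w, hK.1 w.2⟩ - z • (w : H) = x + K w := by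
    rw [← h2, hBw]
    abel
  dsimp only at h1
  rw [h3, vectorIntegral_add_right _ (measurable_resolventFun z) (EA.memLp_resolventFun hz _)
    (EA.memLp_resolventFun hz _)] at h1
  rw [← hw, eq_sub_of_add_eq h1]
  abel

theorem inner_vectorIntegral_resolventFun (E : RealSpectralMeasure H) {z z' : ℂ}
    (hz : z.im ≠ 0) (hzz' : starRingEnd ℂ z = z') (x y : H) :
    ⟪x, E.vectorIntegral (resolventFun z) y⟫_ℂ = ⟪E.vectorIntegral (resolventFun z') x, y⟫_ℂ := by
  rw [← E.inner_vectorIntegral_conj (measurable_resolventFun z) (E.memLp_resolventFun hz x)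
    (E.memLp_resolventFun hz y)]
  congr 2
  ext t
  simp [resolventFun, ← hzz']

/-- The second resolvent identity gives `-⟪R_A(z̄) x, K R_B(z) x⟫`; Cauchy-Schwarz and `2ab ≤ a² +
b²` leave squared norms, which are multiples of Poisson densities. -/
theorem norm_inner_resolvent_sub_le {EA EB : RealSpectralMeasure H} {A B : H →ₗ.[ℂ] H}
    (hA : EA.IsIntegral (fun t => (t : ℂ)) A) (hB : EB.IsIntegral (fun t => (t : ℂ)) B)
    (hdA : Dense (A.domain : Set H)) (hdB : Dense (B.domain : Set H)) {K : H →L[ℂ] H}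
    (hK : IsBoundedDifference A B K) {z z' : ℂ} (hz : z.im ≠ 0) (hzz' : starRingEnd ℂ z = z')
    (x : H) :
    ‖⟪x, EA.vectorIntegral (resolventFun z) x⟫_ℂ - ⟪x, EB.vectorIntegral (resolventFun z) x⟫_ℂ‖ ≤
      ‖K‖ * (‖EA.vectorIntegral (resolventFun z') x‖ ^ 2 +
        ‖EB.vectorIntegral (resolventFun z) x‖ ^ 2) / 2 := by
  rw [← inner_sub_right, vectorIntegral_resolvent_sub hA hB hdA hdB hK hz, inner_neg_right,
    norm_neg, inner_vectorIntegral_resolventFun _ hz hzz']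
  set a := EA.vectorIntegral (resolventFun z') x
  set b := EB.vectorIntegral (resolventFun z) x
  calc _ ≤ ‖a‖ * (‖K‖ * ‖b‖) := (norm_inner_le_norm _ _).trans (by gcongr; exact K.le_opNorm b)
    _ = ‖K‖ * (‖a‖ * ‖b‖) := by ring
    _ ≤ ‖K‖ * ((‖a‖ ^ 2 + ‖b‖ ^ 2) / 2) := by
      gcongr
      nlinarith [sq_nonneg (‖a‖ - ‖b‖)]
    _ = _ := by ring

/-- Stone's formula uses two points, each contributing `‖K‖ (π / s)(k_A + k_B) / 2`; division by
`2π` gives the constant. A bound by the densities themselves is integrable in `t`. -/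
theorem abs_poissonDensity_sub_le {EA EB : RealSpectralMeasure H} {A B : H →ₗ.[ℂ] H}
    (hA : EA.IsIntegral (fun t => (t : ℂ)) A) (hB : EB.IsIntegral (fun t => (t : ℂ)) B)
    (hdA : Dense (A.domain : Set H)) (hdB : Dense (B.domain : Set H)) {K : H →L[ℂ] H}
    (hK : IsBoundedDifference A B K) {s : ℝ≥0} (hs : s ≠ 0) (t : ℝ) (x : H) :
    |poissonDensity s (EA.scalarMeasure x) t - poissonDensity s (EB.scalarMeasure x) t| ≤
      ‖K‖ / s / 2 *
        (poissonDensity s (EA.scalarMeasure x) t + poissonDensity s (EB.scalarMeasure x) t) := by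
  have hs' : (0 : ℝ) < s := by positivity
  have hpi := Real.pi_pos
  set zp : ℂ := t + s * Complex.I with hzp
  set zm : ℂ := t - s * Complex.I with hzm
  have h1 : zp.im ≠ 0 := by simp [hzp, hs]
  have h2 : zm.im ≠ 0 := by simp [hzm, hs]
  have c1 : starRingEnd ℂ zp = zm := by simp [hzp, hzm, sub_eq_add_neg]
  have c2 : starRingEnd ℂ zm = zp := by rw [← c1, Complex.conj_conj]
  have n1 := norm_inner_resolvent_sub_le hA hB hdA hdB hK h1 c1 x
  have n2 := norm_inner_resolvent_sub_le hA hB hdA hdB hK h2 c2 x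
  rw [EA.norm_vectorIntegral_resolventFun_sq hs t _ (Or.inr rfl),
    EB.norm_vectorIntegral_resolventFun_sq hs t _ (Or.inl rfl)] at n1
  rw [EA.norm_vectorIntegral_resolventFun_sq hs t _ (Or.inl rfl),
    EB.norm_vectorIntegral_resolventFun_sq hs t _ (Or.inr rfl)] at n2
  set kA := poissonDensity s (EA.scalarMeasure x) t with hkA
  set kB := poissonDensity s (EB.scalarMeasure x) t with hkB
  have e : 2 * Real.pi * Complex.I * ((kA - kB : ℝ) : ℂ) =
      (⟪x, EA.vectorIntegral (resolventFun zp) x⟫_ℂ - ⟪x, EB.vectorIntegral (resolventFun zp) x⟫_ℂ) -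
      (⟪x, EA.vectorIntegral (resolventFun zm) x⟫_ℂ -
        ⟪x, EB.vectorIntegral (resolventFun zm) x⟫_ℂ) := by
    have e1 := EA.poissonDensity_eq hs t x
    have e2 := EB.poissonDensity_eq hs t x
    push_cast
    linear_combination e1 - e2
  have e' := (congrArg norm e).le.trans ((norm_sub_le _ _).trans (add_le_add n1 n2))
  rw [norm_mul, Complex.norm_real, Real.norm_eq_abs] at e'
  have e3 : ‖(2 * Real.pi * Complex.I : ℂ)‖ = 2 * Real.pi := by
    simp [abs_of_pos hpi]
  rw [e3] at e'
  have e4 : 2 * Real.pi * |kA - kB| ≤ 2 * Real.pi * (‖K‖ / s / 2 * (kA + kB)) := by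
    refine e'.trans (le_of_eq ?_)
    field_simp
    ring
  exact le_of_mul_le_mul_left e4 (by positivity)

/-- **Bernstein inequality** for Poisson integrals of functions of self-adjoint operators. -/
theorem bernstein {EA EB : RealSpectralMeasure H} {A B : H →ₗ.[ℂ] H}
    (hA : EA.IsIntegral (fun t => (t : ℂ)) A) (hB : EB.IsIntegral (fun t => (t : ℂ)) B)
    (hdA : Dense (A.domain : Set H)) (hdB : Dense (B.domain : Set H)) {K : H →L[ℂ] H}
    (hK : IsBoundedDifference A B K) {s : ℝ≥0} (hs : s ≠ 0) (x : H)
    {h : ℝ → ℂ} (hc : Continuous h) {M : ℝ} (hM : ∀ x, ‖h x‖ ≤ M) :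
    ‖∫ t, poissonIntegral s h t ∂(EA.scalarMeasure x) -
      ∫ t, poissonIntegral s h t ∂(EB.scalarMeasure x)‖ ≤ M * (‖K‖ / s) * ‖x‖ ^ 2 := by
  rw [integral_poissonIntegral s hs _ hc hM, integral_poissonIntegral s hs _ hc hM]
  exact norm_integral_smul_sub_le (integrable_poissonDensity s _) (integrable_poissonDensity s _)
    (by positivity)
    (by rw [integral_poissonDensity s hs, scalarMeasure_real_univ])
    (by rw [integral_poissonDensity s hs, scalarMeasure_real_univ])
    (fun t => abs_poissonDensity_sub_le hA hB hdA hdB hK hs t x) hc hM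

end RealSpectralMeasure

end

/-! ### Weak limits, and Borel projections from a representation of `C(X)`. -/

section

open MeasureTheory Filter Topology

section WeakLimits

variable {H : Type*} [NormedAddCommGroup H] [InnerProductSpace ℂ H]

theorem ContinuousLinearMap.inner_polarization (T : H →L[ℂ] H) (y x : H) :
    ⟪y, T x⟫_ℂ = ((⟪y + x, T (y + x)⟫_ℂ - ⟪y - x, T (y - x)⟫_ℂ) -
      Complex.I * (⟪y + Complex.I • x, T (y + Complex.I • x)⟫_ℂ -
        ⟪y - Complex.I • x, T (y - Complex.I • x)⟫_ℂ)) / 4 := by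
  simp only [map_add, map_sub, map_smul, inner_add_left, inner_add_right, inner_sub_left,
    inner_sub_right, inner_smul_left, inner_smul_right, Complex.conj_I]
  ring_nf
  simp only [Complex.I_sq]
  ring

theorem exists_tendsto_inner_of_tendsto_inner_self {T : ℕ → H →L[ℂ] H} {q : H → ℂ}
    (hq : ∀ x, Tendsto (fun n => ⟪x, T n x⟫_ℂ) atTop (𝓝 (q x))) (y x : H) :
    Tendsto (fun n => ⟪y, T n x⟫_ℂ) atTop (𝓝 (((q (y + x) - q (y - x)) -
      Complex.I * (q (y + Complex.I • x) - q (y - Complex.I • x))) / 4)) := by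
  simp only [fun n => (T n).inner_polarization y x]
  exact ((((hq _).sub (hq _)).sub (((hq _).sub (hq _)).const_mul _)).div_const 4)

theorem tendsto_inner_of_tendsto_inner_self {T : ℕ → H →L[ℂ] H} {T' : H →L[ℂ] H}
    (h : ∀ x, Tendsto (fun n => ⟪x, T n x⟫_ℂ) atTop (𝓝 ⟪x, T' x⟫_ℂ)) (y x : H) :
    Tendsto (fun n => ⟪y, T n x⟫_ℂ) atTop (𝓝 ⟪y, T' x⟫_ℂ) := by
  rw [T'.inner_polarization]
  exact exists_tendsto_inner_of_tendsto_inner_self h y x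

/-- Bounded operators whose quadratic forms converge and are uniformly bounded converge weakly. -/
theorem exists_clm_of_tendsto_inner_self [CompleteSpace H] {T : ℕ → H →L[ℂ] H} {q : H → ℂ} {C : ℝ}
    (hC : ∀ n x, ‖⟪x, T n x⟫_ℂ‖ ≤ C * ‖x‖ ^ 2)
    (hq : ∀ x, Tendsto (fun n => ⟪x, T n x⟫_ℂ) atTop (𝓝 (q x))) :
    ∃ T' : H →L[ℂ] H, ∀ x, ⟪x, T' x⟫_ℂ = q x := by
  have hT : ∀ n x, ‖T n x‖ ≤ 2 * C * ‖x‖ := fun n x =>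
    norm_le_of_norm_inner_self_le (D := ⊤) (by simp)
      ((T n : H →ₗ[ℂ] H) ∘ₗ (⊤ : Submodule ℂ H).subtype) (fun y => hC n y) ⟨x, trivial⟩
  choose L hL using fun y x => (⟨_, exists_tendsto_inner_of_tendsto_inner_self hq y x⟩ :
    ∃ l, Tendsto (fun n => ⟪y, T n x⟫_ℂ) atTop (𝓝 l))
  have uniq : ∀ {y x : H} {l : ℂ}, Tendsto (fun n => ⟪y, T n x⟫_ℂ) atTop (𝓝 l) → L y x = l :=
    fun h => tendsto_nhds_unique (hL _ _) h
  let B₀ : H →ₗ⋆[ℂ] H →ₗ[ℂ] ℂ := LinearMap.mk₂'ₛₗ (starRingEnd ℂ) (RingHom.id ℂ) L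
    (fun y y' x => uniq (by simpa only [inner_add_left] using (hL y x).add (hL y' x)))
    (fun c y x => uniq (by
      simpa only [inner_smul_left, smul_eq_mul] using (hL y x).const_mul _))
    (fun y x x' => uniq (by simpa only [map_add, inner_add_right] using (hL y x).add (hL y x')))
    (fun c y x => uniq (by
      simpa only [map_smul, inner_smul_right, smul_eq_mul, RingHom.id_apply] using
        (hL y x).const_mul _))
  let B : H →L⋆[ℂ] H →L[ℂ] ℂ := LinearMap.mkContinuous₂ B₀ (2 * C) fun y x => by
    refine le_of_tendsto' (hL y x).norm fun n => (norm_inner_le_norm _ _).trans ?_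
    calc ‖y‖ * ‖T n x‖ ≤ ‖y‖ * (2 * C * ‖x‖) := by gcongr; exact hT n x
      _ = _ := by ring
  refine ⟨ContinuousLinearMap.adjoint (InnerProductSpace.continuousLinearMapOfBilin B), fun x => ?_⟩
  rw [ContinuousLinearMap.adjoint_inner_right, InnerProductSpace.continuousLinearMapOfBilin_apply]
  exact uniq (hq x)

end WeakLimits

namespace CStarRepresentation

variable {H : Type*} [NormedAddCommGroup H] [InnerProductSpace ℂ H] [CompleteSpace H]
variable {X : Type*} [TopologicalSpace X]
variable (π : C(X, ℂ) →⋆ₐ[ℂ] (H →L[ℂ] H))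

/-- A real continuous function regarded as a complex one. -/
def complexify (f : C(X, ℝ)) : C(X, ℂ) := ⟨fun t => (f t : ℂ), by fun_prop⟩

theorem inner_star_mul (g : C(X, ℂ)) (x : H) :
    ⟪x, π (star g * g) x⟫_ℂ = (‖π g x‖ : ℂ) ^ 2 := by
  rw [map_mul, map_star, ContinuousLinearMap.star_eq_adjoint, mul_apply_eq_comp,
    ContinuousLinearMap.adjoint_inner_right, inner_self_eq_norm_sq_to_K]
  rfl

theorem inner_complexify_real (f : C(X, ℝ)) (x : H) :
    ⟪x, π (complexify f) x⟫_ℂ = ((⟪x, π (complexify f) x⟫_ℂ).re : ℂ) := by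
  have h1 : star (complexify f) = complexify f := by
    ext t
    simp [complexify]
  have h2 : ContinuousLinearMap.adjoint (π (complexify f)) = π (complexify f) := by
    rw [← ContinuousLinearMap.star_eq_adjoint, ← map_star, h1]
  refine (Complex.conj_eq_iff_re.1 ?_).symm
  rw [inner_conj_symm, ← ContinuousLinearMap.adjoint_inner_right, h2]

/-- Continuous functions decreasing to the indicator of a closed set. -/
noncomputable def approxClosed [HasOuterApproxClosed X] {F : Set X} (hF : IsClosed F) (n : ℕ) :
    C(X, ℂ) := ⟨fun t => ((hF.apprSeq n t : ℝ) : ℂ), by fun_prop⟩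

theorem norm_approxClosed_le [HasOuterApproxClosed X] {F : Set X} (hF : IsClosed F) (n : ℕ)
    (t : X) :
    ‖approxClosed hF n t‖ ≤ 1 := by
  simp only [approxClosed, ContinuousMap.coe_mk]
  rw [Complex.norm_of_nonneg (NNReal.coe_nonneg _)]
  exact_mod_cast HasOuterApproxClosed.apprSeq_apply_le_one hF n t

theorem tendsto_integral_mul_approxClosed [HasOuterApproxClosed X] [MeasurableSpace X]
    [BorelSpace X] (μ : Measure X) [IsFiniteMeasure μ] {F : Set X} (hF : IsClosed F) {g : X → ℂ} (hg : Integrable g μ) :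
    Tendsto (fun n => ∫ t, g t * approxClosed hF n t ∂μ) atTop (𝓝 (∫ t in F, g t ∂μ)) := by
  rw [← integral_indicator hF.measurableSet]
  refine tendsto_integral_of_dominated_convergence (fun t => ‖g t‖) (fun n => ?_) hg.norm
    (fun n => Eventually.of_forall fun t => ?_) (Eventually.of_forall fun t => ?_)
  · exact hg.1.mul (approxClosed hF n).continuous.aestronglyMeasurable
  · rw [norm_mul]
    exact mul_le_of_le_one_right (norm_nonneg _) (norm_approxClosed_le hF n t)
  · have h1 := (tendsto_pi_nhds.1 (HasOuterApproxClosed.tendsto_apprSeq hF)) t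
    have h2 : Tendsto (fun n => approxClosed hF n t) atTop
        (𝓝 (((F.indicator (fun _ => (1 : ℝ≥0)) t : ℝ≥0) : ℝ) : ℂ)) := by
      simp only [approxClosed, ContinuousMap.coe_mk]
      exact ((Complex.continuous_ofReal.comp NNReal.continuous_coe).tendsto _).comp h1
    have h3 := h2.const_mul (g t)
    convert h3 using 2
    by_cases ht : t ∈ F <;> simp [ht]

variable [CompactSpace X]

/-- The positive functional `f ↦ ⟪x, π(f) x⟫`. -/
noncomputable def functional (x : H) : CompactlySupportedContinuousMap X ℝ →ₚ[ℝ] ℝ :=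
  PositiveLinearMap.mk₀
    { toFun := fun f => (⟪x, π (complexify (f : C(X, ℝ))) x⟫_ℂ).re
      map_add' := fun f g => by
        rw [← Complex.add_re, ← inner_add_right, ← add_apply, ← map_add]
        congr 5
        ext t
        simp [complexify]
      map_smul' := fun c f => by
        have : complexify ((c • f : CompactlySupportedContinuousMap X ℝ) : C(X, ℝ)) =
            (c : ℂ) • complexify (f : C(X, ℝ)) := by
          ext t
          simp [complexify]
        rw [this, map_smul, smul_apply, inner_smul_right, Complex.re_ofReal_mul]
        rfl }
    (fun f hf => by
      -- Positivity: `f = g* g` makes the form equal to `‖π(g) x‖²`.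
      let g : C(X, ℝ) := ⟨fun t => Real.sqrt (f t), by fun_prop⟩
      have h1 : complexify (f : C(X, ℝ)) = star (complexify g) * complexify g := by
        ext t
        have : 0 ≤ f t := hf t
        simp only [complexify, g, ContinuousMap.mul_apply, ContinuousMap.star_apply,
          ContinuousMap.coe_mk, RCLike.star_def, Complex.conj_ofReal]
        rw [← Complex.ofReal_mul, Real.mul_self_sqrt this]
      change 0 ≤ (⟪x, π (complexify (f : C(X, ℝ))) x⟫_ℂ).re
      rw [h1, inner_star_mul, ← Complex.ofReal_pow, Complex.ofReal_re]
      positivity)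

variable [MeasurableSpace X] [BorelSpace X]

theorem integrable_continuousMap (μ : Measure X) [IsFiniteMeasure μ] (g : C(X, ℂ)) :
    Integrable g μ :=
  Integrable.of_bound g.continuous.aestronglyMeasurable ‖g‖ (Eventually.of_forall g.norm_coe_le_norm)

variable [T2Space X]

/-- The spectral measure of a vector `x` with respect to a representation of `C(X)`. -/
noncomputable def vectorMeasure (x : H) : Measure X := RealRMK.rieszMeasure (functional π x)

instance (x : H) : IsFiniteMeasure (vectorMeasure π x) := by
  unfold vectorMeasure; infer_instance

theorem inner_complexify (f : C(X, ℝ)) (x : H) :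
    ⟪x, π (complexify f) x⟫_ℂ = ∫ t, (f t : ℂ) ∂(vectorMeasure π x) := by
  have h := RealRMK.integral_rieszMeasure (functional π x)
    (CompactlySupportedContinuousMap.continuousMapEquiv f)
  rw [inner_complexify_real, integral_complex_ofReal, vectorMeasure]
  congr 1
  exact h.symm

theorem inner_apply (g : C(X, ℂ)) (x : H) :
    ⟪x, π g x⟫_ℂ = ∫ t, g t ∂(vectorMeasure π x) := by
  let a : C(X, ℝ) := ⟨fun t => (g t).re, by fun_prop⟩
  let b : C(X, ℝ) := ⟨fun t => (g t).im, by fun_prop⟩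
  have h : g = complexify a + Complex.I • complexify b := by
    ext t
    simp only [complexify, a, b, ContinuousMap.add_apply, ContinuousMap.smul_apply,
      ContinuousMap.coe_mk, smul_eq_mul]
    rw [mul_comm, Complex.re_add_im]
  have i := fun f => integrable_continuousMap (vectorMeasure π x) (complexify f)
  nth_rw 1 [h]
  rw [map_add, map_smul, add_apply, smul_apply, inner_add_right, inner_smul_right,
    inner_complexify, inner_complexify, ← integral_const_mul]
  refine (integral_add (i a) ((i b).const_mul _)).symm.trans (integral_congr_ae
    (Eventually.of_forall fun t => ?_))
  simp only [complexify, a, b, ContinuousMap.coe_mk]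
  rw [mul_comm, Complex.re_add_im]

theorem vectorMeasure_real_univ (x : H) : (vectorMeasure π x).real Set.univ = ‖x‖ ^ 2 := by
  have h := inner_apply π 1 x
  rw [map_one, one_apply_eq_self, inner_self_eq_norm_sq_to_K] at h
  simp only [ContinuousMap.one_apply, integral_const, Complex.real_smul, mul_one] at h
  have h2 : ((‖x‖ ^ 2 : ℝ) : ℂ) = ((vectorMeasure π x).real Set.univ : ℂ) := by
    rw [← h]; push_cast; rfl
  exact_mod_cast h2.symm

theorem norm_setIntegral_one_le (x : H) (S : Set X) :
    ‖((vectorMeasure π x).real S : ℂ)‖ ≤ 1 * ‖x‖ ^ 2 := by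
  rw [Complex.norm_of_nonneg measureReal_nonneg, one_mul, ← vectorMeasure_real_univ π]
  exact measureReal_mono (Set.subset_univ S)

/-- Induction on Borel sets from the closed ones, for which `T` is the weak limit of `π` of
continuous functions decreasing to the indicator. Carrying an arbitrary `g` through the induction is
what later yields multiplicativity of the projections. -/
theorem exists_projection [HasOuterApproxClosed X] (S : Set X) (hS : MeasurableSet S) :
    ∃ T : H →L[ℂ] H, ∀ (g : C(X, ℂ)) (x : H),
      ⟪x, π g (T x)⟫_ℂ = ∫ t in S, g t ∂(vectorMeasure π x) := by
  have hone : ∀ (S : Set X) (T : H →L[ℂ] H), (∀ (g : C(X, ℂ)) (x : H),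
      ⟪x, π g (T x)⟫_ℂ = ∫ t in S, g t ∂(vectorMeasure π x)) →
      ∀ x, ⟪x, T x⟫_ℂ = ((vectorMeasure π x).real S : ℂ) := fun S T hT x => by
    have := hT 1 x
    rw [map_one, one_apply_eq_self] at this
    simpa using this
  induction S, hS using MeasurableSpace.induction_on_inter
    ((BorelSpace.measurable_eq (α := X)).trans borel_eq_generateFrom_isClosed)
    isPiSystem_isClosed with
  | empty => exact ⟨0, fun g x => by simp⟩
  | basic F hF =>
    replace hF : IsClosed F := hF
    have i := fun x => integrable_continuousMap (vectorMeasure π x)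
    have lim : ∀ x, Tendsto (fun n => ⟪x, π (approxClosed hF n) x⟫_ℂ) atTop
        (𝓝 ((vectorMeasure π x).real F : ℂ)) := fun x => by
      have := tendsto_integral_mul_approxClosed (vectorMeasure π x) hF
        (integrable_const (1 : ℂ))
      simpa [inner_apply] using this
    obtain ⟨T, hT⟩ := exists_clm_of_tendsto_inner_self (C := 1) (fun n x => by
      rw [inner_apply]
      refine (norm_integral_le_of_norm_le_const (C := 1)
        (Eventually.of_forall (norm_approxClosed_le hF n))).trans ?_
      rw [vectorMeasure_real_univ]) lim
    refine ⟨T, fun g x => ?_⟩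
    have lim2 : ∀ x, Tendsto (fun n => ⟪x, π (approxClosed hF n) x⟫_ℂ) atTop (𝓝 ⟪x, T x⟫_ℂ) :=
      fun x => by rw [hT]; exact lim x
    -- Moving `π(g)` to the left entry leaves a weak limit tested on two fixed vectors.
    have h1 := tendsto_inner_of_tendsto_inner_self lim2 (π (star g) x) x
    rw [map_star, ContinuousLinearMap.star_eq_adjoint, ContinuousLinearMap.adjoint_inner_left] at h1
    refine tendsto_nhds_unique h1 ?_
    simp only [ContinuousLinearMap.adjoint_inner_left, ← mul_apply_eq_comp, ← map_mul, inner_apply]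
    exact tendsto_integral_mul_approxClosed _ hF (i x g)
  | compl S hS ih =>
    obtain ⟨T, hT⟩ := ih
    refine ⟨1 - T, fun g x => ?_⟩
    rw [sub_apply, one_apply_eq_self, map_sub, inner_sub_right, hT, inner_apply,
      setIntegral_compl hS (integrable_continuousMap _ g)]
  | iUnion f hd hm ih =>
    choose T hT using ih
    have hsum : ∀ (g : C(X, ℂ)) (x : H), Tendsto (fun n => ∑ i ∈ Finset.range n, ⟪x, π g (T i x)⟫_ℂ)
        atTop (𝓝 (∫ t in ⋃ i, f i, g t ∂(vectorMeasure π x))) := fun g x => by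
      simp only [hT]
      exact (hasSum_integral_iUnion hm hd
        (integrable_continuousMap _ g).integrableOn).tendsto_sum_nat
    have lim : ∀ x, Tendsto (fun n => ⟪x, (∑ i ∈ Finset.range n, T i) x⟫_ℂ) atTop
        (𝓝 ((vectorMeasure π x).real (⋃ i, f i) : ℂ)) := fun x => by
      have := hsum 1 x
      simpa [sum_apply, inner_sum] using this
    obtain ⟨T', hT'⟩ := exists_clm_of_tendsto_inner_self (C := 1) (fun n x => by
      rw [sum_apply, inner_sum]
      simp only [fun i => hone _ _ (hT i) x]
      rw [← Complex.ofReal_sum, ← measureReal_biUnion_finset (fun i _ j _ hij => hd hij)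
        (fun i _ => hm i)]
      exact norm_setIntegral_one_le π x _) lim
    refine ⟨T', fun g x => ?_⟩
    have lim2 : ∀ x, Tendsto (fun n => ⟪x, (∑ i ∈ Finset.range n, T i) x⟫_ℂ) atTop
        (𝓝 ⟪x, T' x⟫_ℂ) := fun x => by rw [hT']; exact lim x
    have h1 := tendsto_inner_of_tendsto_inner_self lim2 (π (star g) x) x
    rw [map_star, ContinuousLinearMap.star_eq_adjoint, ContinuousLinearMap.adjoint_inner_left] at h1
    refine tendsto_nhds_unique h1 ?_
    simp only [ContinuousLinearMap.adjoint_inner_left, sum_apply, inner_sum]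
    exact hsum g x

end CStarRepresentation

end

/-! ### The spectral measure of a representation of `C(X)`. -/

section

open MeasureTheory Filter Topology

namespace CStarRepresentation

variable {H : Type*} [NormedAddCommGroup H] [InnerProductSpace ℂ H] [CompleteSpace H]
variable {X : Type*} [TopologicalSpace X] [CompactSpace X] [T2Space X] [MeasurableSpace X]
  [BorelSpace X] [HasOuterApproxClosed X]
variable (π : C(X, ℂ) →⋆ₐ[ℂ] (H →L[ℂ] H))

open Classical in
/-- The spectral projections of a representation of `C(X)`. -/
noncomputable def proj (S : Set X) : H →L[ℂ] H :=
  if hS : MeasurableSet S then (exists_projection π S hS).choose else 0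

theorem inner_apply_proj {S : Set X} (hS : MeasurableSet S) (g : C(X, ℂ)) (x : H) :
    ⟪x, π g (proj π S x)⟫_ℂ = ∫ t in S, g t ∂(vectorMeasure π x) := by
  rw [proj, dif_pos hS]
  exact (exists_projection π S hS).choose_spec g x

theorem inner_proj {S : Set X} (hS : MeasurableSet S) (x : H) :
    ⟪x, proj π S x⟫_ℂ = ((vectorMeasure π x).real S : ℂ) := by
  have := inner_apply_proj π hS 1 x
  rw [map_one, one_apply_eq_self] at this
  simpa using this

theorem adjoint_proj {S : Set X} (hS : MeasurableSet S) :
    ContinuousLinearMap.adjoint (proj π S) = proj π S := by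
  refine ContinuousLinearMap.ext_inner_self fun x => ?_
  rw [ContinuousLinearMap.adjoint_inner_right, ← inner_conj_symm, inner_proj π hS,
    Complex.conj_ofReal]

/-- Induction on `S'` with `S` fixed. For closed `S'`, the forms of `π(g) E(S)` are integrals over
`S`, and `g` decreases to the indicator of `S'`. The case `S' = S` gives idempotency. -/
theorem inner_proj_proj {S S' : Set X} (hS : MeasurableSet S) (hS' : MeasurableSet S') (x : H) :
    ⟪x, proj π S' (proj π S x)⟫_ℂ = ((vectorMeasure π x).real (S' ∩ S) : ℂ) := by
  induction S', hS' using MeasurableSpace.induction_on_inter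
    ((BorelSpace.measurable_eq (α := X)).trans borel_eq_generateFrom_isClosed)
    isPiSystem_isClosed with
  | empty =>
    have : proj π (∅ : Set X) = 0 := ContinuousLinearMap.ext_inner_self fun x => by
      rw [inner_proj π MeasurableSet.empty]
      simp
    simp [this]
  | basic F hF =>
    replace hF : IsClosed F := hF
    have lim : ∀ x, Tendsto (fun n => ⟪x, π (approxClosed hF n) x⟫_ℂ) atTop
        (𝓝 ⟪x, proj π F x⟫_ℂ) := fun x => by
      have := tendsto_integral_mul_approxClosed (vectorMeasure π x) hF
        (integrable_const (1 : ℂ))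
      simpa [inner_apply, inner_proj π hF.measurableSet] using this
    refine tendsto_nhds_unique (tendsto_inner_of_tendsto_inner_self lim x (proj π S x)) ?_
    simp only [inner_apply_proj π hS]
    have := tendsto_integral_mul_approxClosed ((vectorMeasure π x).restrict S) hF
      (integrable_const (1 : ℂ))
    simpa [measureReal_restrict_apply hF.measurableSet] using this
  | compl T hT ih =>
    have : proj π Tᶜ = 1 - proj π T := ContinuousLinearMap.ext_inner_self fun x => by
      rw [sub_apply, one_apply_eq_self, inner_sub_right, inner_proj π hT, inner_proj π hT.compl,
        measureReal_compl hT, vectorMeasure_real_univ, inner_self_eq_norm_sq_to_K]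
      push_cast
      rfl
    have h2 := measureReal_sdiff_add_inter (μ := vectorMeasure π x) (s := S) hT
    rw [this, sub_apply, one_apply_eq_self, inner_sub_right, inner_proj π hS, ih,
      Set.inter_comm Tᶜ, Set.inter_comm T, ← Set.sdiff_eq, ← h2]
    push_cast
    ring
  | iUnion f hd hm ih =>
    have lim : ∀ x, Tendsto (fun n => ⟪x, (∑ i ∈ Finset.range n, proj π (f i)) x⟫_ℂ) atTop
        (𝓝 ⟪x, proj π (⋃ i, f i) x⟫_ℂ) := fun x => by
      have h := (hasSum_integral_iUnion hm hd
        (integrable_const (1 : ℂ) (μ := vectorMeasure π x)).integrableOn).tendsto_sum_nat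
      rw [inner_proj π (MeasurableSet.iUnion hm)]
      simp only [sum_apply, inner_sum, inner_proj π (hm _)]
      simpa using h
    refine tendsto_nhds_unique (tendsto_inner_of_tendsto_inner_self lim x (proj π S x)) ?_
    simp only [sum_apply, inner_sum, ih]
    have h := (hasSum_integral_iUnion hm hd
        (integrable_const (1 : ℂ) (μ := (vectorMeasure π x).restrict S)).integrableOn).tendsto_sum_nat
    simpa [measureReal_restrict_apply (hm _), measureReal_restrict_apply (MeasurableSet.iUnion hm)]
      using h

theorem proj_proj {S : Set X} (hS : MeasurableSet S) : proj π S * proj π S = proj π S :=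
  ContinuousLinearMap.ext_inner_self fun x => by
    rw [mul_apply_eq_comp, inner_proj_proj π hS hS, Set.inter_self, inner_proj π hS]

theorem norm_proj_sq {S : Set X} (hS : MeasurableSet S) (x : H) :
    ‖proj π S x‖ ^ 2 = (vectorMeasure π x).real S := by
  have h : ⟪proj π S x, proj π S x⟫_ℂ = ((vectorMeasure π x).real S : ℂ) := by
    nth_rw 1 [← adjoint_proj π hS]
    rw [ContinuousLinearMap.adjoint_inner_left, ← mul_apply_eq_comp, proj_proj π hS,
      inner_proj π hS]
  rw [inner_self_eq_norm_sq_to_K] at h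
  have h2 : ((‖proj π S x‖ ^ 2 : ℝ) : ℂ) = ((vectorMeasure π x).real S : ℂ) := by
    rw [← h]; push_cast; rfl
  exact_mod_cast h2

/-- The remainder after a finite set of indices is the projection of the uncovered part, whose
squared norm is a vanishing scalar mass. -/
theorem hasSum_proj {f : ℕ → Set X} (hm : ∀ i, MeasurableSet (f i))
    (hd : Pairwise (Function.onFun Disjoint f)) (x : H) :
    HasSum (fun i => proj π (f i) x) (proj π (⋃ i, f i) x) := by
  have h := hasSum_integral_iUnion hm hd
    (integrable_const (1 : ℝ) (μ := vectorMeasure π x)).integrableOn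
  simp only [setIntegral_const, smul_eq_mul, mul_one] at h
  have hF : ∀ F : Finset ℕ, ‖(∑ i ∈ F, proj π (f i) x) - proj π (⋃ i, f i) x‖ =
      Real.sqrt ((vectorMeasure π x).real (⋃ i, f i) - ∑ i ∈ F, (vectorMeasure π x).real (f i)) := by
    intro F
    have mF : MeasurableSet (⋃ i ∈ F, f i) := F.measurableSet_biUnion fun i _ => hm i
    have mU := MeasurableSet.iUnion hm
    have sub : (⋃ i ∈ F, f i) ⊆ ⋃ i, f i := Set.iUnion₂_subset fun i _ => Set.subset_iUnion f i
    have meas : ∀ x, (vectorMeasure π x).real ((⋃ i, f i) \ ⋃ i ∈ F, f i) =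
        (vectorMeasure π x).real (⋃ i, f i) - ∑ i ∈ F, (vectorMeasure π x).real (f i) := fun x => by
      rw [measureReal_sdiff sub mF, measureReal_biUnion_finset (fun i _ j _ hij => hd hij)
        (fun i _ => hm i)]
    have hp : proj π ((⋃ i, f i) \ ⋃ i ∈ F, f i) = proj π (⋃ i, f i) - ∑ i ∈ F, proj π (f i) :=
      ContinuousLinearMap.ext_inner_self fun x => by
        rw [inner_proj π (mU.diff mF), meas, sub_apply, sum_apply, inner_sub_right, inner_sum,
          inner_proj π mU]
        simp only [inner_proj π (hm _)]
        push_cast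
        rfl
    rw [← meas, ← norm_proj_sq π (mU.diff mF), Real.sqrt_sq (norm_nonneg _), hp, norm_sub_rev,
      sub_apply, sum_apply]
  rw [HasSum, SummationFilter.unconditional_filter, tendsto_iff_norm_sub_tendsto_zero]
  simp only [hF]
  have h2 : Tendsto (fun F : Finset ℕ => (vectorMeasure π x).real (⋃ i, f i) -
      ∑ i ∈ F, (vectorMeasure π x).real (f i)) atTop (𝓝 0) := by
    have := (tendsto_const_nhds (x := (vectorMeasure π x).real (⋃ i, f i))).sub h
    rwa [sub_self] at this
  have h3 := h2.sqrt
  rwa [Real.sqrt_zero] at h3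

/-- The image under a measurable map `c : X → ℝ` of the spectral measure of a representation of
`C(X)`. -/
noncomputable def realSpectralMeasure {c : X → ℝ} (hc : Measurable c) : RealSpectralMeasure H where
  proj S := proj π (c ⁻¹' S)
  isStarProjection S hS := ⟨proj_proj π (hc hS), adjoint_proj π (hc hS)⟩
  proj_univ := ContinuousLinearMap.ext_inner_self fun x => by
    rw [Set.preimage_univ, inner_proj π MeasurableSet.univ, vectorMeasure_real_univ,
      one_apply_eq_self, inner_self_eq_norm_sq_to_K]
    push_cast
    rfl
  hasSum_iUnion S hS hd x := by
    rw [Set.preimage_iUnion]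
    exact hasSum_proj π (fun i => hc (hS i)) (fun i j hij => (hd hij).preimage c) x

theorem scalarMeasure_realSpectralMeasure {c : X → ℝ} (hc : Measurable c) (x : H) :
    (realSpectralMeasure π hc).scalarMeasure x = (vectorMeasure π x).map c := by
  refine Measure.ext fun S hS => ?_
  rw [RealSpectralMeasure.scalarMeasure_apply _ _ hS, Measure.map_apply hc hS]
  change ENNReal.ofReal (‖proj π (c ⁻¹' S) x‖ ^ 2) = _
  rw [norm_proj_sq π (hc hS), ofReal_measureReal]

end CStarRepresentation

end

/-! ### Resolvents of unbounded self-adjoint operators. -/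

section

open MeasureTheory Filter Topology

section Resolvent

variable {H : Type*} [NormedAddCommGroup H] [InnerProductSpace ℂ H] [CompleteSpace H]
variable {A : H →ₗ.[ℂ] H}

theorem IsSelfAdjoint.inner_apply (hA : IsSelfAdjoint A) (x y : A.domain) :
    ⟪A x, (y : H)⟫_ℂ = ⟪(x : H), A y⟫_ℂ := by
  have h := LinearPMap.adjoint_isFormalAdjoint hA.dense_domain
  rw [LinearPMap.isSelfAdjoint_def.1 hA] at h
  exact h x y

/-- `⟪x, A x⟫` is real, so `⟪x, (A - z) x⟫` has imaginary part `-Im z ‖x‖²`; then Cauchy-Schwarz. -/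
theorem IsSelfAdjoint.norm_le_norm_sub_smul (hA : IsSelfAdjoint A) (z : ℂ) (x : A.domain) :
    |z.im| * ‖(x : H)‖ ≤ ‖A x - z • (x : H)‖ := by
  rcases eq_or_ne (x : H) 0 with hx | hx
  · simp [hx]
  have hx' : 0 < ‖(x : H)‖ := norm_pos_iff.2 hx
  have h1 : (⟪(x : H), A x⟫_ℂ).im = 0 := by
    rw [← Complex.conj_eq_iff_im, inner_conj_symm, hA.inner_apply]
  have h2 : (⟪(x : H), A x - z • (x : H)⟫_ℂ).im = -(z.im * ‖(x : H)‖ ^ 2) := by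
    rw [inner_sub_right, inner_smul_right, inner_self_eq_norm_sq_to_K, Complex.sub_im, h1]
    change 0 - (z * ((‖(x : H)‖ : ℝ) : ℂ) ^ 2).im = _
    rw [← Complex.ofReal_pow, Complex.im_mul_ofReal, zero_sub]
  have h3 := (Complex.abs_im_le_norm _).trans (norm_inner_le_norm (𝕜 := ℂ) (x : H) (A x - z • (x : H)))
  rw [h2, abs_neg, abs_mul, abs_of_nonneg (sq_nonneg ‖(x : H)‖)] at h3
  refine le_of_mul_le_mul_left (le_of_eq_of_le ?_ h3) hx'
  ring

theorem IsSelfAdjoint.eq_of_sub_smul_eq (hA : IsSelfAdjoint A) {z : ℂ} (hz : z.im ≠ 0)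
    {x y : A.domain} (h : A x - z • (x : H) = A y - z • (y : H)) : x = y := by
  have h1 := hA.norm_le_norm_sub_smul z (x - y)
  have h2 : A (x - y) - z • ((x - y : A.domain) : H) = 0 := by
    rw [LinearPMap.map_sub, Submodule.coe_sub, smul_sub, sub_sub_sub_comm, h, sub_self]
  rw [h2, norm_zero] at h1
  have h3 : ‖((x - y : A.domain) : H)‖ ≤ 0 := by
    by_contra! h4
    have := mul_pos (abs_pos.2 hz) h4
    linarith
  have h5 := norm_le_zero_iff.1 h3
  rw [Submodule.coe_sub] at h5
  exact Subtype.ext (sub_eq_zero.1 h5)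

/-- The range is closed, by the lower bound and the closed graph of `A`. A vector orthogonal to it
lies in the kernel of `A* - z̄ = A - z̄`, which is trivial. -/
theorem IsSelfAdjoint.surjective_sub_smul (hA : IsSelfAdjoint A) {z : ℂ} (hz : z.im ≠ 0) (y : H) :
    ∃ x : A.domain, A x - z • (x : H) = y := by
  let S : A.domain →ₗ[ℂ] H := A.toFun - z • A.domain.subtype
  have hS : ∀ x, S x = A x - z • (x : H) := fun x => rfl
  have hz' : 0 < |z.im| := abs_pos.2 hz
  have closed : IsClosed (LinearMap.range S : Set H) := by
    refine IsSeqClosed.isClosed fun u y hu huy => ?_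
    choose x hx using hu
    have cx : CauchySeq fun n => (x n : H) := by
      refine Metric.cauchySeq_iff.2 fun ε hε => ?_
      obtain ⟨N, hN⟩ := Metric.cauchySeq_iff.1 huy.cauchySeq (|z.im| * ε) (by positivity)
      refine ⟨N, fun m hm n hn => ?_⟩
      have h1 := hN m hm n hn
      rw [← hx, ← hx, dist_eq_norm, ← map_sub] at h1
      have h2 := (hA.norm_le_norm_sub_smul z (x m - x n)).trans_lt h1
      rw [dist_eq_norm]
      exact lt_of_mul_lt_mul_left h2 hz'.le
    obtain ⟨x₀, hx₀⟩ := cauchySeq_tendsto_of_complete cx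
    have hAx : Tendsto (fun n => A (x n)) atTop (𝓝 (y + z • x₀)) := by
      refine (huy.add (hx₀.const_smul z)).congr fun n => ?_
      rw [← hx, hS, sub_add_cancel]
    have mem : (x₀, y + z • x₀) ∈ A.graph :=
      (show IsClosed (A.graph : Set (H × H)) from hA.isClosed).mem_of_tendsto
        (hx₀.prodMk_nhds hAx) (Eventually.of_forall fun n => A.mem_graph (x n))
    obtain ⟨w, h1, h2⟩ := (LinearPMap.mem_graph_iff A).1 mem
    dsimp only at h1 h2
    exact ⟨w, by rw [hS, h1, h2, add_sub_cancel_right]⟩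
  have dense : (LinearMap.range S)ᗮ = ⊥ := by
    rw [Submodule.eq_bot_iff]
    intro w hw
    rw [Submodule.mem_orthogonal'] at hw
    have h1 : ∀ x : A.domain, ⟪starRingEnd ℂ z • w, (x : H)⟫_ℂ = ⟪w, A x⟫_ℂ := fun x => by
      have := hw (S x) ⟨x, rfl⟩
      rw [hS, inner_sub_right, inner_smul_right, sub_eq_zero] at this
      rw [this, inner_smul_left, Complex.conj_conj]
    have h2 : w ∈ A.domain := by
      have := LinearPMap.mem_adjoint_domain_of_exists (T := A) w ⟨_, h1⟩
      rwa [LinearPMap.isSelfAdjoint_def.1 hA] at this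
    have h3 : A ⟨w, h2⟩ = starRingEnd ℂ z • w := by
      refine hA.dense_domain.eq_of_inner_left (𝕜 := ℂ) fun x hx => ?_
      rw [hA.inner_apply ⟨w, h2⟩ ⟨x, hx⟩]
      exact (h1 ⟨x, hx⟩).symm
    have h4 := hA.eq_of_sub_smul_eq (z := starRingEnd ℂ z) (x := ⟨w, h2⟩) (y := 0)
      (by simpa using hz) (by rw [h3]; simp)
    exact congrArg Subtype.val h4
  have top := Submodule.topologicalClosure_eq_top_iff.2 dense
  rw [closed.submodule_topologicalClosure_eq] at top
  exact LinearMap.range_eq_top.1 top y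

/-- The resolvent of a self-adjoint operator at a non-real point. -/
theorem IsSelfAdjoint.exists_resolvent (hA : IsSelfAdjoint A) {z : ℂ} (hz : z.im ≠ 0) :
    ∃ R : H →L[ℂ] H, ∀ y, ∃ w : A.domain, (w : H) = R y ∧ A w = y + z • (w : H) := by
  choose w hw using hA.surjective_sub_smul hz
  have uniq : ∀ {x : A.domain} {y : H}, A x - z • (x : H) = y → w y = x := fun {x y} h =>
    hA.eq_of_sub_smul_eq hz ((hw y).trans h.symm)
  let R₀ : H →ₗ[ℂ] H :=
    { toFun := fun y => w y
      map_add' := fun y y' => by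
        rw [← Submodule.coe_add, uniq (x := w y + w y')]
        rw [LinearPMap.map_add, Submodule.coe_add, smul_add, add_sub_add_comm, hw, hw]
      map_smul' := fun c y => by
        rw [RingHom.id_apply, ← Submodule.coe_smul, uniq (x := c • w y)]
        rw [LinearPMap.map_smul, Submodule.coe_smul, smul_comm, ← smul_sub, hw] }
  refine ⟨R₀.mkContinuous |z.im|⁻¹ fun y => ?_, fun y => ⟨w y, rfl, ?_⟩⟩
  · rw [inv_mul_eq_div, le_div_iff₀ (abs_pos.2 hz), mul_comm]
    have := hA.norm_le_norm_sub_smul z (w y)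
    rwa [hw] at this
  · exact sub_eq_iff_eq_add.1 (hw y)

theorem IsSelfAdjoint.resolvent_apply_sub (hA : IsSelfAdjoint A) {z : ℂ} (hz : z.im ≠ 0)
    {R : H →L[ℂ] H} (hR : ∀ y, ∃ w : A.domain, (w : H) = R y ∧ A w = y + z • (w : H))
    (x : A.domain) : R (A x - z • (x : H)) = x := by
  obtain ⟨w, h1, h2⟩ := hR (A x - z • (x : H))
  rw [← h1, hA.eq_of_sub_smul_eq hz (sub_eq_iff_eq_add.2 h2)]

theorem IsSelfAdjoint.adjoint_resolvent (hA : IsSelfAdjoint A) {z z' : ℂ}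
    (hzz' : starRingEnd ℂ z = z') {R R' : H →L[ℂ] H}
    (hR : ∀ y, ∃ w : A.domain, (w : H) = R y ∧ A w = y + z • (w : H))
    (hR' : ∀ y, ∃ w : A.domain, (w : H) = R' y ∧ A w = y + z' • (w : H)) :
    ContinuousLinearMap.adjoint R = R' := by
  refine ((ContinuousLinearMap.eq_adjoint_iff _ _).2 fun x y => ?_).symm
  obtain ⟨w, h1, h2⟩ := hR' x
  obtain ⟨v, h3, h4⟩ := hR y
  rw [← h1, ← h3, ← sub_eq_iff_eq_add.2 h4, ← sub_eq_iff_eq_add.2 h2, inner_sub_left,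
    inner_sub_right, hA.inner_apply, inner_smul_left, inner_smul_right, ← hzz', Complex.conj_conj]

theorem IsSelfAdjoint.resolvent_identity (hA : IsSelfAdjoint A) {z z' : ℂ} (hz : z.im ≠ 0)
    {R R' : H →L[ℂ] H}
    (hR : ∀ y, ∃ w : A.domain, (w : H) = R y ∧ A w = y + z • (w : H))
    (hR' : ∀ y, ∃ w : A.domain, (w : H) = R' y ∧ A w = y + z' • (w : H)) :
    R - R' = (z - z') • (R * R') := by
  ext y
  obtain ⟨w, h1, h2⟩ := hR y
  obtain ⟨v, h3, h4⟩ := hR' y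
  have := hA.resolvent_apply_sub hz hR (w - v)
  rw [LinearPMap.map_sub, Submodule.coe_sub, h2, h4] at this
  rw [sub_apply, smul_apply, mul_apply_eq_comp, ← h1, ← h3, ← this, ← map_smul]
  congr 1
  module

end Resolvent

namespace RealSpectralMeasure

variable {H : Type*} [NormedAddCommGroup H] [InnerProductSpace ℂ H] [CompleteSpace H]

/-- A spectral measure whose resolvent is that of a self-adjoint operator is its spectral measure. -/
theorem isIntegral_of_resolvent (E : RealSpectralMeasure H) {A : H →ₗ.[ℂ] H} (hA : IsSelfAdjoint A)
    {z : ℂ} (hz : z.im ≠ 0) {R : H →L[ℂ] H}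
    (hR : ∀ y, ∃ w : A.domain, (w : H) = R y ∧ A w = y + z • (w : H))
    (h : ∀ x, ⟪x, E.vectorIntegral (resolventFun z) x⟫_ℂ = ⟪x, R x⟫_ℂ) :
    E.IsIntegral (fun t => (t : ℂ)) A := by
  have mr := measurable_resolventFun z
  have mid : Measurable fun t : ℝ => (t : ℂ) := by fun_prop
  have eqR : ∀ x, E.vectorIntegral (resolventFun z) x = R x := by
    let S₀ : H →ₗ[ℂ] H :=
      { toFun := E.vectorIntegral (resolventFun z)
        map_add' := fun x y => E.vectorIntegral_add_right mr (E.memLp_resolventFun hz x)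
          (E.memLp_resolventFun hz y)
        map_smul' := fun c x => E.vectorIntegral_smul_right mr c (E.memLp_resolventFun hz x) }
    let S : H →L[ℂ] H := S₀.mkContinuous _ fun x =>
      E.norm_vectorIntegral_le x mr (norm_resolventFun_le hz)
    have : S = R := ContinuousLinearMap.ext_inner_self h
    intro x
    rw [← this]
    rfl
  have key : ∀ y, MemLp (fun t : ℝ => (t : ℂ)) 2 (E.scalarMeasure (R y)) ∧
      E.vectorIntegral (fun t : ℝ => (t : ℂ)) (R y) = y + z • R y := fun y => by
    rw [← eqR]; exact E.integral_resolvent hz y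
  -- Each `x` in the domain of `A` is `R (A x - z x)`, and the range of `R` lies in the domain of `∫
  -- t dE`.
  have hle : A ≤ E.integral _ mid := by
    refine ⟨fun x hx => ?_, fun x y hxy => ?_⟩
    · have h1 := (key (A ⟨x, hx⟩ - z • x)).1
      rw [show R (A ⟨x, hx⟩ - z • x) = x from hA.resolvent_apply_sub hz hR ⟨x, hx⟩] at h1
      exact (E.mem_integral_domain mid).2 h1
    · have h1 := (key (A x - z • (x : H))).2
      rw [hA.resolvent_apply_sub hz hR x, sub_add_cancel] at h1
      rw [integral_apply, ← hxy, h1]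
  have hd : Dense ((E.integral _ mid).domain : Set H) := hA.dense_domain.mono hle.1
  have : A = E.integral _ mid := by
    refine LinearPMap.eq_of_le_of_domain_eq hle (le_antisymm hle.1 fun x hx => ?_)
    -- Conversely, `R` is also the resolvent of `∫ t dE`, so that domain lies in the range of `R`,
    -- hence in the domain of `A`.
    have h1 := IsIntegral.resolvent_left E (E.isIntegral_integral mid) hd hz ⟨x, hx⟩
    rw [eqR] at h1
    obtain ⟨w, h2, -⟩ := hR (E.integral _ mid ⟨x, hx⟩ - z • x)
    change R (E.integral _ mid ⟨x, hx⟩ - z • x) = x at h1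
    rw [← h1, ← h2]
    exact w.2
  rw [this]
  exact E.isIntegral_integral mid

end RealSpectralMeasure

end

/-! ### The spectral theorem for unbounded self-adjoint operators. -/

section

open MeasureTheory Filter Topology

section SpectralTheorem

open CStarRepresentation

variable {H : Type*} [NormedAddCommGroup H] [InnerProductSpace ℂ H] [CompleteSpace H]

/-- **The spectral theorem** for unbounded self-adjoint operators. -/
theorem IsSelfAdjoint.exists_isIntegral {A : H →ₗ.[ℂ] H} (hA : IsSelfAdjoint A) :
    ∃ E : RealSpectralMeasure H, E.IsIntegral (fun t => (t : ℂ)) A := by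
  have hI : (Complex.I).im ≠ 0 := by simp
  have hI' : (-Complex.I).im ≠ 0 := by simp
  obtain ⟨R, hR⟩ := hA.exists_resolvent hI
  obtain ⟨R', hR'⟩ := hA.exists_resolvent hI'
  have adj : star R = R' := hA.adjoint_resolvent (by simp) hR hR'
  have e1 := hA.resolvent_identity hI hR hR'
  have e2 := hA.resolvent_identity hI' hR' hR
  have e2' : R - R' = (2 * Complex.I) • (R' * R) := by
    rw [← neg_sub, e2, ← neg_smul]
    congr 1
    ring
  have e1' : R - R' = (2 * Complex.I) • (R * R') := by
    rw [e1]
    congr 1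
    ring
  -- The resolvent identities at `i` and `-i` express `R - R'` through both `R R'` and `R' R`, so
  -- the two products agree.
  have normal : IsStarNormal R := ⟨by
    rw [adj, commute_iff_eq]
    exact smul_right_injective _ (mul_ne_zero two_ne_zero Complex.I_ne_zero)
      (e2'.symm.trans e1')⟩
  set π : C(spectrum ℂ R, ℂ) →⋆ₐ[ℂ] (H →L[ℂ] H) := cfcHom normal with hπ
  set ι : C(spectrum ℂ R, ℂ) := (ContinuousMap.id ℂ).restrict (spectrum ℂ R) with hι
  have hid : π ι = R := cfcHom_id normal
  have hidx : ∀ y, R y = π ι y := fun y => by rw [hid]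
  -- On the spectrum, `z - z̄ = 2i|z|²`: for `z ≠ 0` this says that `1/z` has imaginary part `-1`,
  -- so `z = 1/(t - i)` with `t = Re (1/z)`.
  have rel : ι - star ι = (2 * Complex.I) • (ι * star ι) := by
    apply cfcHom_injective normal
    change π _ = π _
    rw [map_sub, map_smul, map_mul, map_star, hid, adj, e1']
  have hc : Measurable fun z : spectrum ℂ R => ((z : ℂ)⁻¹).re := by fun_prop
  -- The point `0` may belong to the spectrum of `R`, but `R` kills its spectral projection and is
  -- injective, so it carries no mass.
  have null : ∀ x, vectorMeasure π x {z | (z : ℂ) = 0} = 0 := fun x => by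
    have mS : MeasurableSet {z : spectrum ℂ R | (z : ℂ) = 0} :=
      measurableSet_eq_fun (by fun_prop) measurable_const
    have h1 : R * proj π {z | (z : ℂ) = 0} = 0 := ContinuousLinearMap.ext_inner_self fun x => by
      rw [mul_apply_eq_comp, hidx, inner_apply_proj π mS, setIntegral_congr_fun mS (g := 0)]
      · simp
      · exact fun z hz => hz
    have h2 : proj π {z | (z : ℂ) = 0} x = 0 := by
      have h3 := congrArg (fun T : H →L[ℂ] H => T x) h1
      rw [mul_apply_eq_comp] at h3
      obtain ⟨w, h4, h5⟩ := hR (proj π {z | (z : ℂ) = 0} x)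
      have h6 : w = 0 := Subtype.ext (h4.trans h3)
      rw [h6, LinearPMap.map_zero] at h5
      simpa using h5.symm
    have h3 := norm_proj_sq π mS x
    rw [h2, norm_zero, zero_pow two_ne_zero] at h3
    exact (measureReal_eq_zero_iff).1 h3.symm
  refine ⟨realSpectralMeasure π hc, RealSpectralMeasure.isIntegral_of_resolvent _ hA hI hR
    fun x => ?_⟩
  have mr := RealSpectralMeasure.measurable_resolventFun Complex.I
  rw [RealSpectralMeasure.inner_vectorIntegral _ mr (RealSpectralMeasure.memLp_resolventFun _ hI x),
    scalarMeasure_realSpectralMeasure, integral_map hc.aemeasurable mr.aestronglyMeasurable,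
    hidx, CStarRepresentation.inner_apply]
  refine integral_congr_ae ?_
  have : ∀ᵐ z : spectrum ℂ R ∂(vectorMeasure π x), (z : ℂ) ≠ 0 := by
    rw [ae_iff]
    simpa using null x
  filter_upwards [this] with z hz
  have h1 : (z : ℂ) - starRingEnd ℂ z = 2 * Complex.I * (z * starRingEnd ℂ z) :=
    congrArg (fun g : C(spectrum ℂ R, ℂ) => g z) rel
  have hz' : starRingEnd ℂ (z : ℂ) ≠ 0 := (map_ne_zero _).2 hz
  have h2 : (z : ℂ)⁻¹ = (((z : ℂ)⁻¹).re : ℂ) - Complex.I := by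
    rw [Complex.re_eq_add_conj, map_inv₀]
    field_simp
    linear_combination -h1
  rw [RealSpectralMeasure.resolventFun, ← h2, inv_inv]
  rfl

theorem IsSelfAdjoint.isFunctionOfOperator {A : H →ₗ.[ℂ] H} (hA : IsSelfAdjoint A) {f : ℝ → ℂ}
    (hf : Measurable f) : IsFunctionOfOperator f A (operatorFunction f A) := by
  obtain ⟨E, hE⟩ := hA.exists_isIntegral
  have h : ∃ T, IsFunctionOfOperator f A T := ⟨_, E, hE, E.isIntegral_integral hf⟩
  rw [operatorFunction, dif_pos h]
  exact h.choose_spec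

end SpectralTheorem

end

/-! ### Poisson integrals of periodic functions as Poisson integrals on the circle. -/

section

open MeasureTheory Filter Topology ProbabilityTheory

section PeriodicFunctions

/-- Integration of periodic functions against an integrable weight. -/
noncomputable def weightedIntegral (p : ℝ) [Fact (0 < p)] {ρ : Measure ℝ} {k : ℝ → ℝ}
    (hk : Integrable k ρ) : C(AddCircle p, ℂ) →L[ℂ] ℂ :=
  LinearMap.mkContinuous
    { toFun := fun g => ∫ t, k t • g (t : AddCircle p) ∂ρ
      map_add' := fun g g' => by
        rw [← integral_add
          (integrable_smul_of_bounded hk (by fun_prop) fun t => g.norm_coe_le_norm _)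
          (integrable_smul_of_bounded hk (by fun_prop) fun t => g'.norm_coe_le_norm _)]
        simp only [ContinuousMap.add_apply, smul_add]
      map_smul' := fun c g => by
        rw [RingHom.id_apply, ← integral_smul]
        exact integral_congr_ae (Eventually.of_forall fun t =>
          smul_comm (k t) c (g (t : AddCircle p))) }
    (∫ t, ‖k t‖ ∂ρ) fun g => by
      rw [← integral_mul_const]
      refine norm_integral_le_of_norm_le (hk.norm.mul_const _) (Eventually.of_forall fun t => ?_)
      rw [norm_smul]
      gcongr
      exact g.norm_coe_le_norm _

/-- Weighted measures with the same Fourier coefficients have the same integrals of continuous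
periodic functions. -/
theorem integral_smul_eq_of_fourier {ρ₁ ρ₂ : Measure ℝ} {k₁ k₂ : ℝ → ℝ} (hk₁ : Integrable k₁ ρ₁)
    (hk₂ : Integrable k₂ ρ₂)
    (hF : ∀ n : ℤ, ∫ t, k₁ t • Complex.exp (n * t * Complex.I) ∂ρ₁ =
      ∫ t, k₂ t • Complex.exp (n * t * Complex.I) ∂ρ₂)
    {h : ℝ → ℂ} (hc : Continuous h) (hp : Function.Periodic h (2 * Real.pi)) :
    ∫ t, k₁ t • h t ∂ρ₁ = ∫ t, k₂ t • h t ∂ρ₂ := by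
  have : Fact (0 < 2 * Real.pi) := ⟨Real.two_pi_pos⟩
  let g : C(AddCircle (2 * Real.pi), ℂ) := ⟨hp.lift, continuous_coinduced_dom.2 hc⟩
  have hg : ∀ t : ℝ, g t = h t := fun t => hp.lift_coe t
  -- Two bounded functionals on continuous periodic functions agree once they agree on the dense
  -- span of the characters.
  have key : weightedIntegral (2 * Real.pi) hk₁ = weightedIntegral (2 * Real.pi) hk₂ := by
    refine ContinuousLinearMap.ext_on (s := Set.range (@fourier (2 * Real.pi)))
      (Submodule.dense_iff_topologicalClosure_eq_top.2 span_fourier_closure_eq_top) ?_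
    rintro _ ⟨n, rfl⟩
    have e : ∀ t : ℝ, fourier n (t : AddCircle (2 * Real.pi)) =
        Complex.exp (n * t * Complex.I) := fun t => by
      rw [fourier_coe_apply]
      congr 1
      have : (Real.pi : ℂ) ≠ 0 := by exact_mod_cast Real.pi_ne_zero
      push_cast
      field_simp
    change ∫ t, k₁ t • fourier n (t : AddCircle (2 * Real.pi)) ∂ρ₁ =
      ∫ t, k₂ t • fourier n (t : AddCircle (2 * Real.pi)) ∂ρ₂
    simp only [e]
    exact hF n
  have := congrArg (fun T : C(AddCircle (2 * Real.pi), ℂ) →L[ℂ] ℂ => T g) key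
  change ∫ t, k₁ t • g (t : AddCircle (2 * Real.pi)) ∂ρ₁ =
    ∫ t, k₂ t • g (t : AddCircle (2 * Real.pi)) ∂ρ₂ at this
  simpa only [hg] using this

/-- The Poisson kernel of the disc on the circle of radius `exp (-s)`. -/
noncomputable def circleKernel (s x t : ℝ) : ℝ :=
  poissonKernel 0 (Complex.exp (-s + x * Complex.I)) (Complex.exp (t * Complex.I))

theorem circleKernel_eq (s x t : ℝ) : circleKernel s x t = (1 - Real.exp (-s) ^ 2) /
    ‖Complex.exp (t * Complex.I) - Real.exp (-s) * Complex.exp (x * Complex.I)‖ ^ 2 := by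
  rw [circleKernel, poissonKernel_def]
  simp [Complex.norm_exp, Complex.exp_add]

theorem one_sub_exp_le_norm (s x t : ℝ) : 1 - Real.exp (-s) ≤
    ‖Complex.exp (t * Complex.I) - Real.exp (-s) * Complex.exp (x * Complex.I)‖ := by
  have := norm_sub_norm_le (Complex.exp (t * Complex.I))
    (Real.exp (-s) * Complex.exp (x * Complex.I))
  rw [norm_mul, Complex.norm_exp_ofReal_mul_I, Complex.norm_exp_ofReal_mul_I, mul_one,
    Complex.norm_real, Real.norm_of_nonneg (Real.exp_pos _).le] at this
  exact this

variable {s : ℝ}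

theorem continuous_circleKernel (hs : 0 < s) :
    Continuous fun q : ℝ × ℝ => circleKernel s q.1 q.2 := by
  simp only [circleKernel_eq]
  refine continuous_const.div (by fun_prop) fun q => ?_
  have := one_sub_exp_le_norm s q.1 q.2
  have h2 : 0 < 1 - Real.exp (-s) := sub_pos.2 (by simpa using hs)
  have := h2.trans_le this
  positivity

theorem circleKernel_nonneg (hs : 0 < s) (x t : ℝ) : 0 ≤ circleKernel s x t := by
  rw [circleKernel_eq]
  have h2 : Real.exp (-s) ≤ 1 := Real.exp_le_one_iff.2 (by linarith)
  have : Real.exp (-s) ^ 2 ≤ 1 := pow_le_one₀ (Real.exp_pos _).le h2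
  exact div_nonneg (by linarith) (by positivity)

theorem norm_circleKernel_le (hs : 0 < s) (x t : ℝ) :
    ‖circleKernel s x t‖ ≤ (1 - Real.exp (-s) ^ 2) / (1 - Real.exp (-s)) ^ 2 := by
  rw [Real.norm_of_nonneg (circleKernel_nonneg hs x t), circleKernel_eq]
  have h2 : 0 < 1 - Real.exp (-s) := sub_pos.2 (by simpa using hs)
  have : Real.exp (-s) ^ 2 ≤ 1 := pow_le_one₀ (Real.exp_pos _).le (by linarith)
  have := one_sub_exp_le_norm s x t
  gcongr

/-- The measure `dt / 2π` on a period. -/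
noncomputable def periodMeasure : Measure ℝ :=
  (ENNReal.ofReal (2 * Real.pi)⁻¹) • volume.restrict (Set.Ioc 0 (2 * Real.pi))

instance : IsFiniteMeasure periodMeasure := by
  unfold periodMeasure
  exact Measure.smul_finite _ ENNReal.ofReal_ne_top

theorem integral_periodMeasure (h : ℝ → ℂ) :
    ∫ t, h t ∂periodMeasure = (2 * Real.pi)⁻¹ • ∫ t in (0)..(2 * Real.pi), h t := by
  rw [periodMeasure, integral_smul_measure, intervalIntegral.integral_of_le Real.two_pi_pos.le,
    ENNReal.toReal_ofReal (inv_nonneg.2 Real.two_pi_pos.le)]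

/-- The Poisson formula for the holomorphic function `z^n` at the point `e^{-s + ix}`. -/
theorem integral_circleKernel_exp_nat (hs : 0 < s) (x : ℝ) (n : ℕ) :
    ∫ t, circleKernel s x t • Complex.exp (n * t * Complex.I) ∂periodMeasure =
      Real.exp (-s * n) * Complex.exp (n * x * Complex.I) := by
  have hw : Complex.exp (-s + x * Complex.I) ∈ Metric.ball (0 : ℂ) 1 := by
    simp [Complex.norm_exp, hs]
  have h := DiffContOnCl.circleAverage_poissonKernel_smul (f := fun z : ℂ => z ^ n) (R := 1)
    (differentiable_pow n).diffContOnCl hw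
  rw [Real.circleAverage, ← integral_periodMeasure] at h
  have e : ∀ t : ℝ, (poissonKernel 0 (Complex.exp (-s + x * Complex.I)) • fun z : ℂ => z ^ n)
      (circleMap 0 1 t) = circleKernel s x t • Complex.exp (n * t * Complex.I) := fun t => by
    rw [Pi.smul_apply', circleMap, circleKernel, Complex.ofReal_one, one_mul, zero_add,
      ← Complex.exp_nat_mul, mul_assoc]
  simp only [e] at h
  rw [h, ← Complex.exp_nat_mul, Complex.ofReal_exp, ← Complex.exp_add]
  congr 1
  push_cast
  ring

theorem integral_circleKernel_exp (hs : 0 < s) (x : ℝ) (n : ℤ) :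
    ∫ t, circleKernel s x t • Complex.exp (n * t * Complex.I) ∂periodMeasure =
      Real.exp (-s * |(n : ℝ)|) * Complex.exp (n * x * Complex.I) := by
  obtain ⟨m, rfl | rfl⟩ := n.eq_nat_or_neg
  · simpa using integral_circleKernel_exp_nat hs x m
  · have h := congrArg (starRingEnd ℂ) (integral_circleKernel_exp_nat hs x m)
    rw [← integral_conj] at h
    simpa [← Complex.exp_conj, Complex.real_smul] using h

theorem integrable_circleKernel (hs : 0 < s) (x : ℝ) :
    Integrable (circleKernel s x) periodMeasure :=
  Integrable.of_bound ((continuous_circleKernel hs).comp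
    (Continuous.prodMk_right x)).aestronglyMeasurable _
    (Eventually.of_forall (norm_circleKernel_le hs x))

/-- The Poisson integral of a periodic function. -/
theorem poissonIntegral_eq_of_periodic {s : ℝ≥0} (hs : s ≠ 0) (x : ℝ) {h : ℝ → ℂ}
    (hc : Continuous h) (hp : Function.Periodic h (2 * Real.pi)) :
    poissonIntegral s h x = ∫ t, circleKernel s x t • h t ∂periodMeasure := by
  have hs' : (0 : ℝ) < s := by positivity
  have h1 : ∫ t, (1 : ℝ) • h t ∂((cauchyMeasure 0 s).map (x + ·)) = poissonIntegral s h x := by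
    rw [integral_map (by fun_prop) (by fun_prop)]
    simp [poissonIntegral]
  rw [← h1]
  have : IsFiniteMeasure ((cauchyMeasure 0 s).map (x + ·)) := by infer_instance
  -- Both sides have Fourier coefficients `e^{-s|n|} e^{inx}`, on the line by the characteristic
  -- function of the Cauchy law.
  refine integral_smul_eq_of_fourier (integrable_const 1) (integrable_circleKernel hs' x)
    (fun n => ?_) hc hp
  rw [integral_circleKernel_exp hs', integral_map (by fun_prop) (by fun_prop)]
  have := charFun_cauchyMeasure s n
  rw [charFun_apply_real] at this
  rw [← this, mul_comm, ← integral_const_mul]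
  congr 1
  ext t
  rw [one_smul, ← Complex.exp_add]
  congr 1
  push_cast
  ring

/-- The Poisson integral over the circle of a measure on the line. -/
noncomputable def circleDensity (s : ℝ) (μ : Measure ℝ) (t : ℝ) : ℝ :=
  ∫ x, circleKernel s x t ∂μ

theorem integrable_circleKernel_prod (hs : 0 < s) (μ : Measure ℝ) [IsFiniteMeasure μ] :
    Integrable (fun q : ℝ × ℝ => circleKernel s q.1 q.2) (μ.prod periodMeasure) :=
  Integrable.of_bound (continuous_circleKernel hs).aestronglyMeasurable _
    (Eventually.of_forall fun q => norm_circleKernel_le hs q.1 q.2)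

theorem integrable_circleDensity (hs : 0 < s) (μ : Measure ℝ) [IsFiniteMeasure μ] :
    Integrable (circleDensity s μ) periodMeasure :=
  (integrable_circleKernel_prod hs μ).integral_prod_right

theorem integral_circleDensity (hs : 0 < s) (μ : Measure ℝ) [IsFiniteMeasure μ] :
    ∫ t, circleDensity s μ t ∂periodMeasure = μ.real Set.univ := by
  unfold circleDensity
  rw [integral_integral_swap (f := fun t x => circleKernel s x t)
    (integrable_circleKernel_prod hs μ).swap]
  have : ∀ x : ℝ, ∫ t, circleKernel s x t ∂periodMeasure = 1 := fun x => by
    have h := integral_circleKernel_exp_nat hs x 0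
    simp only [Nat.cast_zero, zero_mul, Complex.exp_zero, Complex.real_smul, mul_one, mul_zero,
      Real.exp_zero, Complex.ofReal_one, integral_complex_ofReal] at h
    exact_mod_cast h
  simp [this]

theorem integral_poissonIntegral_of_periodic {s : ℝ≥0} (hs : s ≠ 0) (μ : Measure ℝ)
    [IsFiniteMeasure μ] {h : ℝ → ℂ} (hc : Continuous h)
    (hp : Function.Periodic h (2 * Real.pi)) {M : ℝ} (hM : ∀ x, ‖h x‖ ≤ M) :
    ∫ x, poissonIntegral s h x ∂μ = ∫ t, circleDensity s μ t • h t ∂periodMeasure := by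
  simp only [fun x => poissonIntegral_eq_of_periodic hs x hc hp]
  rw [integral_integral_swap (f := fun x t => circleKernel s x t • h t)]
  · simp only [integral_smul_const, circleDensity]
  · exact (integrable_circleKernel_prod (by positivity) μ).smul_bdd M
      (hc.comp continuous_snd).aestronglyMeasurable (Eventually.of_forall fun q => hM q.2)

end PeriodicFunctions

end

/-! ### The Bernstein inequality for unitary operators. -/

section

open MeasureTheory Filter Topology

section UnitaryOperators

open CStarRepresentation

variable {H : Type*} [NormedAddCommGroup H] [InnerProductSpace ℂ H] [CompleteSpace H]

theorem CStarRepresentation.norm_apply_sq {X : Type*} [TopologicalSpace X] [CompactSpace X]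
    [T2Space X] [MeasurableSpace X] [BorelSpace X] (π : C(X, ℂ) →⋆ₐ[ℂ] (H →L[ℂ] H)) (g : C(X, ℂ))
    (x : H) : ‖π g x‖ ^ 2 = ∫ t, ‖g t‖ ^ 2 ∂(vectorMeasure π x) := by
  have h := CStarRepresentation.inner_apply π (star g * g) x
  rw [map_mul, map_star, mul_apply_eq_comp, ContinuousLinearMap.star_eq_adjoint,
    ContinuousLinearMap.adjoint_inner_right, inner_self_eq_norm_sq_to_K] at h
  have e : ∀ t, (star g * g) t = ((‖g t‖ ^ 2 : ℝ) : ℂ) := fun t => by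
    rw [ContinuousMap.mul_apply, ContinuousMap.star_apply, ← starRingEnd_apply, Complex.conj_mul']
    push_cast
    rfl
  simp only [e, integral_complex_ofReal] at h
  have h2 : ((‖π g x‖ ^ 2 : ℝ) : ℂ) =
      ((∫ t, ‖g t‖ ^ 2 ∂(vectorMeasure π x) : ℝ) : ℂ) := by
    rw [← h]; push_cast; rfl
  exact_mod_cast h2

variable (U V : unitary (H →L[ℂ] H))

/-- The continuous functional calculus of a unitary operator. -/
noncomputable def unitaryRep : C(spectrum ℂ (U : H →L[ℂ] H), ℂ) →⋆ₐ[ℂ] (H →L[ℂ] H) :=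
  cfcHom (p := IsStarNormal) inferInstance

theorem unitaryRep_id :
    unitaryRep U ((ContinuousMap.id ℂ).restrict (spectrum ℂ (U : H →L[ℂ] H))) = U :=
  cfcHom_id _

theorem norm_spectrum_unitary (z : spectrum ℂ (U : H →L[ℂ] H)) : ‖(z : ℂ)‖ = 1 :=
  spectrum.norm_eq_one_of_unitary U.2 z.2

theorem exp_arg_spectrum_unitary (z : spectrum ℂ (U : H →L[ℂ] H)) :
    Complex.exp (Complex.arg z * Complex.I) = z := by
  have := Complex.norm_mul_exp_arg_mul_I z
  rwa [norm_spectrum_unitary, Complex.ofReal_one, one_mul] at this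

/-- The scalar spectral measure of a unitary operator, transported to the line by the argument. -/
noncomputable def angleMeasure (x : H) : Measure ℝ :=
  (vectorMeasure (unitaryRep U) x).map fun z : spectrum ℂ (U : H →L[ℂ] H) => Complex.arg z

theorem measurable_arg_spectrum : Measurable fun z : spectrum ℂ (U : H →L[ℂ] H) =>
    Complex.arg z := Complex.measurable_arg.comp measurable_subtype_coe

instance (x : H) : IsFiniteMeasure (angleMeasure U x) := by
  unfold angleMeasure; infer_instance

theorem angleMeasure_real_univ (x : H) : (angleMeasure U x).real Set.univ = ‖x‖ ^ 2 := by
  rw [angleMeasure, map_measureReal_apply (measurable_arg_spectrum U) MeasurableSet.univ,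
    Set.preimage_univ, vectorMeasure_real_univ]

theorem integral_angleMeasure {F : Type*} [NormedAddCommGroup F] [NormedSpace ℝ F]
    [SecondCountableTopology F] (x : H)
    {f : ℝ → F} (hf : Continuous f) : ∫ t, f t ∂(angleMeasure U x) =
      ∫ z : spectrum ℂ (U : H →L[ℂ] H), f (Complex.arg z) ∂(vectorMeasure (unitaryRep U) x) := by
  rw [angleMeasure, integral_map (measurable_arg_spectrum U).aemeasurable
    hf.aestronglyMeasurable]

/-- The argument is a measurable section of `t ↦ e^{it}`; its jump at `-1` is harmless because `f
(e^{it})` is continuous in `t`. -/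
theorem inner_unitaryFunction {f : Circle → ℂ} (hf : Continuous f) (x : H) :
    ⟪x, unitaryFunction f U x⟫_ℂ = ∫ t, f (Circle.exp t) ∂(angleMeasure U x) := by
  let c : spectrum ℂ (U : H →L[ℂ] H) → Circle := fun z => ⟨z, by
    simpa [Submonoid.unitSphere] using norm_spectrum_unitary U z⟩
  have hc : Continuous c := continuous_subtype_val.subtype_mk _
  have ext : ∀ z : spectrum ℂ (U : H →L[ℂ] H),
      Function.extend (fun z : Circle => (z : ℂ)) f 0 z = f (c z) := fun z =>
    Function.Injective.extend_apply Subtype.val_injective f 0 (c z)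
  have hcont : ContinuousOn (Function.extend (fun z : Circle => (z : ℂ)) f 0)
      (spectrum ℂ (U : H →L[ℂ] H)) := by
    rw [continuousOn_iff_continuous_domRestrict]
    exact (hf.comp hc).congr fun z => (ext z).symm
  rw [unitaryFunction, cfc_apply _ _ (inferInstanceAs (IsStarNormal (U : H →L[ℂ] H))) hcont]
  change ⟪x, unitaryRep U _ x⟫_ℂ = _
  rw [CStarRepresentation.inner_apply, integral_angleMeasure U x (by fun_prop)]
  refine integral_congr_ae (Eventually.of_forall fun z => ?_)
  refine (ext z).trans (congrArg f (Circle.ext ?_))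
  rw [Circle.coe_exp, exp_arg_spectrum_unitary]

variable {s : ℝ}

theorem sub_ne_zero_of_spectrum_unitary (hs : 0 < s) (t : ℝ)
    (z : spectrum ℂ (U : H →L[ℂ] H)) :
    Complex.exp (t * Complex.I) - Real.exp (-s) * z ≠ 0 := by
  have h1 := one_sub_exp_le_norm s (Complex.arg z) t
  have h2 : 0 < 1 - Real.exp (-s) := sub_pos.2 (by simpa using hs)
  rw [exp_arg_spectrum_unitary] at h1
  exact norm_pos_iff.1 (h2.trans_le h1)

/-- The function `z ↦ (e^{it} - e^{-s} z)⁻¹` on the spectrum of a unitary operator. -/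
noncomputable def resolventMap (hs : 0 < s) (t : ℝ) : C(spectrum ℂ (U : H →L[ℂ] H), ℂ) where
  toFun z := (Complex.exp (t * Complex.I) - Real.exp (-s) * z)⁻¹
  continuous_toFun := Continuous.inv₀ (by fun_prop) (sub_ne_zero_of_spectrum_unitary U hs t)

theorem unitaryRep_smul_one_sub (a b : ℂ) :
    unitaryRep U (a • 1 - b • (ContinuousMap.id ℂ).restrict (spectrum ℂ (U : H →L[ℂ] H))) =
      a • 1 - b • (U : H →L[ℂ] H) := by
  rw [map_sub, map_smul, map_smul, map_one, unitaryRep_id]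

theorem unitaryRep_resolventMap_mul (hs : 0 < s) (t : ℝ) :
    unitaryRep U (resolventMap U hs t) *
      (Complex.exp (t * Complex.I) • 1 - (Real.exp (-s) : ℂ) • (U : H →L[ℂ] H)) = 1 := by
  rw [← unitaryRep_smul_one_sub, ← map_mul, ← map_one (unitaryRep U)]
  congr 1
  ext z
  simp only [ContinuousMap.mul_apply, ContinuousMap.sub_apply, ContinuousMap.smul_apply,
    ContinuousMap.one_apply, smul_eq_mul, mul_one]
  exact inv_mul_cancel₀ (sub_ne_zero_of_spectrum_unitary U hs t z)

theorem mul_unitaryRep_resolventMap (hs : 0 < s) (t : ℝ) :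
    (Complex.exp (t * Complex.I) • 1 - (Real.exp (-s) : ℂ) • (U : H →L[ℂ] H)) *
      unitaryRep U (resolventMap U hs t) = 1 := by
  rw [← unitaryRep_smul_one_sub, ← map_mul, ← map_one (unitaryRep U)]
  congr 1
  ext z
  simp only [ContinuousMap.mul_apply, ContinuousMap.sub_apply, ContinuousMap.smul_apply,
    ContinuousMap.one_apply, smul_eq_mul, mul_one]
  exact mul_inv_cancel₀ (sub_ne_zero_of_spectrum_unitary U hs t z)

/-- The second resolvent identity for `(e^{it} - e^{-s} U)⁻¹`. -/
theorem resolventMap_sub (hs : 0 < s) (t : ℝ) :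
    unitaryRep U (resolventMap U hs t) - unitaryRep V (resolventMap V hs t) =
      (Real.exp (-s) : ℂ) • (unitaryRep U (resolventMap U hs t) *
        ((U : H →L[ℂ] H) - V) * unitaryRep V (resolventMap V hs t)) := by
  set G := unitaryRep U (resolventMap U hs t)
  set G' := unitaryRep V (resolventMap V hs t)
  have h1 := unitaryRep_resolventMap_mul U hs t
  have h2 := mul_unitaryRep_resolventMap V hs t
  have e : (Real.exp (-s) : ℂ) • ((U : H →L[ℂ] H) - V) =
      (Complex.exp (t * Complex.I) • 1 - (Real.exp (-s) : ℂ) • (V : H →L[ℂ] H)) -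
      (Complex.exp (t * Complex.I) • 1 - (Real.exp (-s) : ℂ) • (U : H →L[ℂ] H)) := by
    rw [smul_sub]; abel
  rw [← smul_mul_assoc, ← mul_smul_comm, e, mul_sub, sub_mul, mul_assoc, h2, h1, mul_one, one_mul]

theorem circleKernel_arg (hs : 0 < s) (t : ℝ) (z : spectrum ℂ (U : H →L[ℂ] H)) :
    circleKernel s (Complex.arg z) t =
      (1 - Real.exp (-s) ^ 2) * ‖resolventMap U hs t z‖ ^ 2 := by
  rw [circleKernel_eq, exp_arg_spectrum_unitary, resolventMap, ContinuousMap.coe_mk, norm_inv,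
    inv_pow, div_eq_mul_inv]

/-- The Poisson kernel is the real part of the Herglotz kernel. This expression is affine in the
resolvent and serves for subtracting two operators; `circleKernel_arg` is quadratic and serves for
the bound. -/
theorem circleKernel_arg_eq_re (hs : 0 < s) (t : ℝ) (z : spectrum ℂ (U : H →L[ℂ] H)) :
    circleKernel s (Complex.arg z) t =
      2 * (Complex.exp (t * Complex.I) * resolventMap U hs t z).re - 1 := by
  have h0 := sub_ne_zero_of_spectrum_unitary U hs t z
  have h1 : Complex.exp (t * Complex.I) * resolventMap U hs t z * 2 - 1 =
      herglotzRieszKernel 0 (Complex.exp (-s + Complex.arg z * Complex.I))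
        (Complex.exp (t * Complex.I)) := by
    rw [herglotzRieszKernel_def, Complex.exp_add, exp_arg_spectrum_unitary, sub_zero, sub_zero,
      resolventMap, ContinuousMap.coe_mk, ← Complex.ofReal_neg, ← Complex.ofReal_exp]
    field_simp
    ring
  rw [circleKernel, poissonKernel_eq_re_herglotzRieszKernel, Function.comp_apply, ← h1]
  simp
  ring

theorem circleDensity_angleMeasure_eq_integral (hs : 0 < s) (t : ℝ) (x : H) :
    circleDensity s (angleMeasure U x) t =
      ∫ z : spectrum ℂ (U : H →L[ℂ] H), circleKernel s (Complex.arg z) t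
        ∂(vectorMeasure (unitaryRep U) x) := by
  have hc : Continuous fun u => circleKernel s u t :=
    (continuous_circleKernel hs).comp (f := fun u => (u, t)) (by fun_prop)
  rw [circleDensity, integral_angleMeasure U x hc]

theorem circleDensity_angleMeasure (hs : 0 < s) (t : ℝ) (x : H) :
    circleDensity s (angleMeasure U x) t =
      (1 - Real.exp (-s) ^ 2) * ‖unitaryRep U (resolventMap U hs t) x‖ ^ 2 := by
  rw [circleDensity_angleMeasure_eq_integral U hs,
    CStarRepresentation.norm_apply_sq (unitaryRep U) (resolventMap U hs t) x, ← integral_const_mul]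
  exact integral_congr_ae (Eventually.of_forall (circleKernel_arg U hs t))

theorem norm_adjoint_resolventMap (hs : 0 < s) (t : ℝ) (x : H) :
    ‖ContinuousLinearMap.adjoint (unitaryRep U (resolventMap U hs t)) x‖ ^ 2 =
      ‖unitaryRep U (resolventMap U hs t) x‖ ^ 2 := by
  rw [← ContinuousLinearMap.star_eq_adjoint, ← map_star, CStarRepresentation.norm_apply_sq,
    CStarRepresentation.norm_apply_sq]
  simp only [ContinuousMap.star_apply, norm_star]

theorem circleDensity_angleMeasure_eq_re (hs : 0 < s) (t : ℝ) (x : H) :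
    circleDensity s (angleMeasure U x) t =
      2 * (Complex.exp (t * Complex.I) * ⟪x, unitaryRep U (resolventMap U hs t) x⟫_ℂ).re -
        ‖x‖ ^ 2 := by
  set g : spectrum ℂ (U : H →L[ℂ] H) → ℂ :=
    fun z => Complex.exp (t * Complex.I) * resolventMap U hs t z with hg
  set ρ := vectorMeasure (unitaryRep U) x with hρ
  have hi : Integrable g ρ := (integrable_continuousMap ρ (resolventMap U hs t)).const_mul _
  have hi' : Integrable (fun z => (g z).re) ρ := hi.re
  have h1 : Complex.exp (t * Complex.I) * ⟪x, unitaryRep U (resolventMap U hs t) x⟫_ℂ =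
      ∫ z, g z ∂ρ := by
    rw [CStarRepresentation.inner_apply (unitaryRep U) (resolventMap U hs t) x, hg,
      integral_const_mul]
  have h2 : (∫ z, g z ∂ρ).re = ∫ z, (g z).re ∂ρ := (integral_re hi).symm
  have h3 : ∫ z, (2 * (g z).re - 1) ∂ρ = 2 * ∫ z, (g z).re ∂ρ - ρ.real Set.univ := by
    rw [integral_sub (hi'.const_mul 2) (integrable_const _), integral_const_mul]
    simp
  rw [circleDensity_angleMeasure_eq_integral U hs, h1, h2,
    ← vectorMeasure_real_univ (unitaryRep U), ← h3]
  exact integral_congr_ae (Eventually.of_forall (circleKernel_arg_eq_re U hs t))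

theorem abs_circleDensity_sub_le (hs : 0 < s) (t : ℝ) (x : H) :
    |circleDensity s (angleMeasure U x) t - circleDensity s (angleMeasure V x) t| ≤
      ‖(U : H →L[ℂ] H) - V‖ / s / 2 *
        (circleDensity s (angleMeasure U x) t + circleDensity s (angleMeasure V x) t) := by
  set κ := ‖(U : H →L[ℂ] H) - V‖ with hκ
  set r := Real.exp (-s) with hr
  have hr0 : 0 < r := Real.exp_pos _
  have hr1 : r < 1 := by simpa [hr] using hs
  have hr2 : 0 < 1 - r ^ 2 := by nlinarith
  -- This is `s ≤ sinh s` multiplied by `2 e^{-s}`. It trades the factor `r` of the resolvent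
  -- identity for `(1 - r²) / 2s`, the normalisation of the densities.
  have hsr : 2 * s * r ≤ 1 - r ^ 2 := by
    have h1 := Real.self_le_sinh_iff.2 hs.le
    rw [Real.sinh_eq, ← hr] at h1
    have h2 : Real.exp s * r = 1 := by rw [hr, ← Real.exp_add]; simp
    nlinarith
  set a := ‖unitaryRep U (resolventMap U hs t) x‖ with ha
  set b := ‖unitaryRep V (resolventMap V hs t) x‖ with hb
  have h1 : |circleDensity s (angleMeasure U x) t - circleDensity s (angleMeasure V x) t| ≤
      2 * (r * (a * κ * b)) := by
    rw [circleDensity_angleMeasure_eq_re U hs, circleDensity_angleMeasure_eq_re V hs,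
      sub_sub_sub_cancel_right, ← mul_sub, ← Complex.sub_re, ← mul_sub, ← inner_sub_right,
      ← sub_apply, resolventMap_sub, abs_mul, abs_two]
    gcongr
    refine (Complex.abs_re_le_norm _).trans ?_
    rw [norm_mul, Complex.norm_exp_ofReal_mul_I, one_mul, smul_apply, inner_smul_right, norm_mul,
      Complex.norm_real, Real.norm_of_nonneg hr0.le, mul_apply_eq_comp, mul_apply_eq_comp,
      ← ContinuousLinearMap.adjoint_inner_left]
    gcongr
    refine (norm_inner_le_norm _ _).trans ?_
    have h3 := norm_adjoint_resolventMap U hs t x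
    rw [sq_eq_sq₀ (norm_nonneg _) (norm_nonneg _)] at h3
    rw [h3, mul_assoc]
    gcongr
    exact ContinuousLinearMap.le_opNorm _ _
  refine h1.trans ?_
  rw [circleDensity_angleMeasure U hs, circleDensity_angleMeasure V hs, ← ha, ← hb, ← hr]
  have h4 : 2 * (a * b) ≤ a ^ 2 + b ^ 2 := by nlinarith [sq_nonneg (a - b)]
  have h5 : r ≤ (1 - r ^ 2) / s / 2 := by
    rw [div_div, le_div_iff₀ (by positivity)]
    linarith
  have hκ0 : 0 ≤ κ := norm_nonneg _
  calc 2 * (r * (a * κ * b)) = κ * r * (2 * (a * b)) := by ring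
    _ ≤ κ * ((1 - r ^ 2) / s / 2) * (a ^ 2 + b ^ 2) := by gcongr
    _ = _ := by ring

/-- **Bernstein inequality** for Poisson integrals of functions of unitary operators. -/
theorem unitary_bernstein {s : ℝ≥0} (hs : s ≠ 0) (x : H) {h : ℝ → ℂ} (hc : Continuous h)
    (hp : Function.Periodic h (2 * Real.pi)) {M : ℝ} (hM : ∀ x, ‖h x‖ ≤ M) :
    ‖∫ t, poissonIntegral s h t ∂(angleMeasure U x) -
      ∫ t, poissonIntegral s h t ∂(angleMeasure V x)‖ ≤
        M * (‖(U : H →L[ℂ] H) - V‖ / s) * ‖x‖ ^ 2 := by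
  have hs' : (0 : ℝ) < s := by positivity
  rw [integral_poissonIntegral_of_periodic hs _ hc hp hM,
    integral_poissonIntegral_of_periodic hs _ hc hp hM]
  exact norm_integral_smul_sub_le (integrable_circleDensity hs' _) (integrable_circleDensity hs' _)
    (by positivity)
    (by rw [integral_circleDensity hs', angleMeasure_real_univ])
    (by rw [integral_circleDensity hs', angleMeasure_real_univ])
    (fun t => abs_circleDensity_sub_le U V hs' t x) hc hM

end UnitaryOperators

end

/-! ### Hölder estimates for functions of operators. -/

section

open MeasureTheory Filter Topology

section HolderEstimates

/-- Covers `κ = 0`, where no starting scale exists: the hypothesis persists for `κ + δ`, and `δ → 0`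
is allowed because `α > 0`. -/
theorem holder_of_bernstein {μ ν : Measure ℝ} [IsFiniteMeasure μ] [IsFiniteMeasure ν]
    {m p : ℝ} (hμ : μ.real Set.univ ≤ m) (hν : ν.real Set.univ ≤ m) {κ : ℝ≥0}
    (hB : ∀ h : ℝ → ℂ, Continuous h → Function.Periodic h p → ∀ M : ℝ, (∀ x, ‖h x‖ ≤ M) →
      ∀ s : ℝ≥0, s ≠ 0 →
        ‖∫ x, poissonIntegral s h x ∂μ - ∫ x, poissonIntegral s h x ∂ν‖ ≤ M / s * κ * m)
    {F : ℝ → ℂ} (hp : Function.Periodic F p) (iμ : Integrable F μ) (iν : Integrable F ν)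
    {C α : ℝ} (h0 : 0 < α) (h1 : α < 1) (hC : 0 ≤ C)
    (hH : ∀ x y, ‖F x - F y‖ ≤ C * |x - y| ^ α) :
    ‖∫ x, F x ∂μ - ∫ x, F x ∂ν‖ ≤ 66 * (1 - α)⁻¹ * C * (κ : ℝ) ^ α * m := by
  have hm : 0 ≤ m := measureReal_nonneg.trans hμ
  have lim : Tendsto (fun δ : ℝ => 66 * (1 - α)⁻¹ * C * ((κ : ℝ) + δ) ^ α * m) (𝓝[>] 0)
      (𝓝 (66 * (1 - α)⁻¹ * C * ((κ : ℝ) + 0) ^ α * m)) := by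
    have : Continuous fun δ : ℝ => 66 * (1 - α)⁻¹ * C * ((κ : ℝ) + δ) ^ α * m :=
      ((continuous_const.mul ((Real.continuous_rpow_const h0.le).comp
        (continuous_const.add continuous_id))).mul continuous_const)
    exact (this.tendsto 0).mono_left nhdsWithin_le_nhds
  rw [add_zero] at lim
  refine ge_of_tendsto lim (eventually_mem_nhdsWithin.mono fun δ (hδ : 0 < δ) => ?_)
  lift δ to ℝ≥0 using hδ.le
  have hδ' : 0 < δ := by exact_mod_cast hδ
  have := holder_of_bernstein_of_ne_zero hμ hν (κ := κ + δ) (by positivity)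
    (fun h hc hp M hM s hs => ?_)
    hp iμ iν h0 h1 hC hH
  · exact_mod_cast this
  · have hM0 : 0 ≤ M := (norm_nonneg _).trans (hM 0)
    refine (hB h hc hp M hM s hs).trans ?_
    gcongr
    exact le_self_add

theorem MemHolder.norm_sub_le {X : Type*} [MetricSpace X] {α : ℝ≥0} {f : X → ℂ}
    (hf : MemHolder α f) (x y : X) : ‖f x - f y‖ ≤ nnHolderNorm α f * dist x y ^ (α : ℝ) := by
  rw [← dist_eq_norm]
  exact hf.holderWith.dist_le x y

variable {H : Type*} [NormedAddCommGroup H] [InnerProductSpace ℂ H] [CompleteSpace H]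

theorem dist_circle_exp_le (x y : ℝ) : dist (Circle.exp x) (Circle.exp y) ≤ |x - y| := by
  change dist (Circle.exp x : ℂ) (Circle.exp y) ≤ _
  rw [dist_eq_norm, Circle.coe_exp, Circle.coe_exp]
  have h : Complex.exp (x * Complex.I) - Complex.exp (y * Complex.I) =
      Complex.exp (y * Complex.I) * (Complex.exp (Complex.I * (x - y : ℝ)) - 1) := by
    rw [mul_sub, mul_one, ← Complex.exp_add]
    congr 2
    push_cast
    ring
  rw [h, norm_mul, Complex.norm_exp_ofReal_mul_I, one_mul]
  exact Real.norm_exp_I_mul_ofReal_sub_one_le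

/-- **Hölder estimate for functions of unitary operators.** -/
theorem norm_unitaryFunction_sub_le {α : ℝ≥0} (h0 : 0 < α) (h1 : α < 1) {f : Circle → ℂ}
    (hf : MemHolder α f) (U V : unitary (H →L[ℂ] H)) :
    ‖unitaryFunction f U - unitaryFunction f V‖ ≤ 132 * (1 - (α : ℝ))⁻¹ * nnHolderNorm α f *
      ‖(U : H →L[ℂ] H) - V‖ ^ (α : ℝ) := by
  have h0' : (0 : ℝ) < α := h0
  have h1' : (α : ℝ) < 1 := h1
  have h1'' : (0 : ℝ) < 1 - α := sub_pos.2 h1'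
  have hc : Continuous f := hf.holderWith.continuous h0
  have hcF : Continuous fun t => f (Circle.exp t) := hc.comp Circle.exp.continuous
  obtain ⟨M, hM⟩ := (isCompact_range hc).isBounded.exists_norm_le
  have hM' : ∀ t, ‖f (Circle.exp t)‖ ≤ M := fun t => hM _ ⟨_, rfl⟩
  have key : ∀ x : H, ‖⟪x, (unitaryFunction f U - unitaryFunction f V) x⟫_ℂ‖ ≤
      66 * (1 - (α : ℝ))⁻¹ * nnHolderNorm α f * ‖(U : H →L[ℂ] H) - V‖ ^ (α : ℝ) * ‖x‖ ^ 2 := by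
    intro x
    rw [sub_apply, inner_sub_right, inner_unitaryFunction U hc, inner_unitaryFunction V hc]
    refine holder_of_bernstein (angleMeasure_real_univ U x).le (angleMeasure_real_univ V x).le
      (κ := ‖(U : H →L[ℂ] H) - V‖₊) (p := 2 * Real.pi) (fun h hc hp M hM s hs => ?_)
      (fun t => by rw [Circle.periodic_exp]) (integrable_of_bounded hcF hM')
      (integrable_of_bounded hcF hM') h0' h1' (NNReal.coe_nonneg _) fun t u => ?_
    · refine (unitary_bernstein U V hs x hc hp hM).trans (le_of_eq ?_)
      rw [coe_nnnorm]
      ring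
    · refine (hf.norm_sub_le _ _).trans ?_
      gcongr
      -- A chord is no longer than its arc, so lifting `f` to the line keeps its Hölder constant.
      exact dist_circle_exp_le t u
  refine ContinuousLinearMap.opNorm_le_bound _ (by positivity) fun x => ?_
  -- Passing from the form to the norm doubles `66` to `132`.
  have h2 := norm_le_of_norm_inner_self_le (D := ⊤) (by simp)
      ((unitaryFunction f U - unitaryFunction f V : H →L[ℂ] H).toLinearMap ∘ₗ
        (⊤ : Submodule ℂ H).subtype) (fun y => key y) ⟨x, trivial⟩
  refine h2.trans (le_of_eq ?_)
  ring

/-- Growth at most linear puts the domain of `A` inside that of `f(A)`. -/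
theorem MemHolder.norm_le_of_lt_one {α : ℝ≥0} (h1 : α < 1) {f : ℝ → ℂ} (hf : MemHolder α f)
    (t : ℝ) : ‖f t‖ ≤ ‖f 0‖ + nnHolderNorm α f + nnHolderNorm α f * ‖(t : ℂ)‖ := by
  have h := hf.norm_sub_le t 0
  have h2 : |t| ^ (α : ℝ) ≤ 1 + |t| := by
    calc |t| ^ (α : ℝ) ≤ (1 + |t|) ^ (α : ℝ) := by gcongr; linarith
      _ ≤ (1 + |t|) ^ (1 : ℝ) :=
        Real.rpow_le_rpow_of_exponent_le (by linarith [abs_nonneg t]) (by exact_mod_cast h1.le)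
      _ = _ := Real.rpow_one _
  rw [Real.dist_eq, sub_zero] at h
  rw [Complex.norm_real, Real.norm_eq_abs]
  have h3 : (nnHolderNorm α f : ℝ) * |t| ^ (α : ℝ) ≤ nnHolderNorm α f * (1 + |t|) := by gcongr
  have h4 := norm_sub_norm_le (f t) (f 0)
  linarith

theorem MemHolder.memLp {α : ℝ≥0} (h0 : 0 < α) (h1 : α < 1) {f : ℝ → ℂ} (hf : MemHolder α f)
    {μ : Measure ℝ} [IsFiniteMeasure μ] (hμ : MemLp (fun t : ℝ => (t : ℂ)) 2 μ) : MemLp f 2 μ := by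
  have h2 : MemLp (fun _ : ℝ => ‖f 0‖ + nnHolderNorm α f) 2 μ := memLp_const _
  have h3 : MemLp (fun t : ℝ => nnHolderNorm α f * ‖(t : ℂ)‖) 2 μ := hμ.norm.const_mul _
  exact (h2.add h3).mono' (hf.holderWith.continuous h0).aestronglyMeasurable
    (Eventually.of_forall (hf.norm_le_of_lt_one h1))

namespace RealSpectralMeasure

/-- Every vector in the domain of `∫ f(t) dE(t)` is a limit, in the graph norm, of vectors in the
domain of `∫ t dE(t)`. -/
theorem exists_tendsto_vectorIntegral (E : RealSpectralMeasure H) {f : ℝ → ℂ} (hf : Measurable f)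
    {x : H} (hfx : MemLp f 2 (E.scalarMeasure x)) :
    ∃ u : ℕ → H, (∀ n, MemLp (fun t : ℝ => (t : ℂ)) 2 (E.scalarMeasure (u n))) ∧
      Tendsto u atTop (𝓝 x) ∧
      Tendsto (fun n => E.vectorIntegral f (u n)) atTop (𝓝 (E.vectorIntegral f x)) := by
  set S : ℕ → Set ℝ := fun n => {t | |t| ≤ n} with hS
  have mS : ∀ n, MeasurableSet (S n) := fun n => measurableSet_le (by fun_prop) measurable_const
  have eS : ∀ t, ∀ᶠ n in atTop, t ∈ S n := fun t => by
    obtain ⟨N, hN⟩ := exists_nat_ge |t|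
    filter_upwards [eventually_ge_atTop N] with n hn
    exact hN.trans (by exact_mod_cast hn)
  set g : ℕ → ℝ → ℂ := fun n => (S n).indicator fun _ => 1 with hg
  have mg : ∀ n, Measurable (g n) := fun n => measurable_const.indicator (mS n)
  have mul : ∀ (h : ℝ → ℂ) n, h * g n = (S n).indicator h := fun h n => by
    ext t
    by_cases ht : t ∈ S n <;> simp [hg, ht]
  have lg : ∀ n, MemLp (g n) 2 (E.scalarMeasure x) := fun n =>
    (E.memLp_of_bound x measurable_const (C := 1) (by simp)).indicator (mS n)
  have mid : Measurable fun t : ℝ => (t : ℂ) := by fun_prop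
  refine ⟨fun n => E.vectorIntegral (g n) x, fun n => ⟨mid.aestronglyMeasurable, ?_⟩, ?_, ?_⟩
  · rw [eLpNorm_scalarMeasure_vectorIntegral _ mid (mg n) (lg n), mul]
    refine (E.memLp_of_bound x (mid.indicator (mS n)) (C := n) fun t => ?_).2
    by_cases ht : t ∈ S n
    · rw [Set.indicator_of_mem ht, Complex.norm_real]
      exact ht
    · rw [Set.indicator_of_notMem ht, norm_zero]
      exact n.cast_nonneg
  · have := E.tendsto_vectorIntegral_indicator mS eS (f := fun _ => 1) measurable_const
      (E.memLp_of_bound x measurable_const (C := 1) (by simp))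
    rwa [vectorIntegral_one] at this
  · refine (E.tendsto_vectorIntegral_indicator mS eS hf hfx).congr fun n => ?_
    rw [vectorIntegral_vectorIntegral _ hf (mg n) (lg n) (by
      rw [mul]; exact hfx.indicator (mS n)), mul]

end RealSpectralMeasure

open RealSpectralMeasure in
/-- **Hölder estimate for functions of self-adjoint operators.** -/
theorem exists_isBoundedDifference_operatorFunction {α : ℝ≥0} (h0 : 0 < α) (h1 : α < 1)
    {f : ℝ → ℂ} (hf : MemHolder α f) {A B : H →ₗ.[ℂ] H} (hA : IsSelfAdjoint A)
    (hB : IsSelfAdjoint B) {K : H →L[ℂ] H} (hK : IsBoundedDifference A B K) :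
    ∃ L : H →L[ℂ] H, IsBoundedDifference (operatorFunction f A) (operatorFunction f B) L ∧
      ‖L‖ ≤ 132 * (1 - (α : ℝ))⁻¹ * nnHolderNorm α f * ‖K‖ ^ (α : ℝ) := by
  have h0' : (0 : ℝ) < α := h0
  have h1' : (α : ℝ) < 1 := h1
  have h1'' : (0 : ℝ) < 1 - α := sub_pos.2 h1'
  have hm : Measurable f := (hf.holderWith.continuous h0).measurable
  have mid : Measurable fun t : ℝ => (t : ℂ) := by fun_prop
  -- Whichever spectral measure underlies the choice in `operatorFunction`, it represents `A` as
  -- well as `f(A)`; no uniqueness of the measure is needed.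
  obtain ⟨EA, hEA, hTA⟩ := hA.isFunctionOfOperator hm
  obtain ⟨EB, hEB, hTB⟩ := hB.isFunctionOfOperator hm
  set TA := operatorFunction f A
  set TB := operatorFunction f B
  have domA : A.domain ≤ TA.domain := fun x hx => (IsIntegral.mem_domain_iff EA hm hTA).2
    (hf.memLp h0 h1 ((IsIntegral.mem_domain_iff EA mid hEA).1 hx))
  have domB : B.domain ≤ TB.domain := fun x hx => (IsIntegral.mem_domain_iff EB hm hTB).2
    (hf.memLp h0 h1 ((IsIntegral.mem_domain_iff EB mid hEB).1 hx))
  have dA : Dense (TA.domain : Set H) := hA.dense_domain.mono domA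
  have dB : Dense (TB.domain : Set H) := hB.dense_domain.mono domB
  -- The estimate is first made on the domain of `B`, which is dense and on which both `f(A)` and
  -- `f(B)` are defined.
  let S : B.domain →ₗ[ℂ] H := TA.toFun ∘ₗ Submodule.inclusion (hK.1.trans domA) -
    TB.toFun ∘ₗ Submodule.inclusion domB
  have hS : ∀ x : B.domain, S x = TA ⟨x, hK.1.trans domA x.2⟩ - TB ⟨x, domB x.2⟩ := fun x => rfl
  have bound : ∀ x : B.domain, ‖S x‖ ≤
      132 * (1 - (α : ℝ))⁻¹ * nnHolderNorm α f * ‖K‖ ^ (α : ℝ) * ‖(x : H)‖ := by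
    intro x
    refine (norm_le_of_norm_inner_self_le hB.dense_domain S
      (C := 66 * (1 - (α : ℝ))⁻¹ * nnHolderNorm α f * ‖K‖ ^ (α : ℝ)) (fun y => ?_) x).trans
      (le_of_eq (by ring))
    rw [hS, inner_sub_right, hTA.2 ⟨y, _⟩, hTB.2 ⟨y, _⟩]
    -- Period `0` imposes no condition, which is how the periodic formulation covers the line.
    refine holder_of_bernstein (scalarMeasure_real_univ EA _).le (scalarMeasure_real_univ EB _).le
      (κ := ‖K‖₊) (p := 0) (fun h hc hp M hM s hs => ?_) (fun t => by rw [add_zero])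
      (((IsIntegral.mem_domain_iff EA hm hTA).1 (hK.1.trans domA y.2)).integrable (by norm_num))
      (((IsIntegral.mem_domain_iff EB hm hTB).1 (domB y.2)).integrable (by norm_num))
      h0' h1' (NNReal.coe_nonneg _) fun t u => hf.norm_sub_le t u
    refine (bernstein hEA hEB hA.dense_domain hB.dense_domain hK hs (y : H) hc hM).trans
      (le_of_eq ?_)
    rw [coe_nnnorm]
    ring
  have dr : DenseRange B.domain.subtype := by
    simpa [DenseRange] using hB.dense_domain
  let L : H →L[ℂ] H := S.extendOfNorm B.domain.subtype
  have hL : ∀ x : B.domain, L x = S x := fun x => LinearMap.extendOfNorm_eq dr ⟨_, bound⟩ x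
  -- The domain of `f(B)` may exceed that of `B`. Approximating `b` from the latter in the graph
  -- norm of `f(B)` makes `f(A) u_n = f(B) u_n + L u_n` converge, and `f(A)` is closed.
  have ext : ∀ b : TB.domain, ∃ h : (b : H) ∈ TA.domain, TA ⟨b, h⟩ = TB b + L b := by
    intro b
    obtain ⟨u, hu, hux, huf⟩ := EB.exists_tendsto_vectorIntegral hm
      ((IsIntegral.mem_domain_iff EB hm hTB).1 b.2)
    have uB : ∀ n, u n ∈ B.domain := fun n => (IsIntegral.mem_domain_iff EB mid hEB).2 (hu n)
    have lim : Tendsto (fun n => EA.vectorIntegral f (u n)) atTop (𝓝 (TB b + L b)) := by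
      rw [IsIntegral.apply_eq EB hm hTB dB]
      refine (huf.add ((L.continuous.tendsto _).comp hux)).congr fun n => ?_
      have h2 := hL ⟨u n, uB n⟩
      rw [hS, IsIntegral.apply_eq EA hm hTA dA, IsIntegral.apply_eq EB hm hTB dB] at h2
      exact eq_add_of_sub_eq' h2.symm |>.symm
    obtain ⟨h3, h4⟩ := EA.integral_closed hm
      (fun n => (IsIntegral.mem_domain_iff EA hm hTA).1 (hK.1.trans domA (uB n))) hux lim
    refine ⟨(IsIntegral.mem_domain_iff EA hm hTA).2 h3, ?_⟩
    rw [IsIntegral.apply_eq EA hm hTA dA]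
    exact h4
  refine ⟨L, ⟨fun x hx => (ext ⟨x, hx⟩).1, fun a b hab => ?_⟩,
    LinearMap.opNorm_extendOfNorm_le dr (by positivity) bound⟩
  obtain ⟨h, h2⟩ := ext b
  have : a = ⟨b, h⟩ := Subtype.ext hab
  rw [this, h2, add_sub_cancel_left]

end HolderEstimates

end

theorem mainTheorem6 :
    ∃ c : ℝ, 0 < c ∧ ∀ α : ℝ≥0, 0 < α → α < 1 →
      (∀ f : Circle → ℂ, MemHolder α f →
        ∀ (H : Type*) [NormedAddCommGroup H] [InnerProductSpace ℂ H] [CompleteSpace H]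
          (U V : unitary (H →L[ℂ] H)),
          ‖unitaryFunction f U - unitaryFunction f V‖ ≤
            c * (1 - (α : ℝ))⁻¹ * (nnHolderNorm α f : ℝ) *
              ‖(U : H →L[ℂ] H) - (V : H →L[ℂ] H)‖ ^ (α : ℝ)) ∧
      (∀ f : ℝ → ℂ, MemHolder α f →
        ∀ (H : Type*) [NormedAddCommGroup H] [InnerProductSpace ℂ H] [CompleteSpace H]
          (A B : H →ₗ.[ℂ] H), IsSelfAdjoint A → IsSelfAdjoint B →
          ∀ K : H →L[ℂ] H, IsBoundedDifference A B K →
            ∃ L : H →L[ℂ] H,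
              IsBoundedDifference (operatorFunction f A) (operatorFunction f B) L ∧
              ‖L‖ ≤ c * (1 - (α : ℝ))⁻¹ * (nnHolderNorm α f : ℝ) * ‖K‖ ^ (α : ℝ)) := by
  refine ⟨132, by norm_num, fun α h0 h1 => ⟨fun f hf H _ _ _ U V => ?_,
    fun f hf H _ _ _ A B hA hB K hK => ?_⟩⟩
  · exact norm_unitaryFunction_sub_le h0 h1 hf U V
  · exact exists_isBoundedDifference_operatorFunction h0 h1 hf hA hB hK
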